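/- Let $\pi: M\to\mathbb{R}$ be a fibration (a smooth surjective submersion) of a smooth $(n+1)$-dimensional manifold, $n\ge 0$. Let $V\pi=\ker T\pi$ be its vertical bundle, $\mu: T^*M\to V^*\pi$ the canonical projection (restriction of covectors to vertical vectors), and $\pi_1^*: V^*\pi\to\mathbb{R}$ the induced projection. The additive group $\mathbb{R}$ acts on $T^*M$ by $s\cdot\alpha=\alpha+s\,d\pi$; this makes $\mu$ an AV-bundle (a principal $\mathbb{R}$-bundle). Let $V_\mu$ be the infinitesimal generator of this action. *The Poisson manifold $J^1\pi_1^*$.* Let $J^1\pi_1^*=\{w\in T(V^*\pi)\mid d\pi_1^*(w)=1\}$, an embedded submanifold of $T(V^*\pi)$. Let $\Lambda_{V^*\pi}$ be the canonical Poisson structure of $V^*\pi$, that is, the $\mu$-projection of the canonical Poisson structure of $T^*M$ (locally $\partial_{q^i}\wedge\partial_{p_i}$). Its complete lift to $T(V^*\pi)$ is tangent to $J^1\pi_1^*$ and restricts there to a Poisson structure $\Lambda_{J^1\pi_1^*}$. *The Poisson manifold $P\mu/\langle d\pi_1^*\rangle$.* Let $C=\{\gamma\in T^*(T^*M)\mid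 \gamma(V_\mu)=1\}$. The phase bundle $P\mu=C/\mathbb{R}$ is the space of orbits in $C$ of the cotangent lift of the action of $\mathbb{R}$ on $T^*M$. It carries a canonical symplectic form $\Omega_{P\mu}$, characterized by the property that its pullback to $C$ is the restriction to $C$ of the canonical symplectic form of $T^*(T^*M)$. Let $\Lambda_{P\mu}$ be the associated Poisson structure. Let $P\mu/\langle d\pi_1^*\rangle$ be the quotient of $P\mu$ which identifies $[\gamma]$ with $[\gamma+c\,\mu^*d\pi_1^*]$ for $\gamma \in C$, $c\in\mathbb{R}$. Then $\Lambda_{P\mu}$ projects to a Poisson structure $\widetilde\Lambda_{P\mu}$ on $P\mu/\langle d\pi_1^*\rangle$. *The map $b_\pi$.* Let $\Omega$ be the canonical symplectic form of $T^*M$ (locally $dt\wedge dp+dq^i\wedge dp_i$) and $b_\Omega: T(T^*M)\to T^*(T^*M)$, $b_\Omega(v)=i_v\Omega$. The map $\varphi=T\mu\circ b_\Omega^{-1}: C\to T(V^*\pi)$ takes values in $J^1\pi_1^*$ and induces a diffeomorphism $\widetilde\varphi: P\mu/\langle d\pi_1^*\rangle\to J^1\pi_1^*$. Put $b_\pi=\widetilde\varphi^{-1}$.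 **Theorem.** All the objects above are well defined (in particular, $\Lambda_{V^*\pi}$, $\Lambda_{J^1\pi_1^*}$ and $\widetilde\Lambda_{P\mu}$ exist, are unique, and are Poisson structures, $\Omega_{P\mu}$ exists, is unique, and is symplectic, and $\widetilde\varphi$ is a diffeomorphism), and $$b_\pi: (J^1\pi_1^*,\Lambda_{J^1\pi_1^*})\to (P\mu/\langle d\pi_1^*\rangle,\widetilde\Lambda_{P\mu})$$ is an anti-Poisson isomorphism: it is a diffeomorphism with $(b_\pi)_*\Lambda_{J^1\pi_1^*}=-\widetilde\Lambda_{P\mu}$. -/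

import Mathlib

open scoped Manifold ContDiff Topology
open Bundle (TotalSpace Trivial Trivialization)
open Set

set_option maxSynthPendingDepth 3

noncomputable section

namespace Tulczyjew

section General

variable {E H : Type*} [NormedAddCommGroup E] [NormedSpace ℝ E] [TopologicalSpace H]
  {N : Type*} [TopologicalSpace N] [ChartedSpace H N]
  {E' H' : Type*} [NormedAddCommGroup E'] [NormedSpace ℝ E'] [TopologicalSpace H']
  {N' : Type*} [TopologicalSpace N'] [ChartedSpace H' N']

/-- The cotangent space `T*_x N`. -/
abbrev CotSpace (I : ModelWithCorners ℝ E H) (x : N) : Type _ :=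
  TangentSpace I x →L[ℝ] Trivial N ℝ x

/-- The cotangent bundle `T*N`, with Mathlib's topology and smooth structure on a bundle of
continuous linear maps. -/
abbrev CotBundle (I : ModelWithCorners ℝ E H) (N : Type*) [TopologicalSpace N]
    [ChartedSpace H N] : Type _ :=
  TotalSpace (E →L[ℝ] ℝ) (CotSpace I (N := N))

/-- The model with corners of the cotangent bundle. -/
abbrev cotModel (I : ModelWithCorners ℝ E H) :
    ModelWithCorners ℝ (E × (E →L[ℝ] ℝ)) (ModelProd H (E →L[ℝ] ℝ)) :=
  I.prod 𝓘(ℝ, E →L[ℝ] ℝ)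

instance (I : ModelWithCorners ℝ E H) [IsManifold I ∞ N] : TopologicalSpace (CotBundle I N) :=
  inferInstance

instance (I : ModelWithCorners ℝ E H) [IsManifold I ∞ N] :
    ChartedSpace (ModelProd H (E →L[ℝ] ℝ)) (CotBundle I N) :=
  inferInstance

instance (I : ModelWithCorners ℝ E H) [IsManifold I ∞ N] :
    IsManifold (cotModel I) ∞ (CotBundle I N) :=
  inferInstance

/-- `mfderiv` seen as a map between the model vector spaces. -/
def dmap (I : ModelWithCorners ℝ E H) (I' : ModelWithCorners ℝ E' H') (f : N → N') (x : N) :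
    E →L[ℝ] E' :=
  mfderiv I I' f x

lemma dmap_of (I : ModelWithCorners ℝ E H) (I' : ModelWithCorners ℝ E' H') {f : N → N'} {x : N}
    {L : E →L[ℝ] E'} (h : @HasMFDerivAt ℝ _ E _ _ H _ I N _ _ E' _ _ H' _ I' N' _ _ f x L) :
    dmap I I' f x = L := by
  unfold dmap; exact h.mfderiv

lemma has_dmap (I : ModelWithCorners ℝ E H) (I' : ModelWithCorners ℝ E' H') {f : N → N'} {x : N}
    (h : MDifferentiableAt I I' f x) : HasMFDerivAt I I' f x (dmap (E := E) (E' := E') I I' f x) :=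
  h.hasMFDerivAt

lemma dmap_congr (I : ModelWithCorners ℝ E H) (I' : ModelWithCorners ℝ E' H') {f g : N → N'}
    {x : N} (h : f =ᶠ[𝓝 x] g) : dmap I I' f x = dmap I I' g x := by
  unfold dmap; exact h.mfderiv_eq

lemma dmap_comp {E'' H'' : Type*} [NormedAddCommGroup E''] [NormedSpace ℝ E'']
    [TopologicalSpace H''] {N'' : Type*} [TopologicalSpace N''] [ChartedSpace H'' N'']
    (I : ModelWithCorners ℝ E H) (I' : ModelWithCorners ℝ E' H')
    (I'' : ModelWithCorners ℝ E'' H'') {g : N' → N''} {f : N → N'} {x : N}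
    (hg : MDifferentiableAt I' I'' g (f x)) (hf : MDifferentiableAt I I' f x) :
    dmap I I'' (fun z => g (f z)) x = (dmap I' I'' g (f x)).comp (dmap I I' f x) :=
  dmap_of I I'' ((has_dmap I' I'' hg).comp x (has_dmap I I' hf))

lemma inTC_from (I : ModelWithCorners ℝ E H) [IsManifold I 1 N] (f : E' → N) (D : E' → E' →L[ℝ] E)
    (y₀ y : E') : inTangentCoordinates 𝓘(ℝ, E') I id f D y₀ y =
      ((trivializationAt E (TangentSpace I) (f y₀)).continuousLinearMapAt ℝ (f y)).comp (D y) := by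
  simp only [inTangentCoordinates, ContinuousLinearMap.inCoordinates]
  have h := TangentBundle.symmL_model_space (𝕜 := ℝ) y₀ y
  erw [h]
  rfl

lemma inTC_to (I : ModelWithCorners ℝ E H) [IsManifold I 1 N] (f : N → E') (D : N → E →L[ℝ] E')
    (x₀ x : N) : inTangentCoordinates I 𝓘(ℝ, E') id f D x₀ x =
      (D x).comp ((trivializationAt E (TangentSpace I) x₀).symmL ℝ x) := by
  simp only [inTangentCoordinates, ContinuousLinearMap.inCoordinates]
  have h := TangentBundle.continuousLinearMapAt_model_space (𝕜 := ℝ) (f x₀) (f x)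
  erw [h]
  rfl

lemma cot_inCoordinates (I : ModelWithCorners ℝ E H) [IsManifold I 1 N] (x₀ x : N)
    (a : CotSpace I x) : ContinuousLinearMap.inCoordinates E (TangentSpace I) ℝ (Trivial N ℝ)
      x₀ x x₀ x a =
      ContinuousLinearMap.comp a ((trivializationAt E (TangentSpace I) x₀).symmL ℝ x) := by
  simp only [ContinuousLinearMap.inCoordinates]
  ext v
  simp

/-- A smooth coordinate system of `N` with values in a normed space `G`: a diffeomorphism
of an open subset of `N` onto an open subset of `G`. -/
structure Coord (I : ModelWithCorners ℝ E H) (N : Type*) [TopologicalSpace N] [ChartedSpace H N]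
    (G : Type*) [NormedAddCommGroup G] [NormedSpace ℝ G] where
  src : Set N
  tgt : Set G
  fn : N → G
  inv : G → N
  open_src : IsOpen src
  open_tgt : IsOpen tgt
  map_src : ∀ x ∈ src, fn x ∈ tgt
  map_tgt : ∀ y ∈ tgt, inv y ∈ src
  left_inv : ∀ x ∈ src, inv (fn x) = x
  right_inv : ∀ y ∈ tgt, fn (inv y) = y
  smooth_fn : ContMDiffOn I 𝓘(ℝ, G) ∞ fn src
  smooth_inv : ContMDiffOn 𝓘(ℝ, G) I ∞ inv tgt

namespace Coord

variable {I : ModelWithCorners ℝ E H} {G : Type*} [NormedAddCommGroup G] [NormedSpace ℝ G]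
  (φ : Coord I N G)

/-- The derivative of the coordinates. -/
def dfn (x : N) : E →L[ℝ] G := dmap I 𝓘(ℝ, G) φ.fn x

/-- The derivative of the inverse of the coordinates. -/
def dinv (y : G) : G →L[ℝ] E := dmap 𝓘(ℝ, G) I φ.inv y

lemma contMDiffAt {x : N} (hx : x ∈ φ.src) : ContMDiffAt I 𝓘(ℝ, G) ∞ φ.fn x :=
  φ.smooth_fn.contMDiffAt (φ.open_src.mem_nhds hx)

lemma contMDiffAt_inv {y : G} (hy : y ∈ φ.tgt) : ContMDiffAt 𝓘(ℝ, G) I ∞ φ.inv y :=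
  φ.smooth_inv.contMDiffAt (φ.open_tgt.mem_nhds hy)

lemma mdiff {x : N} (hx : x ∈ φ.src) : MDifferentiableAt I 𝓘(ℝ, G) φ.fn x :=
  (φ.contMDiffAt hx).mdifferentiableAt (by simp)

lemma mdiff_inv {y : G} (hy : y ∈ φ.tgt) : MDifferentiableAt 𝓘(ℝ, G) I φ.inv y :=
  (φ.contMDiffAt_inv hy).mdifferentiableAt (by simp)

lemma dfn_dinv {y : G} (hy : y ∈ φ.tgt) :
    (φ.dfn (φ.inv y)).comp (φ.dinv y) = ContinuousLinearMap.id ℝ G := by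
  rw [dfn, dinv, ← dmap_comp 𝓘(ℝ, G) I 𝓘(ℝ, G) (φ.mdiff (φ.map_tgt y hy)) (φ.mdiff_inv hy),
    dmap_congr 𝓘(ℝ, G) 𝓘(ℝ, G) (g := id)
      (Filter.eventuallyEq_of_mem (φ.open_tgt.mem_nhds hy) φ.right_inv)]
  exact dmap_of _ _ (hasMFDerivAt_id y)

lemma dinv_dfn {x : N} (hx : x ∈ φ.src) :
    (φ.dinv (φ.fn x)).comp (φ.dfn x) = ContinuousLinearMap.id ℝ E := by
  rw [dfn, dinv, ← dmap_comp I 𝓘(ℝ, G) I (φ.mdiff_inv (φ.map_src x hx)) (φ.mdiff hx),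
    dmap_congr I I (g := id)
      (Filter.eventuallyEq_of_mem (φ.open_src.mem_nhds hx) φ.left_inv)]
  exact dmap_of _ _ (hasMFDerivAt_id x)

variable [IsManifold I ∞ N]

/-- The coordinates `(y, p)` of the cotangent bundle induced by coordinates `y` of `N`. -/
def cotFn (γ : CotBundle I N) : G × (G →L[ℝ] ℝ) :=
  (φ.fn γ.1, ContinuousLinearMap.comp (γ.2 : E →L[ℝ] ℝ) (φ.dinv (φ.fn γ.1)))

/-- The inverse of `Coord.cotFn`. -/
def cotInv (z : G × (G →L[ℝ] ℝ)) : CotBundle I N :=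
  ⟨φ.inv z.1, (ContinuousLinearMap.comp z.2 (φ.dfn (φ.inv z.1)) : E →L[ℝ] ℝ)⟩

lemma cotFn_smooth : ContMDiffOn (cotModel I) 𝓘(ℝ, G × (G →L[ℝ] ℝ)) ∞ φ.cotFn
    (TotalSpace.proj ⁻¹' φ.src) := by
  intro γ₀ hγ
  apply ContMDiffAt.contMDiffWithinAt
  have hx : γ₀.1 ∈ φ.src := hγ
  have hp : ContMDiffAt (cotModel I) I ∞ (fun γ : CotBundle I N => γ.1) γ₀ :=
    Bundle.contMDiffAt_proj _
  have h1 := (φ.contMDiffAt hx).comp γ₀ hp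
  have h2 := (contMDiffAt_hom_bundle (IB := I) (n := ∞) (fun γ : CotBundle I N => γ) (x₀ := γ₀)).1
    contMDiffAt_id |>.2
  have h3 := ((φ.contMDiffAt_inv (φ.map_src _ hx)).mfderiv_const (m := ∞) (by simp)).comp γ₀ h1
  have h4 := h2.clm_comp h3
  refine ContMDiffAt.prodMk_space h1 (h4.congr_of_eventuallyEq ?_)
  have ho := (trivializationAt E (TangentSpace I) γ₀.1).open_baseSet.inter φ.open_src
  filter_upwards [hp.continuousAt.preimage_mem_nhds
    (ho.mem_nhds ⟨mem_baseSet_trivializationAt E (TangentSpace I) γ₀.1, hx⟩)] with γ hγ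
  have e1 : φ.inv (φ.fn γ.1) = γ.1 := φ.left_inv _ hγ.2
  have e0 : φ.inv (φ.fn γ₀.1) = γ₀.1 := φ.left_inv _ hx
  have e2 := inTC_from I φ.inv φ.dinv (φ.fn γ₀.1) (φ.fn γ.1)
  rw [e0, e1] at e2
  change _ = ContinuousLinearMap.comp _ (inTangentCoordinates 𝓘(ℝ, G) I id φ.inv φ.dinv
    (φ.fn γ₀.1) (φ.fn γ.1))
  rw [e2, cot_inCoordinates]
  ext v
  have e3 := Trivialization.symmL_continuousLinearMapAt (R := ℝ)
    (trivializationAt E (TangentSpace I) γ₀.1) hγ.1 (φ.dinv (φ.fn γ.1) v)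
  change γ.2 _ = γ.2 _
  exact congrArg γ.2 e3.symm

lemma cotInv_smooth : ContMDiffOn 𝓘(ℝ, G × (G →L[ℝ] ℝ)) (cotModel I) ∞ φ.cotInv
    (φ.tgt ×ˢ univ) := by
  intro z₀ hz
  apply ContMDiffAt.contMDiffWithinAt
  have hp : ContMDiffAt 𝓘(ℝ, G × (G →L[ℝ] ℝ)) 𝓘(ℝ, G) ∞ Prod.fst z₀ :=
    contDiff_fst.contMDiff.contMDiffAt
  have h1 := (φ.contMDiffAt_inv hz.1).comp z₀ hp
  rw [contMDiffAt_hom_bundle]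
  refine ⟨h1, ?_⟩
  have h2 : ContMDiffAt 𝓘(ℝ, G × (G →L[ℝ] ℝ)) 𝓘(ℝ, G →L[ℝ] ℝ) ∞ Prod.snd z₀ :=
    contDiff_snd.contMDiff.contMDiffAt
  have hx : φ.inv z₀.1 ∈ φ.src := φ.map_tgt _ hz.1
  have h3 := ((φ.contMDiffAt hx).mfderiv_const (m := ∞) (by simp)).comp z₀ h1
  refine (h2.clm_comp h3).congr_of_eventuallyEq (Filter.Eventually.of_forall fun z => ?_)
  have e2 := inTC_to I φ.fn φ.dfn (φ.inv z₀.1) (φ.inv z.1)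
  change _ = ContinuousLinearMap.comp _ (inTangentCoordinates I 𝓘(ℝ, G) id φ.fn φ.dfn
    (φ.inv z₀.1) (φ.inv z.1))
  rw [e2]
  exact cot_inCoordinates I _ _ _

/-- The coordinates of `T*N` induced by coordinates of `N`. -/
def cot : Coord (cotModel I) (CotBundle I N) (G × (G →L[ℝ] ℝ)) where
  src := TotalSpace.proj ⁻¹' φ.src
  tgt := φ.tgt ×ˢ univ
  fn := φ.cotFn
  inv := φ.cotInv
  open_src := φ.open_src.preimage (FiberBundle.continuous_proj (E →L[ℝ] ℝ) (CotSpace I))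
  open_tgt := φ.open_tgt.prod isOpen_univ
  map_src := fun γ h => ⟨φ.map_src _ h, mem_univ _⟩
  map_tgt := fun z h => φ.map_tgt _ h.1
  left_inv := by
    rintro ⟨x, a⟩ h
    have hx : x ∈ φ.src := h
    have e := φ.left_inv x hx
    have hv : ∀ a' : E →L[ℝ] ℝ, (a'.comp (φ.dinv (φ.fn x))).comp (φ.dfn x) = a' := fun a' => by
      rw [ContinuousLinearMap.comp_assoc, φ.dinv_dfn hx, ContinuousLinearMap.comp_id]
    have : ∀ y (_ : y = x), (⟨y, (ContinuousLinearMap.comp (ContinuousLinearMap.comp (a : E →L[ℝ] ℝ)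
        (φ.dinv (φ.fn x))) (φ.dfn y) : E →L[ℝ] ℝ)⟩ : CotBundle I N) = ⟨x, a⟩ := by
      rintro y rfl
      exact congrArg (TotalSpace.mk y) (hv a)
    exact this _ e
  right_inv := by
    rintro ⟨y, p⟩ h
    have hy : y ∈ φ.tgt := h.1
    refine Prod.ext (φ.right_inv y hy) ?_
    change (ContinuousLinearMap.comp p (φ.dfn (φ.inv y))).comp (φ.dinv (φ.fn (φ.inv y))) = p
    rw [φ.right_inv y hy, ContinuousLinearMap.comp_assoc, φ.dfn_dinv hy]
    rfl
  smooth_fn := φ.cotFn_smooth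
  smooth_inv := φ.cotInv_smooth

/-- The coordinates `(y, u)` of the tangent bundle induced by coordinates `y` of `N`. -/
def tanFn (w : TangentBundle I N) : G × G := (φ.fn w.1, φ.dfn w.1 w.2)

/-- The inverse of `Coord.tanFn`. -/
def tanInv (z : G × G) : TangentBundle I N := ⟨φ.inv z.1, (φ.dinv z.1 z.2 : E)⟩

lemma tanFn_smooth : ContMDiffOn I.tangent 𝓘(ℝ, G × G) ∞ φ.tanFn
    (TotalSpace.proj ⁻¹' φ.src) := by
  intro w₀ hw
  apply ContMDiffAt.contMDiffWithinAt
  have hx : w₀.1 ∈ φ.src := hw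
  have hp : ContMDiffAt I.tangent I ∞ (fun w : TangentBundle I N => w.1) w₀ :=
    Bundle.contMDiffAt_proj _
  have h1 := (φ.contMDiffAt hx).comp w₀ hp
  have h2 := ((Bundle.contMDiffAt_totalSpace (IB := I) (n := ∞)
    (f := fun w : TangentBundle I N => w) (x₀ := w₀)).1 contMDiffAt_id).2
  have h3 := ((φ.contMDiffAt hx).mfderiv_const (m := ∞) (by simp)).comp w₀ hp
  refine ContMDiffAt.prodMk_space h1 ((h3.clm_apply h2).congr_of_eventuallyEq ?_)
  have ho := (trivializationAt E (TangentSpace I) w₀.1).open_baseSet.inter φ.open_src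
  filter_upwards [hp.continuousAt.preimage_mem_nhds
    (ho.mem_nhds ⟨mem_baseSet_trivializationAt E (TangentSpace I) w₀.1, hx⟩)] with w hw
  have e2 := inTC_to I φ.fn φ.dfn w₀.1 w.1
  change _ = (inTangentCoordinates I 𝓘(ℝ, G) id φ.fn φ.dfn w₀.1 w.1) _
  rw [e2]
  have e3 := Trivialization.symmL_continuousLinearMapAt (R := ℝ)
    (trivializationAt E (TangentSpace I) w₀.1) hw.1 w.2
  rw [Trivialization.continuousLinearMapAt_apply, Trivialization.linearMapAt_apply,
    if_pos hw.1] at e3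
  exact congrArg (φ.dfn w.1) e3.symm

lemma tanInv_smooth : ContMDiffOn 𝓘(ℝ, G × G) I.tangent ∞ φ.tanInv (φ.tgt ×ˢ univ) := by
  intro z₀ hz
  apply ContMDiffAt.contMDiffWithinAt
  have hp : ContMDiffAt 𝓘(ℝ, G × G) 𝓘(ℝ, G) ∞ Prod.fst z₀ :=
    contDiff_fst.contMDiff.contMDiffAt
  have h1 := (φ.contMDiffAt_inv hz.1).comp z₀ hp
  rw [Bundle.contMDiffAt_totalSpace]
  refine ⟨h1, ?_⟩
  have h2 : ContMDiffAt 𝓘(ℝ, G × G) 𝓘(ℝ, G) ∞ Prod.snd z₀ :=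
    contDiff_snd.contMDiff.contMDiffAt
  have hx : φ.inv z₀.1 ∈ φ.src := φ.map_tgt _ hz.1
  have h3 := ((φ.contMDiffAt_inv hz.1).mfderiv_const (m := ∞) (by simp)).comp z₀ hp
  refine (h3.clm_apply h2).congr_of_eventuallyEq ?_
  have ho := (trivializationAt E (TangentSpace I) (φ.inv z₀.1)).open_baseSet
  filter_upwards [h1.continuousAt.preimage_mem_nhds
    (ho.mem_nhds (mem_baseSet_trivializationAt E (TangentSpace I) (φ.inv z₀.1)))] with z hw
  have e2 := inTC_from I φ.inv φ.dinv z₀.1 z.1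
  change _ = (inTangentCoordinates 𝓘(ℝ, G) I id φ.inv φ.dinv z₀.1 z.1) z.2
  rw [e2]
  have e4 : ∀ u : TangentSpace I (φ.inv z.1), (trivializationAt E (TangentSpace I)
      (φ.inv z₀.1)).continuousLinearMapAt ℝ (φ.inv z.1) u =
      (trivializationAt E (TangentSpace I) (φ.inv z₀.1) ⟨φ.inv z.1, u⟩).2 := fun u => by
    rw [Trivialization.continuousLinearMapAt_apply, Trivialization.linearMapAt_apply, if_pos (show φ.inv z.1 ∈ _ from hw)]
  exact (e4 (φ.dinv z.1 z.2)).symm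

/-- The coordinates of `TN` induced by coordinates of `N`. -/
def tan : Coord I.tangent (TangentBundle I N) (G × G) where
  src := TotalSpace.proj ⁻¹' φ.src
  tgt := φ.tgt ×ˢ univ
  fn := φ.tanFn
  inv := φ.tanInv
  open_src := φ.open_src.preimage (FiberBundle.continuous_proj E (TangentSpace I))
  open_tgt := φ.open_tgt.prod isOpen_univ
  map_src := fun γ h => ⟨φ.map_src _ h, mem_univ _⟩
  map_tgt := fun z h => φ.map_tgt _ h.1
  left_inv := by
    rintro ⟨x, v⟩ h
    have hx : x ∈ φ.src := h
    have hv : φ.dinv (φ.fn x) (φ.dfn x v) = v := DFunLike.congr_fun (φ.dinv_dfn hx) v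
    have : ∀ y (_ : y = x), (⟨y, (φ.dinv (φ.fn x) (φ.dfn x v) : E)⟩ : TangentBundle I N)
        = ⟨x, v⟩ := by
      rintro y rfl
      rw [hv]
    exact this _ (φ.left_inv x hx)
  right_inv := by
    rintro ⟨y, u⟩ h
    have hy : y ∈ φ.tgt := h.1
    exact Prod.ext (φ.right_inv y hy) (DFunLike.congr_fun (φ.dfn_dinv hy) u)
  smooth_fn := φ.tanFn_smooth
  smooth_inv := φ.tanInv_smooth

end Coord

/-- A chart of a subquotient `X` of a manifold `N`, given by a subset `C` of `N` and a quotient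
map `q : C → X`: a smooth function `fn` on an open subset `src` of `N` whose values on `C`
depend on the class only, and a smooth section `sec` over the open set `tgt` of its values. -/
structure QuotChart (I : ModelWithCorners ℝ E H) {C : Set N} {X : Type*} (q : C → X)
    (G : Type*) [NormedAddCommGroup G] [NormedSpace ℝ G] where
  src : Set N
  tgt : Set G
  fn : N → G
  sec : G → N
  open_src : IsOpen src
  open_tgt : IsOpen tgt
  smooth_fn : ContMDiffOn I 𝓘(ℝ, G) ∞ fn src
  smooth_sec : ContMDiffOn 𝓘(ℝ, G) I ∞ sec tgt
  sec_mem : ∀ y ∈ tgt, sec y ∈ C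
  sec_src : ∀ y ∈ tgt, sec y ∈ src
  fn_sec : ∀ y ∈ tgt, fn (sec y) = y
  fn_mem : ∀ z : C, z.1 ∈ src → fn z.1 ∈ tgt
  sec_fn : ∀ (z : C) (h : z.1 ∈ src), q ⟨sec (fn z.1), sec_mem _ (fn_mem z h)⟩ = q z
  sat : ∀ z z' : C, q z = q z' → z.1 ∈ src → z'.1 ∈ src ∧ fn z.1 = fn z'.1

namespace QuotChart

variable {I : ModelWithCorners ℝ E H} {C : Set N} {X : Type*} {q : C → X}
  {G : Type*} [NormedAddCommGroup G] [NormedSpace ℝ G]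

/-- The induced section, extended by the value `x₀`. -/
def up (Q : QuotChart I q G) (x₀ : X) (y : G) : X :=
  open Classical in if h : y ∈ Q.tgt then q ⟨Q.sec y, Q.sec_mem y h⟩ else x₀

lemma up_of (Q : QuotChart I q G) (x₀ : X) {y : G} (h : y ∈ Q.tgt) :
    Q.up x₀ y = q ⟨Q.sec y, Q.sec_mem y h⟩ := by
  rw [up, dif_pos h]

lemma preimage_src (Q : QuotChart I q G) :
    q ⁻¹' (q '' {z | z.1 ∈ Q.src}) = {z | z.1 ∈ Q.src} := by
  ext z
  constructor
  · rintro ⟨z', h', e⟩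
    exact (Q.sat z' z e h').1
  · exact fun h => ⟨z, h, rfl⟩

variable [TopologicalSpace X]

/-- The induced map on the quotient. -/
def down (Q : QuotChart I q G) (hq : Topology.IsQuotientMap q) (x : X) : G :=
  Q.fn (Function.surjInv hq.surjective x).1

lemma down_q (Q : QuotChart I q G) (hq : Topology.IsQuotientMap q) {z : C} (hz : z.1 ∈ Q.src) :
    Q.down hq (q z) = Q.fn z.1 :=
  (Q.sat z _ (Function.surjInv_eq hq.surjective (q z)).symm hz).2.symm

/-- The chart of the quotient. -/
def chart (Q : QuotChart I q G) (hq : Topology.IsQuotientMap q) (x₀ : X) :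
    OpenPartialHomeomorph X G where
  toFun := Q.down hq
  invFun := Q.up x₀
  source := q '' {z | z.1 ∈ Q.src}
  target := Q.tgt
  map_source' := by
    rintro _ ⟨z, hz, rfl⟩
    rw [Q.down_q hq hz]
    exact Q.fn_mem z hz
  map_target' := fun y hy => by
    rw [Q.up_of x₀ hy]
    exact ⟨_, Q.sec_src y hy, rfl⟩
  left_inv' := by
    rintro _ ⟨z, hz, rfl⟩
    rw [Q.down_q hq hz, Q.up_of x₀ (Q.fn_mem z hz)]
    exact Q.sec_fn z hz
  right_inv' := fun y hy => by
    rw [Q.up_of x₀ hy, Q.down_q hq (Q.sec_src y hy)]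
    exact Q.fn_sec y hy
  open_source := by
    rw [← hq.isOpen_preimage, Q.preimage_src]
    exact Q.open_src.preimage continuous_subtype_val
  open_target := Q.open_tgt
  continuousOn_toFun := by
    have ho : IsOpen (q '' {z | z.1 ∈ Q.src}) := by
      rw [← hq.isOpen_preimage, Q.preimage_src]
      exact Q.open_src.preimage continuous_subtype_val
    rw [hq.continuousOn_isOpen_iff ho, Q.preimage_src]
    refine ContinuousOn.congr (f := fun z : C => Q.fn z.1) ?_ fun z hz => Q.down_q hq hz
    exact Q.smooth_fn.continuousOn.comp continuous_subtype_val.continuousOn fun z hz => hz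
  continuousOn_invFun := by
    rw [continuousOn_iff_continuous_domRestrict]
    have h : Q.tgt.domRestrict (Q.up x₀) = fun y => q ⟨Q.sec y.1, Q.sec_mem y.1 y.2⟩ :=
      funext fun y => Q.up_of x₀ y.2
    rw [h]
    exact hq.continuous.comp (Continuous.subtype_mk
      (continuousOn_iff_continuous_domRestrict.1 Q.smooth_sec.continuousOn) _)

/-- The smooth structure of the quotient. -/
@[reducible] def chartedSpace (hq : Topology.IsQuotientMap q) (Q : X → QuotChart I q G)
    (hQ : ∀ x, ∃ z : C, q z = x ∧ z.1 ∈ (Q x).src) : ChartedSpace G X where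
  atlas := range fun x => (Q x).chart hq x
  chartAt := fun x => (Q x).chart hq x
  mem_chart_source := fun x => by
    obtain ⟨z, hz, h⟩ := hQ x
    exact ⟨z, h, hz⟩
  chart_mem_atlas := fun x => ⟨x, rfl⟩

lemma isManifold (hq : Topology.IsQuotientMap q) (Q : X → QuotChart I q G)
    (hQ : ∀ x, ∃ z : C, q z = x ∧ z.1 ∈ (Q x).src) :
    @IsManifold ℝ _ G _ _ G _ 𝓘(ℝ, G) ∞ X _ (chartedSpace hq Q hQ) := by
  let := chartedSpace hq Q hQ
  apply isManifold_of_contDiffOn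
  rintro _ _ ⟨x, rfl⟩ ⟨x', rfl⟩
  simp only [modelWithCornersSelf_coe, modelWithCornersSelf_coe_symm, Function.comp_id,
    Function.id_comp, preimage_id, range_id, inter_univ]
  have h : ContMDiffOn 𝓘(ℝ, G) 𝓘(ℝ, G) ∞ (fun y => (Q x').fn ((Q x).sec y))
      ((Q x).tgt ∩ (Q x).sec ⁻¹' (Q x').src) :=
    (Q x').smooth_fn.comp ((Q x).smooth_sec.mono inter_subset_left) fun y hy => hy.2
  refine (h.contDiffOn.mono ?_).congr ?_
  · rintro y ⟨hy, hy'⟩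
    refine ⟨hy, ?_⟩
    have hy'' : (Q x).up x y ∈ q '' {z | z.1 ∈ (Q x').src} := hy'
    rw [(Q x).up_of x hy] at hy''
    have := (Q x').preimage_src
    exact this.subset hy''
  · rintro y ⟨hy, hy'⟩
    have hy'' : (Q x).up x y ∈ q '' {z | z.1 ∈ (Q x').src} := hy'
    rw [(Q x).up_of x hy] at hy''
    have h' := (Q x').preimage_src.subset hy''
    change (Q x').down hq ((Q x).up x y) = _
    rw [(Q x).up_of x hy]
    exact (Q x').down_q hq h'

end QuotChart

/-- A chart in the atlas of a manifold modelled on `G` is a coordinate system. -/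
def Coord.ofChart {G : Type*} [NormedAddCommGroup G] [NormedSpace ℝ G] {X : Type*}
    [TopologicalSpace X] [ChartedSpace G X] [IsManifold 𝓘(ℝ, G) ∞ X] (x : X) :
    Coord 𝓘(ℝ, G) X G where
  src := (chartAt G x).source
  tgt := (chartAt G x).target
  fn := chartAt G x
  inv := (chartAt G x).symm
  open_src := (chartAt G x).open_source
  open_tgt := (chartAt G x).open_target
  map_src := fun _ h => (chartAt G x).map_source h
  map_tgt := fun _ h => (chartAt G x).map_target h
  left_inv := fun _ h => (chartAt G x).left_inv h
  right_inv := fun _ h => (chartAt G x).right_inv h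
  smooth_fn := contMDiffOn_chart
  smooth_inv := contMDiffOn_chart_symm

end General

/-- The model space of the fibres of the fibration. -/
abbrev Fib (n : ℕ) : Type := EuclideanSpace ℝ (Fin n)

/-- A fibration `π : M → ℝ` of a smooth `(n+1)`-dimensional manifold `M`: a smooth surjective
submersion. -/
structure Fibration (n : ℕ) (M : Type*) [TopologicalSpace M]
    [ChartedSpace (EuclideanSpace ℝ (Fin (n + 1))) M] where
  toFun : M → ℝ
  smooth : ContMDiff (𝓡 (n + 1)) 𝓘(ℝ, ℝ) ∞ toFun
  surjective : Function.Surjective toFun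
  submersion : ∀ x, Function.Surjective (mfderiv (𝓡 (n + 1)) 𝓘(ℝ, ℝ) toFun x)

lemma exists_linear_coord (n : ℕ) (l : EuclideanSpace ℝ (Fin (n + 1)) →L[ℝ] ℝ)
    (hl : Function.Surjective l) :
    ∃ A : EuclideanSpace ℝ (Fin (n + 1)) ≃L[ℝ] (ℝ × Fib n), ∀ v, (A v).1 = l v := by
  obtain ⟨v₀, hv₀⟩ := hl 1
  have hr : Module.finrank ℝ (LinearMap.ker l.toLinearMap) = Module.finrank ℝ (Fib n) := by
    have h := l.toLinearMap.finrank_range_add_finrank_ker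
    rw [LinearMap.range_eq_top.2 hl, finrank_top] at h
    simp only [Module.finrank_self, finrank_euclideanSpace, Fintype.card_fin] at h ⊢
    omega
  let κ := LinearEquiv.ofFinrankEq _ _ hr
  let pr : EuclideanSpace ℝ (Fin (n + 1)) →ₗ[ℝ] LinearMap.ker l.toLinearMap :=
    (LinearMap.id - l.toLinearMap.smulRight v₀).codRestrict _ fun v => by simp [hv₀]
  have hpr : ∀ v, (pr v).1 = v - l v • v₀ := fun v => rfl
  let e : EuclideanSpace ℝ (Fin (n + 1)) ≃ₗ[ℝ] (ℝ × Fib n) := LinearEquiv.ofLinearMap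
    (l.toLinearMap.prod (κ.toLinearMap.comp pr))
    (LinearMap.coprod (LinearMap.toSpanSingleton ℝ _ v₀)
      ((LinearMap.ker l.toLinearMap).subtype.comp κ.symm.toLinearMap))
    (LinearMap.ext fun w => by
      have hk : l (κ.symm w.2).1 = 0 := (κ.symm w.2).2
      have h1 : l (w.1 • v₀ + (κ.symm w.2).1) = w.1 := by simp [hv₀, hk]
      refine Prod.ext h1 ?_
      have h2 : pr (w.1 • v₀ + (κ.symm w.2).1) = κ.symm w.2 := by
        ext1
        rw [hpr, h1, add_sub_cancel_left]
      change κ (pr (w.1 • v₀ + (κ.symm w.2).1)) = w.2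
      rw [h2, κ.apply_symm_apply])
    (LinearMap.ext fun v => by
      change l v • v₀ + (κ.symm (κ (pr v))).1 = v
      rw [κ.symm_apply_apply, hpr, add_sub_cancel])
  exact ⟨e.toContinuousLinearEquiv, fun v => rfl⟩

namespace Fibration

variable {n : ℕ} {M : Type*} [TopologicalSpace M]
  [ChartedSpace (EuclideanSpace ℝ (Fin (n + 1))) M] [IsManifold (𝓡 (n + 1)) ∞ M]
  (π : Fibration n M)

/-- Around each point there are coordinates `(t, q)` adapted to the fibration. -/
lemma exists_adapted (x₀ : M) : ∃ φ : Coord (𝓡 (n + 1)) M (ℝ × Fib n),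
    x₀ ∈ φ.src ∧ ∀ x ∈ φ.src, (φ.fn x).1 = π.toFun x := by
  let ψ : Coord (𝓡 (n + 1)) M (EuclideanSpace ℝ (Fin (n + 1))) := Coord.ofChart x₀
  have hx₀ : x₀ ∈ ψ.src := mem_chart_source _ x₀
  let g : EuclideanSpace ℝ (Fin (n + 1)) → ℝ := fun y => π.toFun (ψ.inv y)
  have hg : ContDiffOn ℝ ∞ g ψ.tgt := contMDiffOn_iff_contDiffOn.1
    (π.smooth.comp_contMDiffOn ψ.smooth_inv)
  let y₀ := ψ.fn x₀
  have hy₀ : y₀ ∈ ψ.tgt := ψ.map_src x₀ hx₀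
  have hgd : ∀ y ∈ ψ.tgt, DifferentiableAt ℝ g y := fun y hy =>
    ((hg y hy).contDiffAt (ψ.open_tgt.mem_nhds hy)).differentiableAt (by simp)
  have hl : Function.Surjective (fderiv ℝ g y₀) := by
    have e : fderiv ℝ g y₀ =
        (dmap (𝓡 (n + 1)) 𝓘(ℝ, ℝ) π.toFun (ψ.inv y₀)).comp (ψ.dinv y₀) := by
      rw [Coord.dinv, ← dmap_comp 𝓘(ℝ, EuclideanSpace ℝ (Fin (n + 1))) (𝓡 (n + 1)) 𝓘(ℝ, ℝ)
        (π.smooth.mdifferentiable (by simp) _) (ψ.mdiff_inv hy₀)]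
      exact mfderiv_eq_fderiv.symm
    rw [e]
    intro c
    obtain ⟨v, hv⟩ := π.submersion (ψ.inv y₀) c
    have h := ψ.dinv_dfn (ψ.map_tgt y₀ hy₀)
    rw [ψ.right_inv y₀ hy₀] at h
    refine ⟨ψ.dfn (ψ.inv y₀) v, ?_⟩
    exact (congrArg (dmap (𝓡 (n + 1)) 𝓘(ℝ, ℝ) π.toFun (ψ.inv y₀)) (DFunLike.congr_fun h v)).trans hv
  obtain ⟨A, hA⟩ := exists_linear_coord n (fderiv ℝ g y₀) hl
  let f : EuclideanSpace ℝ (Fin (n + 1)) → ℝ × Fib n := fun y => (g y, (A y).2)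
  have hf : ContDiffOn ℝ ∞ f ψ.tgt := hg.prodMk (contDiff_snd.comp A.contDiff).contDiffOn
  have hfa : ∀ y ∈ ψ.tgt, ContDiffAt ℝ ∞ f y := fun y hy =>
    (hf y hy).contDiffAt (ψ.open_tgt.mem_nhds hy)
  have hfA : HasFDerivAt f (A : EuclideanSpace ℝ (Fin (n + 1)) →L[ℝ] ℝ × Fib n) y₀ := by
    have h1 := (hgd y₀ hy₀).hasFDerivAt.prodMk
      (((ContinuousLinearMap.snd ℝ ℝ (Fib n)).comp
        (A : EuclideanSpace ℝ (Fin (n + 1)) →L[ℝ] ℝ × Fib n)).hasFDerivAt (x := y₀))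
    refine h1.congr_fderiv ?_
    ext1 v
    exact Prod.ext (hA v).symm rfl
  let P := (hfa y₀ hy₀).toOpenPartialHomeomorph f hfA (by simp)
  have hP : ∀ y, P y = f y := fun y => rfl
  let U : Set (EuclideanSpace ℝ (Fin (n + 1))) := ψ.tgt ∩ fderiv ℝ f ⁻¹'
    range ((↑) : (EuclideanSpace ℝ (Fin (n + 1)) ≃L[ℝ] ℝ × Fib n) →
      (EuclideanSpace ℝ (Fin (n + 1)) →L[ℝ] ℝ × Fib n))
  have hU : IsOpen U := (hf.continuousOn_fderiv_of_isOpen ψ.open_tgt (by simp)).isOpen_inter_preimage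
    ψ.open_tgt (ContinuousLinearEquiv.isOpen)
  have hyU : y₀ ∈ U := ⟨hy₀, A, hfA.fderiv.symm⟩
  have hyP : y₀ ∈ P.source := (hfa y₀ hy₀).mem_toOpenPartialHomeomorph_source hfA (by simp)
  let R := P.restrOpen U hU
  have hRs : R.source = P.source ∩ U := P.restrOpen_source U hU
  have hRU : ∀ y ∈ R.source, y ∈ U := fun y hy => (hRs ▸ hy).2
  have hR : ∀ y, R y = f y := fun y => rfl
  refine ⟨{
    src := ψ.src ∩ ψ.fn ⁻¹' R.source
    tgt := R.target
    fn := fun x => f (ψ.fn x)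
    inv := fun z => ψ.inv (R.symm z)
    open_src := ψ.smooth_fn.continuousOn.isOpen_inter_preimage ψ.open_src R.open_source
    open_tgt := R.open_target
    map_src := fun x hx => R.map_source hx.2
    map_tgt := fun z hz => by
      have h := R.map_target hz
      refine ⟨ψ.map_tgt _ (hRU _ h).1, ?_⟩
      rw [mem_preimage, ψ.right_inv _ (hRU _ h).1]
      exact h
    left_inv := fun x hx => by
      rw [← hR, R.left_inv hx.2, ψ.left_inv x hx.1]
    right_inv := fun z hz => by
      rw [ψ.right_inv _ (hRU _ (R.map_target hz)).1, ← hR, R.right_inv hz]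
    smooth_fn := hf.contMDiffOn.comp (ψ.smooth_fn.mono inter_subset_left)
      fun x hx => (hRU _ hx.2).1
    smooth_inv := by
      refine ψ.smooth_inv.comp (t := ψ.tgt) (s := R.target) (f := R.symm) ?_
        fun z hz => (hRU _ (R.map_target hz)).1
      refine ContDiffOn.contMDiffOn fun z hz => ContDiffAt.contDiffWithinAt ?_
      have h := hRU _ (R.map_target hz)
      obtain ⟨B, hB⟩ := h.2
      refine R.contDiffAt_symm hz (f₀' := B) ?_ (hfa _ h.1)
      rw [hB]
      exact ((hfa _ h.1).differentiableAt (by simp)).hasFDerivAt }, ⟨hx₀, ?_⟩, ?_⟩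
  · rw [mem_preimage, hRs]
    exact ⟨hyP, hyU⟩
  · intro x hx
    change π.toFun (ψ.inv (ψ.fn x)) = _
    rw [ψ.left_inv x hx.1]


/-- A chosen system of adapted coordinates `(t, q)` around a point. -/
def adapted (x : M) : Coord (𝓡 (n + 1)) M (ℝ × Fib n) := (π.exists_adapted x).choose

lemma mem_adapted (x : M) : x ∈ (π.adapted x).src := (π.exists_adapted x).choose_spec.1

lemma adapted_fst (x₀ : M) : ∀ x ∈ (π.adapted x₀).src, ((π.adapted x₀).fn x).1 = π.toFun x :=
  (π.exists_adapted x₀).choose_spec.2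

end Fibration

section Spaces

variable {n : ℕ} {M : Type*} [TopologicalSpace M]
  [ChartedSpace (EuclideanSpace ℝ (Fin (n + 1))) M]

/-- The fibre `V_x π = ker d_x π` of the vertical bundle. -/
def VertSpace (π : Fibration n M) (x : M) : Submodule ℝ (TangentSpace (𝓡 (n + 1)) x) :=
  LinearMap.ker (mfderiv (𝓡 (n + 1)) 𝓘(ℝ, ℝ) π.toFun x).toLinearMap

/-- The dual bundle `V*π` of the vertical bundle: pairs of a point `x` of `M` and a linear form
on `V_x π`. -/
structure VStar (π : Fibration n M) where
  base : M
  form : VertSpace π base →L[ℝ] ℝ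

/-- The canonical projection `μ : T*M → V*π`, restriction of covectors to vertical vectors. -/
def mu (π : Fibration n M) (α : CotBundle (𝓡 (n + 1)) M) : VStar π :=
  ⟨α.1, ContinuousLinearMap.comp α.2 (VertSpace π α.1).subtypeL⟩

/-- The projection `π₁* : V*π → ℝ`. -/
def piOneStar (π : Fibration n M) (a : VStar π) : ℝ := π.toFun a.base

lemma mu_surjective (π : Fibration n M) : Function.Surjective (mu π) := by
  rintro ⟨x, a⟩
  obtain ⟨g, hg⟩ := LinearMap.exists_extend (p := VertSpace π x) a.toLinearMap
  let g' : EuclideanSpace ℝ (Fin (n + 1)) →ₗ[ℝ] ℝ := g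
  refine ⟨⟨x, (LinearMap.toContinuousLinearMap g' : EuclideanSpace ℝ (Fin (n + 1)) →L[ℝ] ℝ)⟩, ?_⟩
  exact congrArg (VStar.mk x) (ContinuousLinearMap.ext fun v => LinearMap.congr_fun hg v)

lemma dpi_eq (π : Fibration n M) {φ : Coord (𝓡 (n + 1)) M (ℝ × Fib n)}
    (h : ∀ x ∈ φ.src, (φ.fn x).1 = π.toFun x) {x : M} (hx : x ∈ φ.src) :
    dmap (𝓡 (n + 1)) 𝓘(ℝ, ℝ) π.toFun x =
      (ContinuousLinearMap.fst ℝ ℝ (Fib n)).comp (φ.dfn x) := by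
  have h1 : HasMFDerivAt 𝓘(ℝ, ℝ × Fib n) 𝓘(ℝ, ℝ) (Prod.fst : ℝ × Fib n → ℝ) (φ.fn x)
      (ContinuousLinearMap.fst ℝ ℝ (Fib n)) :=
    (ContinuousLinearMap.fst ℝ ℝ (Fib n)).hasFDerivAt.hasMFDerivAt
  have h2 := dmap_comp (𝓡 (n + 1)) 𝓘(ℝ, ℝ × Fib n) 𝓘(ℝ, ℝ) h1.mdifferentiableAt (φ.mdiff hx)
  rw [dmap_of _ _ h1] at h2
  rw [Coord.dfn, ← h2]
  exact dmap_congr _ _ (Filter.eventuallyEq_of_mem (φ.open_src.mem_nhds hx) h).symm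

lemma mem_vert (π : Fibration n M) {φ : Coord (𝓡 (n + 1)) M (ℝ × Fib n)}
    (h : ∀ x ∈ φ.src, (φ.fn x).1 = π.toFun x) {x : M} (hx : x ∈ φ.src)
    (v : TangentSpace (𝓡 (n + 1)) x) : v ∈ VertSpace π x ↔ (φ.dfn x v).1 = 0 := by
  have e := DFunLike.congr_fun (dpi_eq π h hx) v
  exact ⟨fun h => e.symm.trans h, fun h => e.trans h⟩

variable [IsManifold (𝓡 (n + 1)) ∞ M]

/-- The topology of `V*π` is the quotient topology of `T*M`. -/
instance (π : Fibration n M) : TopologicalSpace (VStar π) :=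
  TopologicalSpace.coinduced (mu π) inferInstance

lemma mu_isQuotientMap (π : Fibration n M) : Topology.IsQuotientMap (mu π) :=
  ⟨⟨rfl⟩, mu_surjective π⟩

/-- The map `μ` defined on the full subset of `T*M`. -/
def muUniv (π : Fibration n M) (z : (univ : Set (CotBundle (𝓡 (n + 1)) M))) : VStar π := mu π z.1

lemma muUniv_isQuotientMap (π : Fibration n M) : Topology.IsQuotientMap (muUniv π) :=
  (mu_isQuotientMap π).comp (Homeomorph.Set.univ _).isQuotientMap

/-- The model space of `V*π`, with coordinates `((t, q), p)`. -/
abbrev VModel (n : ℕ) : Type := (ℝ × Fib n) × (Fib n →L[ℝ] ℝ)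

lemma mu_cotInv (π : Fibration n M) {φ : Coord (𝓡 (n + 1)) M (ℝ × Fib n)}
    (h : ∀ x ∈ φ.src, (φ.fn x).1 = π.toFun x) {y : ℝ × Fib n} (hy : y ∈ φ.tgt)
    {p p' : (ℝ × Fib n) →L[ℝ] ℝ}
    (hp : p.comp (ContinuousLinearMap.inr ℝ ℝ (Fib n)) =
      p'.comp (ContinuousLinearMap.inr ℝ ℝ (Fib n))) :
    mu π (φ.cotInv (y, p)) = mu π (φ.cotInv (y, p')) := by
  refine congrArg (VStar.mk (φ.inv y)) (ContinuousLinearMap.ext fun v => ?_)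
  change p (φ.dfn (φ.inv y) v.1) = p' (φ.dfn (φ.inv y) v.1)
  have hv := (mem_vert π h (φ.map_tgt y hy) v.1).1 v.2
  have e : φ.dfn (φ.inv y) v.1 = ContinuousLinearMap.inr ℝ ℝ (Fib n) (φ.dfn (φ.inv y) v.1).2 :=
    Prod.ext hv rfl
  rw [e]
  exact DFunLike.congr_fun hp _

lemma cotFn_of_mu (π : Fibration n M) {φ : Coord (𝓡 (n + 1)) M (ℝ × Fib n)}
    (h : ∀ x ∈ φ.src, (φ.fn x).1 = π.toFun x) {α β : CotBundle (𝓡 (n + 1)) M}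
    (hα : α.1 ∈ φ.src) (e : mu π α = mu π β) : β.1 ∈ φ.src ∧ φ.fn α.1 = φ.fn β.1 ∧
      (φ.cotFn α).2.comp (ContinuousLinearMap.inr ℝ ℝ (Fib n)) =
      (φ.cotFn β).2.comp (ContinuousLinearMap.inr ℝ ℝ (Fib n)) := by
  obtain ⟨x, a⟩ := α
  obtain ⟨x', b⟩ := β
  obtain ⟨rfl, h'⟩ := VStar.mk.inj e
  have hx : x ∈ φ.src := hα
  refine ⟨hx, rfl, ContinuousLinearMap.ext fun w => ?_⟩
  have hv : φ.dinv (φ.fn x) (0, w) ∈ VertSpace π x := by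
    refine (mem_vert π h hx _).2 ?_
    have h2 := DFunLike.congr_fun (φ.dfn_dinv (φ.map_src x hx)) (0, w)
    rw [φ.left_inv x hx] at h2
    exact congrArg Prod.fst h2
  exact DFunLike.congr_fun (eq_of_heq h') ⟨_, hv⟩

/-- The chart `((t, q), p)` of `V*π` induced by adapted coordinates `(t, q)` of `M`. -/
def VStar.quotChart (π : Fibration n M) (φ : Coord (𝓡 (n + 1)) M (ℝ × Fib n))
    (h : ∀ x ∈ φ.src, (φ.fn x).1 = π.toFun x) :
    QuotChart (cotModel (𝓡 (n + 1))) (muUniv π) (VModel n) where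
  src := φ.cot.src
  tgt := φ.tgt ×ˢ univ
  fn := fun α => ((φ.cotFn α).1, (φ.cotFn α).2.comp (ContinuousLinearMap.inr ℝ ℝ (Fib n)))
  sec := fun z => φ.cotInv (z.1, z.2.comp (ContinuousLinearMap.snd ℝ ℝ (Fib n)))
  open_src := φ.cot.open_src
  open_tgt := φ.open_tgt.prod isOpen_univ
  smooth_fn := by
    have hs : ContDiff ℝ ∞ (fun z : (ℝ × Fib n) × ((ℝ × Fib n) →L[ℝ] ℝ) =>
        (z.1, z.2.comp (ContinuousLinearMap.inr ℝ ℝ (Fib n)))) := by fun_prop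
    exact hs.contMDiff.comp_contMDiffOn φ.cot.smooth_fn
  smooth_sec := by
    have hs : ContDiff ℝ ∞ (fun z : VModel n =>
        (z.1, z.2.comp (ContinuousLinearMap.snd ℝ ℝ (Fib n)))) := by fun_prop
    exact φ.cot.smooth_inv.comp hs.contMDiff.contMDiffOn fun z hz => ⟨hz.1, mem_univ _⟩
  sec_mem := fun _ _ => mem_univ _
  sec_src := fun z hz => φ.map_tgt _ hz.1
  fn_sec := fun z hz => by
    have e : φ.cotFn (φ.cotInv (z.1, z.2.comp (ContinuousLinearMap.snd ℝ ℝ (Fib n)))) = _ :=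
      φ.cot.right_inv (z.1, z.2.comp (ContinuousLinearMap.snd ℝ ℝ (Fib n))) ⟨hz.1, mem_univ _⟩
    rw [e]
    rfl
  fn_mem := fun z hz => ⟨φ.map_src _ hz, mem_univ _⟩
  sec_fn := fun z hz => by
    have e : φ.cotInv (φ.cotFn z.1) = z.1 := φ.cot.left_inv z.1 hz
    refine Eq.trans (mu_cotInv π h (φ.map_src _ hz) ?_) (congrArg (mu π) e)
    rfl
  sat := fun z z' e hz => by
    obtain ⟨h1, h2, h3⟩ := cotFn_of_mu π h hz e
    exact ⟨h1, Prod.ext h2 h3⟩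

lemma VStar.exists_src (π : Fibration n M) (a : VStar π) : ∃ z, muUniv π z = a ∧
    z.1 ∈ (VStar.quotChart π (π.adapted a.base) (π.adapted_fst a.base)).src := by
  obtain ⟨z, rfl⟩ := mu_surjective π a
  exact ⟨⟨z, mem_univ _⟩, rfl, π.mem_adapted z.1⟩

/-- The smooth structure of `V*π`, with the charts induced by adapted coordinates of `M`. -/
instance (π : Fibration n M) : ChartedSpace (VModel n) (VStar π) :=
  QuotChart.chartedSpace (muUniv_isQuotientMap π)
    (fun a => VStar.quotChart π (π.adapted a.base) (π.adapted_fst a.base)) (VStar.exists_src π)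

instance (π : Fibration n M) : IsManifold 𝓘(ℝ, VModel n) ∞ (VStar π) :=
  QuotChart.isManifold (muUniv_isQuotientMap π)
    (fun a => VStar.quotChart π (π.adapted a.base) (π.adapted_fst a.base)) (VStar.exists_src π)

lemma VStar.chart_mu (π : Fibration n M) (a : VStar π) {α : CotBundle (𝓡 (n + 1)) M}
    (hα : α.1 ∈ (π.adapted a.base).src) :
    mu π α ∈ (chartAt (VModel n) a).source ∧ chartAt (VModel n) a (mu π α) =
      (((π.adapted a.base).cotFn α).1,
        ((π.adapted a.base).cotFn α).2.comp (ContinuousLinearMap.inr ℝ ℝ (Fib n))) :=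
  ⟨⟨⟨α, mem_univ _⟩, hα, rfl⟩,
    (VStar.quotChart π (π.adapted a.base) (π.adapted_fst a.base)).down_q
      (muUniv_isQuotientMap π) (z := ⟨α, mem_univ _⟩) hα⟩

lemma VStar.chart_fst (π : Fibration n M) (a b : VStar π)
    (hb : b ∈ (chartAt (VModel n) a).source) : (chartAt (VModel n) a b).1.1 = piOneStar π b := by
  obtain ⟨z, hz, rfl⟩ := hb
  rw [show muUniv π z = mu π z.1 from rfl, (VStar.chart_mu π a hz).2]
  exact π.adapted_fst a.base _ hz

lemma mu_contMDiff (π : Fibration n M) :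
    ContMDiff (cotModel (𝓡 (n + 1))) 𝓘(ℝ, VModel n) ∞ (mu π) := by
  intro α
  let φ := π.adapted α.1
  have hs : ContDiff ℝ ∞ (fun z : (ℝ × Fib n) × ((ℝ × Fib n) →L[ℝ] ℝ) =>
      (z.1, z.2.comp (ContinuousLinearMap.inr ℝ ℝ (Fib n)))) := by fun_prop
  have h1 := hs.contMDiff.comp_contMDiffOn φ.cot.smooth_fn
  have h2 : ContMDiffOn (cotModel (𝓡 (n + 1))) 𝓘(ℝ, VModel n) ∞
      (fun β => (chartAt (VModel n) (mu π α)).symm (φ.cotFn β |>.1,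
        (φ.cotFn β).2.comp (ContinuousLinearMap.inr ℝ ℝ (Fib n)))) φ.cot.src := by
    refine contMDiffOn_chart_symm.comp h1 fun β hβ => ?_
    have h3 := VStar.chart_mu π (mu π α) (α := β) hβ
    rw [mem_preimage]
    exact h3.2 ▸ (chartAt (VModel n) (mu π α)).map_source h3.1
  refine (h2.congr fun β hβ => ?_).contMDiffAt (φ.cot.open_src.mem_nhds (π.mem_adapted α.1))
  have h3 := VStar.chart_mu π (mu π α) (α := β) hβ
  rw [← (chartAt (VModel n) (mu π α)).left_inv h3.1, h3.2]
  rfl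

lemma piOneStar_contMDiff (π : Fibration n M) :
    ContMDiff 𝓘(ℝ, VModel n) 𝓘(ℝ, ℝ) ∞ (piOneStar π) := by
  intro a
  have hs : ContDiff ℝ ∞ (fun z : VModel n => z.1.1) := by fun_prop
  have h1 := hs.contMDiff.comp_contMDiffOn (contMDiffOn_chart (I := 𝓘(ℝ, VModel n)) (n := ∞) (x := a))
  exact (h1.congr fun b hb => (VStar.chart_fst π a b hb).symm).contMDiffAt
    ((chartAt (VModel n) a).open_source.mem_nhds (mem_chart_source _ a))

/-- The jet manifold `J¹π₁*` as a subset of `T(V*π)`: the tangent vectors `w` of `V*π` with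
`dπ₁*(w) = 1`. -/
def JetSet (π : Fibration n M) : Set (TangentBundle 𝓘(ℝ, VModel n) (VStar π)) :=
  {w | dmap 𝓘(ℝ, VModel n) 𝓘(ℝ, ℝ) (piOneStar π) w.1 w.2 = 1}

/-- The jet manifold `J¹π₁*`, with the subspace topology of `T(V*π)`. -/
abbrev Jet (π : Fibration n M) : Type _ := ↥(JetSet π)

/-- The model space of `J¹π₁*`, with coordinates `(((t, q), p), (q', p'))`. -/
abbrev JModel (n : ℕ) : Type := VModel n × (Fib n × (Fib n →L[ℝ] ℝ))

lemma dpiOneStar_eq (π : Fibration n M) {ψ : Coord 𝓘(ℝ, VModel n) (VStar π) (VModel n)}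
    (h : ∀ a ∈ ψ.src, (ψ.fn a).1.1 = piOneStar π a) {a : VStar π} (ha : a ∈ ψ.src)
    (v : VModel n) :
    dmap 𝓘(ℝ, VModel n) 𝓘(ℝ, ℝ) (piOneStar π) a v = (ψ.dfn a v).1.1 := by
  let l : VModel n →L[ℝ] ℝ := (ContinuousLinearMap.fst ℝ ℝ (Fib n)).comp
    (ContinuousLinearMap.fst ℝ (ℝ × Fib n) (Fib n →L[ℝ] ℝ))
  have h1 : HasMFDerivAt 𝓘(ℝ, VModel n) 𝓘(ℝ, ℝ) l (ψ.fn a) l := l.hasFDerivAt.hasMFDerivAt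
  have h2 := dmap_comp 𝓘(ℝ, VModel n) 𝓘(ℝ, VModel n) 𝓘(ℝ, ℝ) h1.mdifferentiableAt (ψ.mdiff ha)
  rw [dmap_of _ _ h1] at h2
  have h3 := dmap_congr 𝓘(ℝ, VModel n) 𝓘(ℝ, ℝ)
    (Filter.eventuallyEq_of_mem (ψ.open_src.mem_nhds ha) (fun b hb => (h b hb).symm))
  rw [h3]
  exact DFunLike.congr_fun h2 v

/-- The chart of `J¹π₁*` induced by adapted coordinates of `V*π`. -/
def Jet.quotChart (π : Fibration n M) (ψ : Coord 𝓘(ℝ, VModel n) (VStar π) (VModel n))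
    (h : ∀ a ∈ ψ.src, (ψ.fn a).1.1 = piOneStar π a) :
    QuotChart (𝓘(ℝ, VModel n).tangent) (id : Jet π → Jet π) (JModel n) where
  src := ψ.tan.src
  tgt := ψ.tgt ×ˢ univ
  fn := fun w => ((ψ.tanFn w).1, ((ψ.tanFn w).2.1.2, (ψ.tanFn w).2.2))
  sec := fun z => ψ.tanInv (z.1, ((1, z.2.1), z.2.2))
  open_src := ψ.tan.open_src
  open_tgt := ψ.open_tgt.prod isOpen_univ
  smooth_fn := by
    have hs : ContDiff ℝ ∞ (fun z : VModel n × VModel n => (z.1, (z.2.1.2, z.2.2))) := by fun_prop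
    exact hs.contMDiff.comp_contMDiffOn ψ.tan.smooth_fn
  smooth_sec := by
    have hs : ContDiff ℝ ∞ (fun z : JModel n =>
      ((z.1, (((1 : ℝ), z.2.1), z.2.2)) : VModel n × VModel n)) := by fun_prop
    exact ψ.tan.smooth_inv.comp hs.contMDiff.contMDiffOn fun z hz => ⟨hz.1, mem_univ _⟩
  sec_mem := fun z hz => by
    refine (dpiOneStar_eq π h (ψ.map_tgt _ hz.1) _).trans ?_
    have e := DFunLike.congr_fun (ψ.dfn_dinv hz.1) (((1 : ℝ), z.2.1), z.2.2)
    exact congrArg (fun u : VModel n => u.1.1) e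
  sec_src := fun z hz => ψ.map_tgt _ hz.1
  fn_sec := fun z hz => by
    have e : ψ.tanFn (ψ.tanInv (z.1, ((1, z.2.1), z.2.2))) = _ :=
      ψ.tan.right_inv (z.1, ((1, z.2.1), z.2.2)) ⟨hz.1, mem_univ _⟩
    rw [e]
  fn_mem := fun z hz => ⟨ψ.map_src _ hz, mem_univ _⟩
  sec_fn := fun z hz => by
    have e : ψ.tanInv (ψ.tanFn z.1) = z.1 := ψ.tan.left_inv z.1 hz
    have e1 : (ψ.tanFn z.1).2.1.1 = 1 := (dpiOneStar_eq π h hz _).symm.trans z.2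
    refine Subtype.ext (Eq.trans ?_ e)
    refine congrArg ψ.tanInv (Prod.ext rfl (Prod.ext (Prod.ext e1.symm rfl) rfl))
  sat := fun z z' e hz => by
    obtain rfl : z = z' := e
    exact ⟨hz, rfl⟩

lemma Jet.exists_src (π : Fibration n M) (w : Jet π) : ∃ z : Jet π, id z = w ∧
    z.1 ∈ (Jet.quotChart π (Coord.ofChart w.1.1) (VStar.chart_fst π w.1.1)).src :=
  ⟨w, rfl, mem_chart_source (VModel n) w.1.1⟩

/-- The smooth structure of `J¹π₁*` as an embedded submanifold of `T(V*π)`. -/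
instance (π : Fibration n M) : ChartedSpace (JModel n) (Jet π) :=
  QuotChart.chartedSpace Topology.IsQuotientMap.id
    (fun w => Jet.quotChart π (Coord.ofChart w.1.1) (VStar.chart_fst π w.1.1)) (Jet.exists_src π)

instance (π : Fibration n M) : IsManifold 𝓘(ℝ, JModel n) ∞ (Jet π) :=
  QuotChart.isManifold Topology.IsQuotientMap.id
    (fun w => Jet.quotChart π (Coord.ofChart w.1.1) (VStar.chart_fst π w.1.1)) (Jet.exists_src π)

/-- The differential `d_x π` as a covector of `M`. -/
def dpi (π : Fibration n M) (x : M) : CotSpace (𝓡 (n + 1)) x :=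
  mfderiv (𝓡 (n + 1)) 𝓘(ℝ, ℝ) π.toFun x

/-- The principal action of `ℝ` on the AV-bundle `μ : T*M → V*π`: translation by multiples of
`dπ`. -/
def act (π : Fibration n M) (s : ℝ) (α : CotBundle (𝓡 (n + 1)) M) : CotBundle (𝓡 (n + 1)) M :=
  ⟨α.1, α.2 + s • dpi π α.1⟩

/-- The infinitesimal generator `V_μ` of the action of `ℝ` on `T*M`. -/
def vMu (π : Fibration n M) (α : CotBundle (𝓡 (n + 1)) M) :
    TangentSpace (cotModel (𝓡 (n + 1))) α :=
  dmap 𝓘(ℝ, ℝ) (cotModel (𝓡 (n + 1))) (fun s : ℝ => act π s α) 0 1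

/-- `T*(T*M)`. -/
abbrev CotCot (n : ℕ) (M : Type*) [TopologicalSpace M]
    [ChartedSpace (EuclideanSpace ℝ (Fin (n + 1))) M] [IsManifold (𝓡 (n + 1)) ∞ M] : Type _ :=
  CotBundle (cotModel (𝓡 (n + 1))) (CotBundle (𝓡 (n + 1)) M)

/-- The linear function on `T*(T*M)` induced by the vector field `V_μ`. -/
def hatVMu (π : Fibration n M) (γ : CotCot n M) : ℝ := γ.2 (vMu π γ.1)

/-- The level set `{γ ∈ T*(T*M) | γ(V_μ) = 1}`. -/
def LevelSet (π : Fibration n M) : Set (CotCot n M) := {γ | hatVMu π γ = 1}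

/-- The affine subbundle `{γ ∈ T*(T*M) | γ(V_μ) = 1}` of `T*(T*M)`, with the subspace topology. -/
abbrev Level (π : Fibration n M) : Type _ := ↥(LevelSet π)

section Model

/-- The dual of `ℝ × F`. -/
abbrev CovM (n : ℕ) : Type := (ℝ × Fib n) →L[ℝ] ℝ

/-- The model space of `{γ(V_μ) = 1}`, with coordinates `(((t, q), (p_t, p)), (P_(t, q), P_p))`. -/
abbrev LModel (n : ℕ) : Type :=
  ((ℝ × Fib n) × CovM n) × (CovM n × ((Fib n →L[ℝ] ℝ) →L[ℝ] ℝ))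

/-- The direction of the fibres of `μ` in adapted coordinates. -/
def dirV (n : ℕ) : (ℝ × Fib n) × CovM n := (0, ContinuousLinearMap.fst ℝ ℝ (Fib n))

/-- The coordinates of a covector `P`. -/
def toL (z : ((ℝ × Fib n) × CovM n) × (((ℝ × Fib n) × CovM n) →L[ℝ] ℝ)) : LModel n :=
  (z.1, (z.2.comp (ContinuousLinearMap.inl ℝ (ℝ × Fib n) (CovM n)),
    (z.2.comp (ContinuousLinearMap.inr ℝ (ℝ × Fib n) (CovM n))).comp
      (ContinuousLinearMap.precomp ℝ (ContinuousLinearMap.snd ℝ ℝ (Fib n)))))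

/-- The covector `P` with given coordinates and value `1` on the direction of the fibres. -/
def ofL (z : LModel n) : ((ℝ × Fib n) × CovM n) × (((ℝ × Fib n) × CovM n) →L[ℝ] ℝ) :=
  (z.1, z.2.1.comp (ContinuousLinearMap.fst ℝ (ℝ × Fib n) (CovM n)) +
    (z.2.2.comp (ContinuousLinearMap.precomp ℝ (ContinuousLinearMap.inr ℝ ℝ (Fib n))) +
      ContinuousLinearMap.apply ℝ ℝ ((1 : ℝ), (0 : Fib n))).comp
      (ContinuousLinearMap.snd ℝ (ℝ × Fib n) (CovM n)))

lemma contDiff_toL : ContDiff ℝ ∞ (toL (n := n)) := by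
  unfold toL; fun_prop

lemma contDiff_ofL : ContDiff ℝ ∞ (ofL (n := n)) := by
  unfold ofL; fun_prop

lemma ofL_dirV (z : LModel n) : (ofL z).2 (dirV n) = 1 := by
  simp [ofL, dirV]

lemma toL_ofL (z : LModel n) : toL (ofL z) = z := by
  refine Prod.ext rfl (Prod.ext ?_ ?_)
  · ext <;> simp [toL, ofL]
  · ext b
    have e : (b.comp (ContinuousLinearMap.snd ℝ ℝ (Fib n))).comp
        (ContinuousLinearMap.inr ℝ ℝ (Fib n)) = b := rfl
    simp [toL, ofL, e]

lemma CovM_decomp (p : CovM n) : p = p (1, 0) • ContinuousLinearMap.fst ℝ ℝ (Fib n) +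
    (p.comp (ContinuousLinearMap.inr ℝ ℝ (Fib n))).comp (ContinuousLinearMap.snd ℝ ℝ (Fib n)) := by
  refine ContinuousLinearMap.ext fun w => ?_
  have e : w = w.1 • ((1 : ℝ), (0 : Fib n)) + (0, w.2) := by ext <;> simp
  conv_lhs => rw [e, map_add, map_smul]
  simp [mul_comm]

lemma ofL_toL (z : ((ℝ × Fib n) × CovM n) × (((ℝ × Fib n) × CovM n) →L[ℝ] ℝ))
    (hz : z.2 (dirV n) = 1) : ofL (toL z) = z := by
  refine Prod.ext rfl (ContinuousLinearMap.ext fun w => ?_)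
  obtain ⟨y, p⟩ := w
  have e1 : ((y, p) : (ℝ × Fib n) × CovM n) = (y, 0) + (p (1, 0) • dirV n +
      (0, (p.comp (ContinuousLinearMap.inr ℝ ℝ (Fib n))).comp
        (ContinuousLinearMap.snd ℝ ℝ (Fib n)))) := by
    refine Prod.ext (by simp [dirV]) ?_
    simpa [dirV] using CovM_decomp p
  have e2 := congrArg z.2 e1
  rw [map_add, map_add, map_smul, hz] at e2
  rw [e2]
  simp [ofL, toL]
  ring

end Model

section Coordinates

variable (π : Fibration n M) {φ : Coord (𝓡 (n + 1)) M (ℝ × Fib n)}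

lemma cotFn_act (h : ∀ x ∈ φ.src, (φ.fn x).1 = π.toFun x) (s : ℝ)
    {α : CotBundle (𝓡 (n + 1)) M} (hα : α.1 ∈ φ.src) :
    φ.cotFn (act π s α) = φ.cotFn α + s • dirV n := by
  obtain ⟨x, a⟩ := α
  have hx : x ∈ φ.src := hα
  have e1 : (dmap (𝓡 (n + 1)) 𝓘(ℝ, ℝ) π.toFun x).comp (φ.dinv (φ.fn x)) =
      ContinuousLinearMap.fst ℝ ℝ (Fib n) := by
    have e2 := φ.dfn_dinv (φ.map_src x hx)
    rw [φ.left_inv x hx] at e2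
    rw [dpi_eq π h hx, ContinuousLinearMap.comp_assoc, e2, ContinuousLinearMap.comp_id]
  refine Prod.ext (by simp [Coord.cotFn, act, dirV]) ?_
  refine ContinuousLinearMap.ext fun w => ?_
  have e3 := DFunLike.congr_fun e1 w
  change a (φ.dinv (φ.fn x) w) + s * dmap (𝓡 (n + 1)) 𝓘(ℝ, ℝ) π.toFun x (φ.dinv (φ.fn x) w) =
    a (φ.dinv (φ.fn x) w) + s * w.1
  congr 2

lemma act_eq_inv (h : ∀ x ∈ φ.src, (φ.fn x).1 = π.toFun x) (s : ℝ)
    {α : CotBundle (𝓡 (n + 1)) M} (hα : α.1 ∈ φ.src) :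
    act π s α = φ.cotInv (φ.cotFn α + s • dirV n) := by
  rw [← cotFn_act π h s hα]
  exact (φ.cot.left_inv (act π s α) hα).symm

lemma add_dirV_mem (s : ℝ) {c : (ℝ × Fib n) × CovM n} (hc : c ∈ φ.cot.tgt) :
    c + s • dirV n ∈ φ.cot.tgt := by
  refine ⟨?_, mem_univ _⟩
  have e : (c + s • dirV n).1 = c.1 := by simp [dirV]
  rw [e]
  exact hc.1

lemma dfn_vMu (h : ∀ x ∈ φ.src, (φ.fn x).1 = π.toFun x)
    {α : CotBundle (𝓡 (n + 1)) M} (hα : α.1 ∈ φ.src) :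
    φ.cot.dfn α (vMu π α) = dirV n := by
  have hc : φ.cotFn α ∈ φ.cot.tgt := φ.cot.map_src α hα
  have e0 : (fun s : ℝ => act π s α) = fun s => φ.cot.inv (φ.cotFn α + s • dirV n) :=
    funext fun s => act_eq_inv π h s hα
  have hl : HasFDerivAt (fun s : ℝ => φ.cotFn α + s • dirV n)
      ((ContinuousLinearMap.id ℝ ℝ).smulRight (dirV n)) 0 :=
    ((hasFDerivAt_id (0 : ℝ)).smul_const (dirV n)).const_add _
  have hl' := hl.hasMFDerivAt
  have e1 : φ.cotFn α + (0 : ℝ) • dirV n = φ.cotFn α := by rw [zero_smul, add_zero]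
  have e2 := dmap_comp 𝓘(ℝ, ℝ) 𝓘(ℝ, (ℝ × Fib n) × CovM n) (cotModel (𝓡 (n + 1)))
    (f := fun s : ℝ => φ.cotFn α + s • dirV n) (φ.cot.mdiff_inv (add_dirV_mem (φ := φ) 0 hc)) hl'.mdifferentiableAt
  rw [dmap_of _ _ hl', e1] at e2
  have e3 : vMu π α = φ.cot.dinv (φ.cotFn α) (dirV n) := by
    unfold vMu
    rw [e0, e2]
    simp only [Coord.dinv, ContinuousLinearMap.comp_apply, ContinuousLinearMap.smulRight_apply,
      ContinuousLinearMap.id_apply, one_smul]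
    rfl
  rw [e3]
  have e4 := φ.cot.dfn_dinv hc
  rw [show φ.cot.inv (φ.cotFn α) = α from φ.cot.left_inv α hα] at e4
  exact DFunLike.congr_fun e4 (dirV n)

lemma hatVMu_eq (h : ∀ x ∈ φ.src, (φ.fn x).1 = π.toFun x) {γ : CotCot n M}
    (hγ : γ.1.1 ∈ φ.src) : hatVMu π γ = (φ.cot.cotFn γ).2 (dirV n) := by
  rw [← dfn_vMu π h hγ]
  have e := DFunLike.congr_fun (φ.cot.dinv_dfn (x := γ.1) hγ) (vMu π γ.1)
  exact (congrArg γ.2 e).symm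

lemma act_mdiff (s : ℝ) (α : CotBundle (𝓡 (n + 1)) M) :
    MDifferentiableAt (cotModel (𝓡 (n + 1))) (cotModel (𝓡 (n + 1))) (act π s) α := by
  let φ := π.adapted α.1
  have hα : α.1 ∈ φ.src := π.mem_adapted α.1
  have hc : φ.cotFn α ∈ φ.cot.tgt := φ.cot.map_src α hα
  have hl : HasFDerivAt (fun c => c + s • dirV n) (ContinuousLinearMap.id ℝ _) (φ.cotFn α) :=
    (hasFDerivAt_id _).add_const _
  have h1 := (φ.cot.mdiff_inv (add_dirV_mem (φ := φ) s hc)).comp α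
    (hl.hasMFDerivAt.mdifferentiableAt.comp α (φ.cot.mdiff hα))
  refine h1.congr_of_eventuallyEq ?_
  exact Filter.eventuallyEq_of_mem (φ.cot.open_src.mem_nhds hα)
    fun β hβ => act_eq_inv π (π.adapted_fst α.1) s hβ

/-- The cotangent lift to `T*(T*M)` of the action of `ℝ` on `T*M`: the covector `γ` at `α` is
sent to its pullback under the translation by `-s`, a covector at the translate of `α`. -/
def liftAct (π : Fibration n M) (s : ℝ) (γ : CotCot n M) : CotCot n M :=
  ⟨act π s γ.1, ContinuousLinearMap.comp (γ.2 : _ →L[ℝ] ℝ)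
    (dmap (cotModel (𝓡 (n + 1))) (cotModel (𝓡 (n + 1))) (act π (-s)) (act π s γ.1))⟩

lemma cotFn_liftAct (h : ∀ x ∈ φ.src, (φ.fn x).1 = π.toFun x) (s : ℝ) {γ : CotCot n M}
    (hγ : γ.1.1 ∈ φ.src) : φ.cot.cotFn (liftAct π s γ) =
      ((φ.cot.cotFn γ).1 + s • dirV n, (φ.cot.cotFn γ).2) := by
  obtain ⟨α, g⟩ := γ
  have hα : α.1 ∈ φ.src := hγ
  have hc : φ.cotFn α ∈ φ.cot.tgt := φ.cot.map_src α hα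
  have hcs := add_dirV_mem (φ := φ) s hc
  have e0 : φ.cotFn (act π s α) = φ.cotFn α + s • dirV n := cotFn_act π h s hα
  refine Prod.ext e0 ?_
  have hl : HasFDerivAt (fun c => c + (-s) • dirV n) (ContinuousLinearMap.id ℝ _)
      (φ.cotFn α + s • dirV n) := (hasFDerivAt_id _).add_const _
  have hl' := hl.hasMFDerivAt
  have e1 : φ.cotFn α + s • dirV n + (-s) • dirV n = φ.cotFn α := by
    module
  have e2 := dmap_comp 𝓘(ℝ, (ℝ × Fib n) × CovM n) 𝓘(ℝ, (ℝ × Fib n) × CovM n)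
    (cotModel (𝓡 (n + 1))) (f := fun c => c + (-s) • dirV n)
    (φ.cot.mdiff_inv (add_dirV_mem (φ := φ) (-s) hcs)) hl'.mdifferentiableAt
  rw [dmap_of _ _ hl', e1, ContinuousLinearMap.comp_id] at e2
  have e3 := dmap_comp 𝓘(ℝ, (ℝ × Fib n) × CovM n) (cotModel (𝓡 (n + 1)))
    (cotModel (𝓡 (n + 1))) (act_mdiff π (-s) (φ.cot.inv (φ.cotFn α + s • dirV n)))
    (φ.cot.mdiff_inv hcs)
  have e4 := dmap_congr 𝓘(ℝ, (ℝ × Fib n) × CovM n) (cotModel (𝓡 (n + 1)))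
    (f := fun c => act π (-s) (φ.cot.inv c)) (g := fun c => φ.cot.inv (c + (-s) • dirV n))
    (x := φ.cotFn α + s • dirV n)
    (Filter.eventuallyEq_of_mem (φ.cot.open_tgt.mem_nhds hcs) fun c hc' => by
      have := act_eq_inv π h (-s) (α := φ.cot.inv c) (φ.cot.map_tgt c hc')
      refine this.trans (congrArg φ.cot.inv ?_)
      exact congrArg (· + (-s) • dirV n) (φ.cot.right_inv c hc'))
  rw [e3, e2] at e4
  change ContinuousLinearMap.comp (ContinuousLinearMap.comp (g : _ →L[ℝ] ℝ)
    (dmap (cotModel (𝓡 (n + 1))) (cotModel (𝓡 (n + 1))) (act π (-s)) (act π s α)))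
    (φ.cot.dinv (φ.cotFn (act π s α))) = ContinuousLinearMap.comp (g : _ →L[ℝ] ℝ)
      (φ.cot.dinv (φ.cotFn α))
  have e6 : φ.cot.inv (φ.cotFn α + s • dirV n) = act π s α := (act_eq_inv π h s hα).symm
  rw [e6] at e4
  rw [e0]
  exact ContinuousLinearMap.ext fun w => congrArg g (DFunLike.congr_fun e4 w)

end Coordinates


lemma ofL_mem {φ : Coord (𝓡 (n + 1)) M (ℝ × Fib n)} {z : LModel n} (hz : z.1.1 ∈ φ.tgt) :
    ofL z ∈ φ.cot.cot.tgt :=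
  ⟨⟨hz, mem_univ _⟩, mem_univ _⟩

lemma cotFn_ofL {φ : Coord (𝓡 (n + 1)) M (ℝ × Fib n)} {z : LModel n} (hz : z.1.1 ∈ φ.tgt) :
    φ.cot.cotFn (φ.cot.cotInv (ofL z)) = ofL z :=
  φ.cot.cot.right_inv (ofL z) (ofL_mem hz)

lemma hatVMu_ofL (π : Fibration n M) {φ : Coord (𝓡 (n + 1)) M (ℝ × Fib n)}
    (h : ∀ x ∈ φ.src, (φ.fn x).1 = π.toFun x) {z : LModel n} (hz : z.1.1 ∈ φ.tgt) :
    hatVMu π (φ.cot.cotInv (ofL z)) = 1 := by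
  have h1 : (φ.cot.cotInv (ofL z)).1.1 ∈ φ.src := φ.map_tgt _ hz
  rw [hatVMu_eq π h h1, cotFn_ofL hz, ofL_dirV]

lemma cotInv_ofL_toL (π : Fibration n M) {φ : Coord (𝓡 (n + 1)) M (ℝ × Fib n)}
    (h : ∀ x ∈ φ.src, (φ.fn x).1 = π.toFun x) {γ : CotCot n M} (hγ : γ.1.1 ∈ φ.src)
    (h1 : hatVMu π γ = 1) : φ.cot.cotInv (ofL (toL (φ.cot.cotFn γ))) = γ := by
  rw [hatVMu_eq π h hγ] at h1
  rw [ofL_toL _ h1]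
  exact φ.cot.cot.left_inv γ hγ

lemma contMDiffOn_pFnL (φ : Coord (𝓡 (n + 1)) M (ℝ × Fib n)) :
    ContMDiffOn (cotModel (cotModel (𝓡 (n + 1)))) 𝓘(ℝ, LModel n) ∞
      (fun γ => toL (φ.cot.cotFn γ)) φ.cot.cot.src :=
  contDiff_toL.contMDiff.comp_contMDiffOn φ.cot.cot.smooth_fn

lemma contMDiffOn_pInvL (φ : Coord (𝓡 (n + 1)) M (ℝ × Fib n)) :
    ContMDiffOn 𝓘(ℝ, LModel n) (cotModel (cotModel (𝓡 (n + 1)))) ∞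
      (fun z : LModel n => φ.cot.cotInv (ofL z)) {z | z.1.1 ∈ φ.tgt} :=
  φ.cot.cot.smooth_inv.comp contDiff_ofL.contMDiff.contMDiffOn fun _ hz => ofL_mem hz

/-- The chart of `{γ(V_μ) = 1}` induced by adapted coordinates of `M`. -/
def Level.quotChart (π : Fibration n M) (φ : Coord (𝓡 (n + 1)) M (ℝ × Fib n))
    (h : ∀ x ∈ φ.src, (φ.fn x).1 = π.toFun x) :
    QuotChart (cotModel (cotModel (𝓡 (n + 1)))) (id : Level π → Level π) (LModel n) where
  src := φ.cot.cot.src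
  tgt := {z | z.1.1 ∈ φ.tgt}
  fn := fun γ => toL (φ.cot.cotFn γ)
  sec := fun z => φ.cot.cotInv (ofL z)
  open_src := φ.cot.cot.open_src
  open_tgt := φ.open_tgt.preimage (by fun_prop)
  smooth_fn := contMDiffOn_pFnL φ
  smooth_sec := contMDiffOn_pInvL φ
  sec_mem := fun z hz => hatVMu_ofL π h hz
  sec_src := fun _ hz => φ.map_tgt _ hz
  fn_sec := fun z hz => (congrArg toL (cotFn_ofL hz)).trans (toL_ofL z)
  fn_mem := fun γ hγ => φ.map_src _ hγ
  sec_fn := fun γ hγ => Subtype.ext (cotInv_ofL_toL π h hγ γ.2)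
  sat := fun γ γ' e hγ => by
    obtain rfl : γ = γ' := e
    exact ⟨hγ, rfl⟩

lemma Level.exists_src (π : Fibration n M) (γ : Level π) : ∃ z : Level π, id z = γ ∧
    z.1 ∈ (Level.quotChart π (π.adapted γ.1.1.1) (π.adapted_fst γ.1.1.1)).src :=
  ⟨γ, rfl, π.mem_adapted γ.1.1.1⟩

/-- The smooth structure of `{γ(V_μ) = 1}` as an embedded submanifold of `T*(T*M)`. -/
instance (π : Fibration n M) : ChartedSpace (LModel n) (Level π) :=
  QuotChart.chartedSpace Topology.IsQuotientMap.id
    (fun γ => Level.quotChart π (π.adapted γ.1.1.1) (π.adapted_fst γ.1.1.1)) (Level.exists_src π)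

instance (π : Fibration n M) : IsManifold 𝓘(ℝ, LModel n) ∞ (Level π) :=
  QuotChart.isManifold Topology.IsQuotientMap.id
    (fun γ => Level.quotChart π (π.adapted γ.1.1.1) (π.adapted_fst γ.1.1.1)) (Level.exists_src π)

/-- The phase bundle `Pμ` of the AV-bundle `μ`: the space of orbits of the lifted action of `ℝ`
on `{γ(V_μ) = 1}`. -/
def PMu (π : Fibration n M) : Type _ :=
  Quot fun Γ Γ' : Level π => ∃ s : ℝ, Γ'.1 = liftAct π s Γ.1

/-- The canonical projection `{γ(V_μ) = 1} → Pμ`. -/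
def PMu.mk (π : Fibration n M) (Γ : Level π) : PMu π := Quot.mk _ Γ

instance (π : Fibration n M) : TopologicalSpace (PMu π) :=
  TopologicalSpace.coinduced (PMu.mk π) inferInstance

lemma PMu.mk_isQuotientMap (π : Fibration n M) : Topology.IsQuotientMap (PMu.mk π) :=
  ⟨⟨rfl⟩, Quot.mk_surjective⟩

/-- The model space of `Pμ`, with coordinates `(((t, q), p), (P_(t, q), P_p))`. -/
abbrev PModel (n : ℕ) : Type := VModel n × (CovM n × ((Fib n →L[ℝ] ℝ) →L[ℝ] ℝ))

/-- The coordinates of `T*(T*M)` which are constant on the orbits of the lifted action. -/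
def Level.pFn (φ : Coord (𝓡 (n + 1)) M (ℝ × Fib n)) (γ : CotCot n M) : PModel n :=
  (((toL (φ.cot.cotFn γ)).1.1,
    (toL (φ.cot.cotFn γ)).1.2.comp (ContinuousLinearMap.inr ℝ ℝ (Fib n))),
    (toL (φ.cot.cotFn γ)).2)

/-- The point of `{γ(V_μ) = 1}` with `p_t = 0` and given other coordinates. -/
def Level.pInv (φ : Coord (𝓡 (n + 1)) M (ℝ × Fib n)) (z : PModel n) : CotCot n M :=
  φ.cot.cotInv (ofL ((z.1.1, z.1.2.comp (ContinuousLinearMap.snd ℝ ℝ (Fib n))), z.2))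

lemma Level.pFn_liftAct (π : Fibration n M) {φ : Coord (𝓡 (n + 1)) M (ℝ × Fib n)}
    (h : ∀ x ∈ φ.src, (φ.fn x).1 = π.toFun x) (s : ℝ) {γ : CotCot n M}
    (hγ : γ.1.1 ∈ φ.src) : Level.pFn φ (liftAct π s γ) = Level.pFn φ γ := by
  unfold Level.pFn
  rw [cotFn_liftAct π h s hγ]
  refine Prod.ext (Prod.ext ?_ ?_) rfl
  · simp [toL, dirV]
  · ext; simp [toL, dirV]

lemma PMu.mk_pInv (π : Fibration n M) {φ : Coord (𝓡 (n + 1)) M (ℝ × Fib n)}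
    (h : ∀ x ∈ φ.src, (φ.fn x).1 = π.toFun x) (Γ Γ' : Level π) (hΓ : Γ.1.1.1 ∈ φ.src)
    (e : Γ'.1 = Level.pInv φ (Level.pFn φ Γ.1)) : PMu.mk π Γ' = PMu.mk π Γ := by
  refine Quot.sound ⟨(φ.cot.cotFn Γ.1).1.2 (1, 0), ?_⟩
  set s := (φ.cot.cotFn Γ.1).1.2 (1, 0) with hs
  have ht : ∀ z : LModel n, z.1.1 ∈ φ.tgt → ofL z ∈ φ.cot.cot.tgt := fun z hz =>
    ⟨⟨hz, mem_univ _⟩, mem_univ _⟩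
  have hy : (φ.cot.cotFn Γ.1).1.1 ∈ φ.tgt := φ.map_src _ hΓ
  have hy' : ((((Level.pFn φ Γ.1).1.1, (Level.pFn φ Γ.1).1.2.comp
      (ContinuousLinearMap.snd ℝ ℝ (Fib n))), (Level.pFn φ Γ.1).2) : LModel n).1.1 ∈ φ.tgt := hy
  have hs' : Γ'.1.1.1 ∈ φ.src := by rw [e]; exact φ.map_tgt _ hy'
  have e1 : φ.cot.cotFn Γ'.1 = _ := (congrArg _ e).trans (φ.cot.cot.right_inv _ (ht _ hy'))
  have hl : liftAct π s Γ'.1 ∈ φ.cot.cot.src := hs'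
  have hΓc : Γ.1 ∈ φ.cot.cot.src := hΓ
  have e2 := cotFn_liftAct π h s hs'
  rw [e1] at e2
  have e3 : φ.cot.cot.fn Γ.1 = φ.cot.cot.fn (liftAct π s Γ'.1) := by
    refine Eq.trans ?_ e2.symm
    have h1 : (φ.cot.cotFn Γ.1).2 (dirV n) = 1 := (hatVMu_eq π h hΓ).symm.trans Γ.2
    have h2 := ofL_toL _ h1
    refine h2.symm.trans (Prod.ext ?_ rfl)
    refine Prod.ext ?_ ?_
    · simp [ofL, toL, Level.pFn, dirV]
    · have := CovM_decomp (φ.cot.cotFn Γ.1).1.2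
      rw [← hs] at this
      refine this.trans ?_
      simp only [ofL, Level.pFn, toL, dirV]
      rw [add_comm]
      rfl
  rw [← φ.cot.cot.left_inv _ hl, ← e3, φ.cot.cot.left_inv _ hΓc]

lemma Level.contMDiffOn_pFn (φ : Coord (𝓡 (n + 1)) M (ℝ × Fib n)) :
    ContMDiffOn (cotModel (cotModel (𝓡 (n + 1)))) 𝓘(ℝ, PModel n) ∞ (Level.pFn φ)
      φ.cot.cot.src := by
  have hs : ContDiff ℝ ∞ (fun z : LModel n =>
    (((z.1.1, z.1.2.comp (ContinuousLinearMap.inr ℝ ℝ (Fib n))), z.2) : PModel n)) := by fun_prop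
  exact hs.contMDiff.comp_contMDiffOn (contMDiffOn_pFnL φ)

lemma Level.contMDiffOn_pInv (φ : Coord (𝓡 (n + 1)) M (ℝ × Fib n)) :
    ContMDiffOn 𝓘(ℝ, PModel n) (cotModel (cotModel (𝓡 (n + 1)))) ∞ (Level.pInv φ)
      {z | z.1.1 ∈ φ.tgt} := by
  have hs : ContDiff ℝ ∞ (fun z : PModel n =>
    (((z.1.1, z.1.2.comp (ContinuousLinearMap.snd ℝ ℝ (Fib n))), z.2) : LModel n)) := by fun_prop
  exact (contMDiffOn_pInvL φ).comp hs.contMDiff.contMDiffOn fun _ hz => hz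

lemma Level.pFn_pInv {φ : Coord (𝓡 (n + 1)) M (ℝ × Fib n)} {z : PModel n} (hz : z.1.1 ∈ φ.tgt) :
    Level.pFn φ (Level.pInv φ z) = z := by
  have e : toL (φ.cot.cotFn (φ.cot.cotInv (ofL ((z.1.1, z.1.2.comp
      (ContinuousLinearMap.snd ℝ ℝ (Fib n))), z.2)))) = _ :=
    (congrArg toL (cotFn_ofL hz)).trans (toL_ofL _)
  unfold Level.pFn Level.pInv
  rw [e]
  rfl

lemma PMu.sat (π : Fibration n M) {φ : Coord (𝓡 (n + 1)) M (ℝ × Fib n)}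
    (h : ∀ x ∈ φ.src, (φ.fn x).1 = π.toFun x) {Γ Γ' : Level π} (e : PMu.mk π Γ = PMu.mk π Γ')
    (hΓ : Γ.1.1.1 ∈ φ.src) : Γ'.1.1.1 ∈ φ.src ∧ Level.pFn φ Γ.1 = Level.pFn φ Γ'.1 := by
  have key : ∀ Γ Γ' : Level π, Relation.EqvGen
      (fun Γ Γ' : Level π => ∃ s : ℝ, Γ'.1 = liftAct π s Γ.1) Γ Γ' →
      (Γ.1.1.1 ∈ φ.src ↔ Γ'.1.1.1 ∈ φ.src) ∧
        (Γ.1.1.1 ∈ φ.src → Level.pFn φ Γ.1 = Level.pFn φ Γ'.1) := by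
    intro Γ Γ' hr
    induction hr with
    | rel a b hab =>
      obtain ⟨s, hs⟩ := hab
      rw [hs]
      exact ⟨Iff.rfl, fun ha => (Level.pFn_liftAct π h s ha).symm⟩
    | refl a => exact ⟨Iff.rfl, fun _ => rfl⟩
    | symm a b _ ih => exact ⟨ih.1.symm, fun hb => (ih.2 (ih.1.2 hb)).symm⟩
    | trans a b c _ _ ih1 ih2 =>
      exact ⟨ih1.1.trans ih2.1, fun ha => (ih1.2 ha).trans (ih2.2 (ih1.1.1 ha))⟩
  have hk := key Γ Γ' (Quot.eqvGen_exact e)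
  exact ⟨hk.1.1 hΓ, hk.2 hΓ⟩

/-- The chart of `Pμ` induced by adapted coordinates of `M`, in terms of a chart of
`{γ(V_μ) = 1}`. -/
def PMu.quotChart (π : Fibration n M) (φ : Coord (𝓡 (n + 1)) M (ℝ × Fib n))
    (h : ∀ x ∈ φ.src, (φ.fn x).1 = π.toFun x) :
    QuotChart (cotModel (cotModel (𝓡 (n + 1)))) (PMu.mk π) (PModel n) where
  src := φ.cot.cot.src
  tgt := {z | z.1.1 ∈ φ.tgt}
  fn := Level.pFn φ
  sec := Level.pInv φ
  open_src := φ.cot.cot.open_src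
  open_tgt := φ.open_tgt.preimage (by fun_prop)
  smooth_fn := Level.contMDiffOn_pFn φ
  smooth_sec := Level.contMDiffOn_pInv φ
  sec_mem := fun _ hz => hatVMu_ofL π h hz
  sec_src := fun _ hz => φ.map_tgt _ hz
  fn_sec := fun _ hz => Level.pFn_pInv hz
  fn_mem := fun _ hΓ => φ.map_src _ hΓ
  sec_fn := fun Γ hΓ => PMu.mk_pInv π h Γ _ hΓ rfl
  sat := fun Γ Γ' e hΓ => PMu.sat π h e hΓ

/-- A representative of a point of `Pμ`. -/
def PMu.rep (π : Fibration n M) (z : PMu π) : Level π := Quot.out z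

lemma PMu.exists_src (π : Fibration n M) (z : PMu π) : ∃ Γ : Level π, PMu.mk π Γ = z ∧
    Γ.1 ∈ (PMu.quotChart π (π.adapted (PMu.rep π z).1.1.1)
      (π.adapted_fst (PMu.rep π z).1.1.1)).src :=
  ⟨PMu.rep π z, Quot.out_eq z, π.mem_adapted (PMu.rep π z).1.1.1⟩

/-- The smooth structure of `Pμ`, with the charts induced by adapted coordinates of `M`. -/
instance (π : Fibration n M) : ChartedSpace (PModel n) (PMu π) :=
  QuotChart.chartedSpace (PMu.mk_isQuotientMap π)
    (fun z => PMu.quotChart π (π.adapted (PMu.rep π z).1.1.1)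
      (π.adapted_fst (PMu.rep π z).1.1.1)) (PMu.exists_src π)

instance (π : Fibration n M) : IsManifold 𝓘(ℝ, PModel n) ∞ (PMu π) :=
  QuotChart.isManifold (PMu.mk_isQuotientMap π)
    (fun z => PMu.quotChart π (π.adapted (PMu.rep π z).1.1.1)
      (π.adapted_fst (PMu.rep π z).1.1.1)) (PMu.exists_src π)

/-- The pullback `μ*dπ₁*` at a point of `T*M`. -/
def muDpi (π : Fibration n M) (α : CotBundle (𝓡 (n + 1)) M) : CotSpace (cotModel (𝓡 (n + 1))) α :=
  ContinuousLinearMap.comp (dmap 𝓘(ℝ, VModel n) 𝓘(ℝ, ℝ) (piOneStar π) (mu π α))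
    (dmap (cotModel (𝓡 (n + 1))) 𝓘(ℝ, VModel n) (mu π) α)

/-- Translation of covectors of `T*M` by multiples of `μ*dπ₁*`. -/
def shift (π : Fibration n M) (c : ℝ) (γ : CotCot n M) : CotCot n M :=
  ⟨γ.1, γ.2 + c • muDpi π γ.1⟩

/-- The differential of `t` in the coordinates of `T*M`. -/
def dtM (n : ℕ) : ((ℝ × Fib n) × CovM n) →L[ℝ] ℝ :=
  (ContinuousLinearMap.fst ℝ ℝ (Fib n)).comp (ContinuousLinearMap.fst ℝ (ℝ × Fib n) (CovM n))

lemma dmap_piOneStar_mu (π : Fibration n M) {φ : Coord (𝓡 (n + 1)) M (ℝ × Fib n)}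
    (h : ∀ x ∈ φ.src, (φ.fn x).1 = π.toFun x) {α : CotBundle (𝓡 (n + 1)) M} (hα : α.1 ∈ φ.src) :
    ((dmap 𝓘(ℝ, VModel n) 𝓘(ℝ, ℝ) (piOneStar π) (mu π α)).comp
      (dmap (cotModel (𝓡 (n + 1))) 𝓘(ℝ, VModel n) (mu π) α)).comp (φ.cot.dinv (φ.cotFn α)) =
      dtM n := by
  have hc : φ.cotFn α ∈ φ.cot.tgt := φ.cot.map_src α hα
  have e0 : φ.cot.inv (φ.cotFn α) = α := φ.cot.left_inv α hα
  have h1 : MDifferentiableAt 𝓘(ℝ, VModel n) 𝓘(ℝ, ℝ) (piOneStar π) (mu π α) :=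
    (piOneStar_contMDiff π).mdifferentiableAt (by simp)
  have h2 : MDifferentiableAt (cotModel (𝓡 (n + 1))) 𝓘(ℝ, VModel n) (mu π) α :=
    (mu_contMDiff π).mdifferentiableAt (by simp)
  have h12 : MDifferentiableAt (cotModel (𝓡 (n + 1))) 𝓘(ℝ, ℝ) (fun β => piOneStar π (mu π β))
      (φ.cot.inv (φ.cotFn α)) := by
    rw [e0]; exact h1.comp α h2
  rw [← dmap_comp _ _ _ h1 h2, Coord.dinv]
  have h3 := dmap_comp 𝓘(ℝ, (ℝ × Fib n) × CovM n) (cotModel (𝓡 (n + 1))) 𝓘(ℝ, ℝ) h12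
    (φ.cot.mdiff_inv hc)
  rw [e0] at h3
  rw [← h3, dmap_congr _ _ (g := dtM n) (Filter.eventuallyEq_of_mem
    (φ.cot.open_tgt.mem_nhds hc) fun c hc' => ?_)]
  · exact dmap_of _ _ (dtM n).hasFDerivAt.hasMFDerivAt
  · have h4 := h _ (φ.map_tgt _ hc'.1)
    rw [φ.right_inv _ hc'.1] at h4
    exact h4.symm

lemma cotFn_shift (π : Fibration n M) {φ : Coord (𝓡 (n + 1)) M (ℝ × Fib n)}
    (h : ∀ x ∈ φ.src, (φ.fn x).1 = π.toFun x) (c : ℝ) {γ : CotCot n M} (hγ : γ.1.1 ∈ φ.src) :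
    φ.cot.cotFn (shift π c γ) = ((φ.cot.cotFn γ).1, (φ.cot.cotFn γ).2 + c • dtM n) := by
  refine Prod.ext rfl (ContinuousLinearMap.ext fun w => ?_)
  have e := DFunLike.congr_fun (dmap_piOneStar_mu π h hγ) w
  exact congrArg (fun r => γ.2 (φ.cot.dinv (φ.cotFn γ.1) w) + c * r) e

lemma hatVMu_shift (π : Fibration n M) (c : ℝ) (γ : CotCot n M) :
    hatVMu π (shift π c γ) = hatVMu π γ := by
  have h := π.adapted_fst γ.1.1
  have hγ := π.mem_adapted γ.1.1
  have hγ' : (shift π c γ).1.1 ∈ (π.adapted γ.1.1).src := hγ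
  rw [hatVMu_eq π h hγ, hatVMu_eq π h hγ', cotFn_shift π h c hγ]
  simp [dtM, dirV]

/-- The quotient `Pμ/⟨dπ₁*⟩`: two classes in `Pμ` are identified if they have representatives
which differ by a multiple of `μ*dπ₁*`. -/
def PMuQuot (π : Fibration n M) : Type _ :=
  Quot fun z z' : PMu π => ∃ Γ Γ' : Level π, ∃ c : ℝ,
    PMu.mk π Γ = z ∧ PMu.mk π Γ' = z' ∧ Γ'.1 = shift π c Γ.1

/-- The canonical projection `Pμ → Pμ/⟨dπ₁*⟩`. -/
def PMuQuot.mk (π : Fibration n M) (z : PMu π) : PMuQuot π := Quot.mk _ z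

instance (π : Fibration n M) : TopologicalSpace (PMuQuot π) :=
  TopologicalSpace.coinduced (PMuQuot.mk π) inferInstance

/-- The canonical projection `{γ(V_μ) = 1} → Pμ/⟨dπ₁*⟩`. -/
def PMuQuot.mkL (π : Fibration n M) (Γ : Level π) : PMuQuot π := PMuQuot.mk π (PMu.mk π Γ)

lemma PMuQuot.mkL_isQuotientMap (π : Fibration n M) : Topology.IsQuotientMap (PMuQuot.mkL π) :=
  (show Topology.IsQuotientMap (PMuQuot.mk π) from ⟨⟨rfl⟩, Quot.mk_surjective⟩).comp
    (PMu.mk_isQuotientMap π)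

/-- The model space of `Pμ/⟨dπ₁*⟩`, with coordinates `(((t, q), p), (P_q, P_p))`. -/
abbrev RModel (n : ℕ) : Type :=
  VModel n × ((Fib n →L[ℝ] ℝ) × ((Fib n →L[ℝ] ℝ) →L[ℝ] ℝ))

/-- The coordinates of `T*(T*M)` which are constant on the classes of `Pμ/⟨dπ₁*⟩`. -/
def Level.rFn (φ : Coord (𝓡 (n + 1)) M (ℝ × Fib n)) (γ : CotCot n M) : RModel n :=
  ((Level.pFn φ γ).1,
    ((Level.pFn φ γ).2.1.comp (ContinuousLinearMap.inr ℝ ℝ (Fib n)), (Level.pFn φ γ).2.2))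

/-- The point of `{γ(V_μ) = 1}` with `p_t = 0`, `P_t = 0` and given other coordinates. -/
def Level.rInv (φ : Coord (𝓡 (n + 1)) M (ℝ × Fib n)) (z : RModel n) : CotCot n M :=
  Level.pInv φ (z.1, (z.2.1.comp (ContinuousLinearMap.snd ℝ ℝ (Fib n)), z.2.2))

lemma Level.contMDiffOn_rFn (φ : Coord (𝓡 (n + 1)) M (ℝ × Fib n)) :
    ContMDiffOn (cotModel (cotModel (𝓡 (n + 1)))) 𝓘(ℝ, RModel n) ∞ (Level.rFn φ)
      φ.cot.cot.src := by
  have hs : ContDiff ℝ ∞ (fun z : PModel n =>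
    ((z.1, (z.2.1.comp (ContinuousLinearMap.inr ℝ ℝ (Fib n)), z.2.2)) : RModel n)) := by fun_prop
  exact hs.contMDiff.comp_contMDiffOn (Level.contMDiffOn_pFn φ)

lemma Level.contMDiffOn_rInv (φ : Coord (𝓡 (n + 1)) M (ℝ × Fib n)) :
    ContMDiffOn 𝓘(ℝ, RModel n) (cotModel (cotModel (𝓡 (n + 1)))) ∞ (Level.rInv φ)
      {z | z.1.1 ∈ φ.tgt} := by
  have hs : ContDiff ℝ ∞ (fun z : RModel n =>
    ((z.1, (z.2.1.comp (ContinuousLinearMap.snd ℝ ℝ (Fib n)), z.2.2)) : PModel n)) := by fun_prop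
  exact (Level.contMDiffOn_pInv φ).comp hs.contMDiff.contMDiffOn fun _ hz => hz

lemma Level.rFn_rInv {φ : Coord (𝓡 (n + 1)) M (ℝ × Fib n)} {z : RModel n} (hz : z.1.1 ∈ φ.tgt) :
    Level.rFn φ (Level.rInv φ z) = z := by
  have e := Level.pFn_pInv (φ := φ)
    (z := (z.1, (z.2.1.comp (ContinuousLinearMap.snd ℝ ℝ (Fib n)), z.2.2))) hz
  unfold Level.rFn Level.rInv
  rw [e]
  rfl

lemma Level.pFn_shift (π : Fibration n M) {φ : Coord (𝓡 (n + 1)) M (ℝ × Fib n)}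
    (h : ∀ x ∈ φ.src, (φ.fn x).1 = π.toFun x) (c : ℝ) {γ : CotCot n M} (hγ : γ.1.1 ∈ φ.src) :
    Level.pFn φ (shift π c γ) = ((Level.pFn φ γ).1,
      ((Level.pFn φ γ).2.1 + c • ContinuousLinearMap.fst ℝ ℝ (Fib n), (Level.pFn φ γ).2.2)) := by
  unfold Level.pFn
  rw [cotFn_shift π h c hγ]
  refine Prod.ext rfl (Prod.ext ?_ ?_)
  · ext <;> simp [toL, dtM]
  · ext; simp [toL, dtM]

lemma Level.rFn_shift (π : Fibration n M) {φ : Coord (𝓡 (n + 1)) M (ℝ × Fib n)}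
    (h : ∀ x ∈ φ.src, (φ.fn x).1 = π.toFun x) (c : ℝ) {γ : CotCot n M} (hγ : γ.1.1 ∈ φ.src) :
    Level.rFn φ (shift π c γ) = Level.rFn φ γ := by
  unfold Level.rFn
  rw [Level.pFn_shift π h c hγ]
  refine Prod.ext rfl (Prod.ext ?_ rfl)
  ext
  simp

lemma PMu.mk_eq (π : Fibration n M) {φ : Coord (𝓡 (n + 1)) M (ℝ × Fib n)}
    (h : ∀ x ∈ φ.src, (φ.fn x).1 = π.toFun x) {Γ Γ' : Level π} (hΓ : Γ.1.1.1 ∈ φ.src)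
    (hΓ' : Γ'.1.1.1 ∈ φ.src) (e : Level.pFn φ Γ.1 = Level.pFn φ Γ'.1) :
    PMu.mk π Γ = PMu.mk π Γ' := by
  have hy : (Level.pFn φ Γ.1).1.1 ∈ φ.tgt := φ.map_src _ hΓ
  let Γ₀ : Level π := ⟨Level.pInv φ (Level.pFn φ Γ.1), hatVMu_ofL π h hy⟩
  exact (PMu.mk_pInv π h Γ Γ₀ hΓ rfl).symm.trans
    (PMu.mk_pInv π h Γ' Γ₀ hΓ' (congrArg (Level.pInv φ) e))

lemma PMuQuot.mk_rInv (π : Fibration n M) {φ : Coord (𝓡 (n + 1)) M (ℝ × Fib n)}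
    (h : ∀ x ∈ φ.src, (φ.fn x).1 = π.toFun x) (Γ Γ' : Level π) (hΓ : Γ.1.1.1 ∈ φ.src)
    (e : Γ'.1 = Level.rInv φ (Level.rFn φ Γ.1)) : PMuQuot.mkL π Γ' = PMuQuot.mkL π Γ := by
  have hy : (Level.pFn φ Γ.1).1.1 ∈ φ.tgt := φ.map_src _ hΓ
  have hs : Γ'.1.1.1 ∈ φ.src := by rw [e]; exact φ.map_tgt _ hy
  let c : ℝ := (Level.pFn φ Γ.1).2.1 (1, 0)
  let Γ'' : Level π := ⟨shift π c Γ'.1, (hatVMu_shift π c Γ'.1).trans Γ'.2⟩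
  have hs' : Γ''.1.1.1 ∈ φ.src := hs
  have e1 : Level.pFn φ Γ'.1 = _ := (congrArg (Level.pFn φ) e).trans (Level.pFn_pInv hy)
  have e2 : Level.pFn φ Γ''.1 = Level.pFn φ Γ.1 := by
    refine (Level.pFn_shift π h c hs).trans ?_
    rw [e1]
    refine Prod.ext rfl (Prod.ext ?_ rfl)
    refine Eq.trans ?_ (CovM_decomp (Level.pFn φ Γ.1).2.1).symm
    exact add_comm _ _
  have e3 : PMuQuot.mkL π Γ' = PMuQuot.mkL π Γ'' := Quot.sound ⟨Γ', Γ'', c, rfl, rfl, rfl⟩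
  exact e3.trans (congrArg (PMuQuot.mk π) (PMu.mk_eq π h hs' hΓ e2))

lemma PMuQuot.sat (π : Fibration n M) {φ : Coord (𝓡 (n + 1)) M (ℝ × Fib n)}
    (h : ∀ x ∈ φ.src, (φ.fn x).1 = π.toFun x) {Γ Γ' : Level π}
    (e : PMuQuot.mkL π Γ = PMuQuot.mkL π Γ') (hΓ : Γ.1.1.1 ∈ φ.src) :
    Γ'.1.1.1 ∈ φ.src ∧ Level.rFn φ Γ.1 = Level.rFn φ Γ'.1 := by
  have hm : ∀ Γ Γ' : Level π, PMu.mk π Γ = PMu.mk π Γ' → Γ.1.1.1 ∈ φ.src →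
      Γ'.1.1.1 ∈ φ.src ∧ Level.rFn φ Γ.1 = Level.rFn φ Γ'.1 := fun Γ Γ' e hΓ => by
    obtain ⟨h1, h2⟩ := PMu.sat π h e hΓ
    refine ⟨h1, ?_⟩
    unfold Level.rFn
    rw [h2]
  have key : ∀ z z' : PMu π, Relation.EqvGen (fun z z' : PMu π => ∃ Γ Γ' : Level π, ∃ c : ℝ,
      PMu.mk π Γ = z ∧ PMu.mk π Γ' = z' ∧ Γ'.1 = shift π c Γ.1) z z' →
      ∀ Γ Γ' : Level π, PMu.mk π Γ = z → PMu.mk π Γ' = z' →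
      (Γ.1.1.1 ∈ φ.src ↔ Γ'.1.1.1 ∈ φ.src) ∧
        (Γ.1.1.1 ∈ φ.src → Level.rFn φ Γ.1 = Level.rFn φ Γ'.1) := by
    intro z z' hr
    induction hr with
    | rel a b hab =>
      intro Γ Γ' hz hz'
      obtain ⟨Λ, Λ', c, ha, hb, hc⟩ := hab
      have i1 : Λ'.1.1.1 ∈ φ.src ↔ Λ.1.1.1 ∈ φ.src := by rw [hc]; exact Iff.rfl
      have i2 : Λ.1.1.1 ∈ φ.src → Level.rFn φ Λ.1 = Level.rFn φ Λ'.1 := fun hΛ => by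
        rw [hc]; exact (Level.rFn_shift π h c hΛ).symm
      have ea := hz.trans ha.symm
      have eb := hb.trans hz'.symm
      refine ⟨⟨fun hg => (hm _ _ eb (i1.2 (hm _ _ ea hg).1)).1,
        fun hg => (hm _ _ ea.symm (i1.1 (hm _ _ eb.symm hg).1)).1⟩, fun hg => ?_⟩
      have k1 := hm _ _ ea hg
      exact k1.2.trans ((i2 k1.1).trans (hm _ _ eb (i1.2 k1.1)).2)
    | refl a =>
      intro Γ Γ' hz hz'
      have ea := hz.trans hz'.symm
      exact ⟨⟨fun hg => (hm _ _ ea hg).1, fun hg => (hm _ _ ea.symm hg).1⟩,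
        fun hg => (hm _ _ ea hg).2⟩
    | symm a b _ ih =>
      intro Γ Γ' hz hz'
      have i := ih Γ' Γ hz' hz
      exact ⟨i.1.symm, fun hg => (i.2 (i.1.2 hg)).symm⟩
    | trans a b c _ _ ih1 ih2 =>
      intro Γ Γ' hz hz'
      obtain ⟨Λ, hΛ⟩ := (PMu.mk_isQuotientMap π).surjective b
      have i1 := ih1 Γ Λ hz hΛ
      have i2 := ih2 Λ Γ' hΛ hz'
      exact ⟨i1.1.trans i2.1, fun hg => (i1.2 hg).trans (i2.2 (i1.1.1 hg))⟩
  have hk := key _ _ (Quot.eqvGen_exact e) Γ Γ' rfl rfl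
  exact ⟨hk.1.1 hΓ, hk.2 hΓ⟩

/-- The chart of `Pμ/⟨dπ₁*⟩` induced by adapted coordinates of `M`. -/
def PMuQuot.quotChart (π : Fibration n M) (φ : Coord (𝓡 (n + 1)) M (ℝ × Fib n))
    (h : ∀ x ∈ φ.src, (φ.fn x).1 = π.toFun x) :
    QuotChart (cotModel (cotModel (𝓡 (n + 1)))) (PMuQuot.mkL π) (RModel n) where
  src := φ.cot.cot.src
  tgt := {z | z.1.1 ∈ φ.tgt}
  fn := Level.rFn φ
  sec := Level.rInv φ
  open_src := φ.cot.cot.open_src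
  open_tgt := φ.open_tgt.preimage (by fun_prop)
  smooth_fn := Level.contMDiffOn_rFn φ
  smooth_sec := Level.contMDiffOn_rInv φ
  sec_mem := fun _ hz => hatVMu_ofL π h hz
  sec_src := fun _ hz => φ.map_tgt _ hz
  fn_sec := fun _ hz => Level.rFn_rInv hz
  fn_mem := fun _ hΓ => φ.map_src _ hΓ
  sec_fn := fun Γ hΓ => PMuQuot.mk_rInv π h Γ _ hΓ rfl
  sat := fun _ _ e hΓ => PMuQuot.sat π h e hΓ

/-- A representative of a point of `Pμ/⟨dπ₁*⟩`. -/
def PMuQuot.rep (π : Fibration n M) (z : PMuQuot π) : Level π := PMu.rep π (Quot.out z)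

lemma PMuQuot.exists_src (π : Fibration n M) (z : PMuQuot π) : ∃ Γ : Level π,
    PMuQuot.mkL π Γ = z ∧ Γ.1 ∈ (PMuQuot.quotChart π (π.adapted (PMuQuot.rep π z).1.1.1)
      (π.adapted_fst (PMuQuot.rep π z).1.1.1)).src :=
  ⟨PMuQuot.rep π z, (congrArg (PMuQuot.mk π) (Quot.out_eq (Quot.out z))).trans (Quot.out_eq z),
    π.mem_adapted (PMuQuot.rep π z).1.1.1⟩

/-- The smooth structure of `Pμ/⟨dπ₁*⟩`, with the charts induced by adapted coordinates
of `M`. -/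
instance (π : Fibration n M) : ChartedSpace (RModel n) (PMuQuot π) :=
  QuotChart.chartedSpace (PMuQuot.mkL_isQuotientMap π)
    (fun z => PMuQuot.quotChart π (π.adapted (PMuQuot.rep π z).1.1.1)
      (π.adapted_fst (PMuQuot.rep π z).1.1.1)) (PMuQuot.exists_src π)

instance (π : Fibration n M) : IsManifold 𝓘(ℝ, RModel n) ∞ (PMuQuot π) :=
  QuotChart.isManifold (PMuQuot.mkL_isQuotientMap π)
    (fun z => PMuQuot.quotChart π (π.adapted (PMuQuot.rep π z).1.1.1)
      (π.adapted_fst (PMuQuot.rep π z).1.1.1)) (PMuQuot.exists_src π)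

end Spaces

section Tensors

variable {E H : Type*} [NormedAddCommGroup E] [NormedSpace ℝ E] [TopologicalSpace H]
  {N : Type*} [TopologicalSpace N] [ChartedSpace H N]
  {E' H' : Type*} [NormedAddCommGroup E'] [NormedSpace ℝ E'] [TopologicalSpace H']
  {N' : Type*} [TopologicalSpace N'] [ChartedSpace H' N']

/-- The preferred chart at a point of a manifold without boundary, as a coordinate system. -/
def Coord.ext (I : ModelWithCorners ℝ E H) [I.Boundaryless] [IsManifold I ∞ N] (x : N) :
    Coord I N E where
  src := (extChartAt I x).source
  tgt := (extChartAt I x).target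
  fn := extChartAt I x
  inv := (extChartAt I x).symm
  open_src := isOpen_extChartAt_source x
  open_tgt := isOpen_extChartAt_target x
  map_src := fun _ h => (extChartAt I x).map_source h
  map_tgt := fun _ h => (extChartAt I x).map_target h
  left_inv := fun _ h => (extChartAt I x).left_inv h
  right_inv := fun _ h => (extChartAt I x).right_inv h
  smooth_fn := by
    rw [extChartAt_source]
    exact contMDiffOn_extChartAt
  smooth_inv := contMDiffOn_extChartAt_symm x

/-- A field of bilinear forms on the tangent spaces of `N`, for example a `2`-form. Recall that
each tangent space of `N` is the model vector space `E`, through the preferred chart. -/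
abbrev FormField (_ : ModelWithCorners ℝ E H) (N : Type*) : Type _ := N → E →L[ℝ] E →L[ℝ] ℝ

/-- A field of bilinear forms on the cotangent spaces of `N`, for example a bivector field. -/
abbrev BivField (_ : ModelWithCorners ℝ E H) (N : Type*) : Type _ :=
  N → (E →L[ℝ] ℝ) →L[ℝ] (E →L[ℝ] ℝ) →L[ℝ] ℝ

/-- The exterior derivative `dθ(v, w) = D_v θ(w) - D_w θ(v)` of a `1`-form `θ`, computed in the
preferred chart at each point. -/
def extDerivOne (I : ModelWithCorners ℝ E H) [I.Boundaryless] [IsManifold I ∞ N]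
    (θ : N → E →L[ℝ] ℝ) : FormField I N := fun x =>
  let φ : Coord I N E := Coord.ext I x
  let A : E →L[ℝ] E →L[ℝ] ℝ :=
    fderiv ℝ (fun y => (θ (φ.inv y)).comp (φ.dinv y)) (φ.fn x)
  (A - A.flip).bilinearComp (φ.dfn x) (φ.dfn x)

/-- The expression of a field of bilinear forms in coordinates. -/
def FormField.loc {I : ModelWithCorners ℝ E H} (φ : Coord I N E) (σ : FormField I N) (y : E) :
    E →L[ℝ] E →L[ℝ] ℝ :=
  (σ (φ.inv y)).bilinearComp (φ.dinv y) (φ.dinv y)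

/-- Symplectic forms: smooth, closed and nondegenerate `2`-forms. -/
structure IsSymplectic (I : ModelWithCorners ℝ E H) [I.Boundaryless] [IsManifold I ∞ N]
    (σ : FormField I N) : Prop where
  alternating : ∀ x v, σ x v v = 0
  smooth : ∀ x, ContDiffOn ℝ ∞ (FormField.loc (Coord.ext I x) σ) (Coord.ext I x).tgt
  closed : ∀ x u v w,
    fderiv ℝ (FormField.loc (Coord.ext I x) σ) ((Coord.ext I x).fn x) u v w +
      fderiv ℝ (FormField.loc (Coord.ext I x) σ) ((Coord.ext I x).fn x) v w u +
      fderiv ℝ (FormField.loc (Coord.ext I x) σ) ((Coord.ext I x).fn x) w u v = 0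
  nondegenerate : ∀ x v, (∀ w, σ x v w = 0) → v = 0

/-- The pullback `f*σ`. -/
def pullbackForm (I : ModelWithCorners ℝ E H) (I' : ModelWithCorners ℝ E' H') (f : N → N')
    (σ : FormField I' N') : FormField I N := fun x =>
  (σ (f x)).bilinearComp (dmap I I' f x) (dmap I I' f x)

/-- The Liouville `1`-form of the cotangent bundle: `θ_α(u) = α(T pr (u))`. -/
def liouville (I : ModelWithCorners ℝ E H) [IsManifold I ∞ N] (α : CotBundle I N) :
    (E × (E →L[ℝ] ℝ)) →L[ℝ] ℝ :=
  let a : E →L[ℝ] ℝ := α.2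
  a.comp (dmap (cotModel I) I (fun β : CotBundle I N => β.1) α)

/-- The canonical symplectic form `Ω = -dθ` of the cotangent bundle, `Ω = dqⁱ ∧ dp_i` in
coordinates. -/
def canonicalForm (I : ModelWithCorners ℝ E H) [I.Boundaryless] [IsManifold I ∞ N] :
    FormField (cotModel I) (CotBundle I N) :=
  fun α => -extDerivOne (cotModel I) (liouville I) α

/-- The bivector field associated with a nondegenerate `2`-form:
`Λ(i_v σ, i_w σ) = σ(v, w)`. -/
def bivOfForm {I : ModelWithCorners ℝ E H} (σ : FormField I N) : BivField I N := fun x =>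
  (σ x).bilinearComp (σ x).inverse (σ x).inverse

/-- The bracket `{f, g} = Λ(df, dg)`. -/
def bracket (I : ModelWithCorners ℝ E H) (Λ : BivField I N) (f g : N → ℝ) (x : N) : ℝ :=
  Λ x (dmap I 𝓘(ℝ, ℝ) f x) (dmap I 𝓘(ℝ, ℝ) g x)

/-- Poisson structures: smooth bivector fields whose bracket satisfies the Jacobi identity. -/
structure IsPoisson (I : ModelWithCorners ℝ E H) (Λ : BivField I N) : Prop where
  alternating : ∀ x a, Λ x a a = 0
  smooth : ∀ (U : Set N), IsOpen U → ∀ f g : N → ℝ, ContMDiffOn I 𝓘(ℝ, ℝ) ∞ f U →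
    ContMDiffOn I 𝓘(ℝ, ℝ) ∞ g U → ContMDiffOn I 𝓘(ℝ, ℝ) ∞ (bracket I Λ f g) U
  jacobi : ∀ (U : Set N), IsOpen U → ∀ f g h : N → ℝ, ContMDiffOn I 𝓘(ℝ, ℝ) ∞ f U →
    ContMDiffOn I 𝓘(ℝ, ℝ) ∞ g U → ContMDiffOn I 𝓘(ℝ, ℝ) ∞ h U → ∀ x ∈ U,
    bracket I Λ f (bracket I Λ g h) x + bracket I Λ g (bracket I Λ h f) x +
      bracket I Λ h (bracket I Λ f g) x = 0

/-- Poisson maps: smooth maps `f` with `f_* Λ = Λ'`. -/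
def IsPoissonMap (I : ModelWithCorners ℝ E H) (I' : ModelWithCorners ℝ E' H') (f : N → N')
    (Λ : BivField I N) (Λ' : BivField I' N') : Prop :=
  ContMDiff I I' ∞ f ∧ ∀ x a b,
    Λ' (f x) a b = Λ x (a.comp (dmap I I' f x)) (b.comp (dmap I I' f x))

/-- Anti-Poisson maps: smooth maps `f` with `f_* Λ = -Λ'`. -/
def IsAntiPoissonMap (I : ModelWithCorners ℝ E H) (I' : ModelWithCorners ℝ E' H') (f : N → N')
    (Λ : BivField I N) (Λ' : BivField I' N') : Prop :=
  ContMDiff I I' ∞ f ∧ ∀ x a b,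
    Λ' (f x) a b = -Λ x (a.comp (dmap I I' f x)) (b.comp (dmap I I' f x))

/-- The expression of a bivector field in coordinates. -/
def BivField.loc {I : ModelWithCorners ℝ E H} (φ : Coord I N E) (Λ : BivField I N) (y : E) :
    (E →L[ℝ] ℝ) →L[ℝ] (E →L[ℝ] ℝ) →L[ℝ] ℝ :=
  (Λ (φ.inv y)).bilinearComp (ContinuousLinearMap.precomp ℝ (φ.dfn (φ.inv y)))
    (ContinuousLinearMap.precomp ℝ (φ.dfn (φ.inv y)))

/-- The complete lift to `TN` of a bivector field. In the coordinates `(y, u)` of `TN` induced by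
coordinates `y` of `N`, the complete lift of `½ Λⁱʲ ∂_{yⁱ} ∧ ∂_{yʲ}` is
`Λⁱʲ ∂_{yⁱ} ∧ ∂_{uʲ} + ½ uᵏ (∂_k Λⁱʲ) ∂_{uⁱ} ∧ ∂_{uʲ}`; here `a ↦ a.comp (D.comp inl)` and
`a ↦ a.comp (D.comp inr)` are the components of a covector along `dy` and along `du`. -/
def completeLift (I : ModelWithCorners ℝ E H) [I.Boundaryless] [IsManifold I ∞ N]
    (Λ : BivField I N) : BivField I.tangent (TangentBundle I N) := fun w =>
  let φ : Coord I N E := Coord.ext I w.1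
  let y : E := (φ.tanFn w).1
  let u : E := (φ.tanFn w).2
  let D : (E × E) →L[ℝ] (E × E) := φ.tan.dinv (y, u)
  let py := ContinuousLinearMap.precomp ℝ (D.comp (ContinuousLinearMap.inl ℝ E E))
  let pu := ContinuousLinearMap.precomp ℝ (D.comp (ContinuousLinearMap.inr ℝ E E))
  let L : (E →L[ℝ] ℝ) →L[ℝ] (E →L[ℝ] ℝ) →L[ℝ] ℝ := BivField.loc φ Λ y
  let L' : (E →L[ℝ] ℝ) →L[ℝ] (E →L[ℝ] ℝ) →L[ℝ] ℝ := fderiv ℝ (BivField.loc φ Λ) y u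
  L.bilinearComp py pu + L.bilinearComp pu py + L'.bilinearComp pu pu

end Tensors

section PhaseMap

variable {n : ℕ} {M : Type*} [TopologicalSpace M]
  [ChartedSpace (EuclideanSpace ℝ (Fin (n + 1))) M] [IsManifold (𝓡 (n + 1)) ∞ M]

/-- The isomorphism inverse to `b_Ω : T(T*M) → T*(T*M)`, `b_Ω(v) = i_v Ω`, where `Ω` is the
canonical symplectic form of `T*M`. -/
def flatInv (n : ℕ) (M : Type*) [TopologicalSpace M]
    [ChartedSpace (EuclideanSpace ℝ (Fin (n + 1))) M] [IsManifold (𝓡 (n + 1)) ∞ M]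
    (γ : CotCot n M) :
    TangentBundle (cotModel (𝓡 (n + 1))) (CotBundle (𝓡 (n + 1)) M) :=
  ⟨γ.1, (canonicalForm (𝓡 (n + 1)) (N := M) γ.1).inverse γ.2⟩

/-- The map `φ = Tμ ∘ b_Ω⁻¹ : {γ(V_μ) = 1} → T(V*π)`. -/
def phi (π : Fibration n M) (Γ : Level π) : TangentBundle 𝓘(ℝ, VModel n) (VStar π) :=
  tangentMap (cotModel (𝓡 (n + 1))) 𝓘(ℝ, VModel n) (mu π) (flatInv n M Γ.1)

end PhaseMap

end Tulczyjew

end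

open Tulczyjew

/-!
Adapted coordinates `(t, q)` of `M`, with `t = π`, induce coordinates of `T*M`, `V*π`, `T(V*π)`,
`J¹π₁*`, `{γ(V_μ) = 1}`, `Pμ` and `Pμ/⟨dπ₁*⟩`. In these coordinates all the maps involved are
affine (`Coord.AffineIn`), and all the tensors have constant coefficients (`Coord.HasForm`,
`Coord.HasBiv`):

* `∂_q ∧ ∂_p` on `V*π`, with complete lift `∂_q ∧ ∂_{p'} + ∂_{q'} ∧ ∂_p`, which does not involve
  `∂_{t'}` and so is tangent to `J¹π₁*`;
* `dt ∧ dP_t + dq ∧ dP_q + dp ∧ dP_p` on `Pμ`, so that `∂_q ∧ ∂_{P_q} + ∂_p ∧ ∂_{P_p}` is its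
  projection to `Pμ/⟨dπ₁*⟩`.

The map induced by `Tμ ∘ b_Ω⁻¹` is `q' = P_p`, `p' = -P_q`, and the change of sign of `P_q` makes it
anti-Poisson (`phiLin_sharpJ`).

A tensor with constant coefficients in coordinates around each point is automatically smooth and
satisfies the Jacobi identity (`isPoisson_of_hasBiv`) or is closed (`isSymplectic_of_hasForm`).
Since the tensors are determined by their relation with the tensors of another manifold, by
a submersion or an immersion, they exist globally and are unique once they have the same
coefficients in all adapted coordinates.

Two facts rest on the symmetry of second derivatives: the exterior derivative may be computed in any
coordinates (`extDerivOne_eq`), which gives the canonical symplectic form of a cotangent bundle in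
all induced coordinates (`Coord.hasForm_canonicalForm`), and so may the complete lift of a bivector
field with constant coefficients (`Coord.HasBiv.completeLift`).
-/

noncomputable section

namespace Tulczyjew

section General

variable {E H : Type*} [NormedAddCommGroup E] [NormedSpace ℝ E] [TopologicalSpace H]
  {N : Type*} [TopologicalSpace N] [ChartedSpace H N]
  {E' H' : Type*} [NormedAddCommGroup E'] [NormedSpace ℝ E'] [TopologicalSpace H']
  {N' : Type*} [TopologicalSpace N'] [ChartedSpace H' N']
  {I : ModelWithCorners ℝ E H} {I' : ModelWithCorners ℝ E' H'}
  {G G' : Type*} [NormedAddCommGroup G] [NormedSpace ℝ G]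
  [NormedAddCommGroup G'] [NormedSpace ℝ G']

/-! ### Maps and functions in coordinates -/

namespace Coord

variable (φ : Coord I N G) (φ' : Coord I' N' G')

lemma dfn_dinv_fn {x : N} (hx : x ∈ φ.src) (v : G) : φ.dfn x (φ.dinv (φ.fn x) v) = v := by
  have h := φ.dfn_dinv (φ.map_src x hx)
  rw [φ.left_inv x hx] at h
  exact DFunLike.congr_fun h v

lemma dinv_fn_dfn {x : N} (hx : x ∈ φ.src) (v : E) : φ.dinv (φ.fn x) (φ.dfn x v) = v :=
  DFunLike.congr_fun (φ.dinv_dfn hx) v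

lemma comp_dinv_dfn {x : N} (hx : x ∈ φ.src) (a : E →L[ℝ] ℝ) :
    (a.comp (φ.dinv (φ.fn x))).comp (φ.dfn x) = a :=
  ContinuousLinearMap.ext fun v => congrArg a (φ.dinv_fn_dfn hx v)

lemma isOpen_inter_preimage {U : Set N} (hU : IsOpen U) : IsOpen (φ.tgt ∩ φ.inv ⁻¹' U) :=
  φ.smooth_inv.continuousOn.isOpen_inter_preimage φ.open_tgt hU

/-- A function which is smooth on an open set is smooth in coordinates. -/
lemma contDiffOn_comp_inv {U : Set N} {f : N → ℝ} (hf : ContMDiffOn I 𝓘(ℝ, ℝ) ∞ f U) :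
    ContDiffOn ℝ ∞ (fun y => f (φ.inv y)) (φ.tgt ∩ φ.inv ⁻¹' U) :=
  contMDiffOn_iff_contDiffOn.1 (hf.comp (φ.smooth_inv.mono inter_subset_left) fun _ hy => hy.2)

/-- The chain rule for the differential of a function, in coordinates. -/
lemma dmap_eq_fderiv_comp {f : N → ℝ} {x : N} (hx : x ∈ φ.src)
    (hf : MDifferentiableAt I 𝓘(ℝ, ℝ) f x) :
    dmap I 𝓘(ℝ, ℝ) f x = (fderiv ℝ (fun y => f (φ.inv y)) (φ.fn x)).comp (φ.dfn x) := by
  have hy := φ.map_src x hx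
  have e0 := φ.left_inv x hx
  have h1 := dmap_comp 𝓘(ℝ, G) I 𝓘(ℝ, ℝ) (g := f) (f := φ.inv) (x := φ.fn x) (by rwa [e0])
    (φ.mdiff_inv hy)
  have h2 : dmap 𝓘(ℝ, G) 𝓘(ℝ, ℝ) (fun y => f (φ.inv y)) (φ.fn x) =
      fderiv ℝ (fun y => f (φ.inv y)) (φ.fn x) := mfderiv_eq_fderiv
  rw [← h2, h1, e0]
  exact (φ.comp_dinv_dfn hx _).symm

/-- The map `f` is the affine map `y ↦ l y + c` in the coordinates `φ` and `φ'`, and the domain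
of `φ` is the whole preimage of the domain of `φ'`. -/
structure AffineIn (f : N → N') (l : G →L[ℝ] G') (c : G') : Prop where
  mem_iff : ∀ x, f x ∈ φ'.src ↔ x ∈ φ.src
  eq : ∀ x ∈ φ.src, φ'.fn (f x) = l (φ.fn x) + c

lemma eq_of_fn_eq {x x' : N} (hx : x ∈ φ.src) (hx' : x' ∈ φ.src) (e : φ.fn x = φ.fn x') :
    x = x' := by
  rw [← φ.left_inv x hx, e, φ.left_inv x' hx']

namespace AffineIn

variable {φ φ'} {f : N → N'} {l : G →L[ℝ] G'} {c : G'} (h : AffineIn φ φ' f l c)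
include h

lemma contMDiffAt {x : N} (hx : x ∈ φ.src) : ContMDiffAt I I' ∞ f x := by
  have hl : ContDiff ℝ ∞ (fun y => l y + c) := by fun_prop
  have h1 : ContMDiffOn I I' ∞ (fun z => φ'.inv (l (φ.fn z) + c)) φ.src := by
    refine φ'.smooth_inv.comp (hl.contMDiff.comp_contMDiffOn φ.smooth_fn) fun z hz => ?_
    change l (φ.fn z) + c ∈ φ'.tgt
    rw [← h.eq z hz]
    exact φ'.map_src _ ((h.mem_iff z).2 hz)
  refine (h1.congr fun z hz => ?_).contMDiffAt (φ.open_src.mem_nhds hx)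
  rw [← h.eq z hz, φ'.left_inv _ ((h.mem_iff z).2 hz)]

lemma dfn_dmap {x : N} (hx : x ∈ φ.src) :
    (φ'.dfn (f x)).comp (dmap I I' f x) = l.comp (φ.dfn x) := by
  have hl : HasMFDerivAt 𝓘(ℝ, G) 𝓘(ℝ, G') (fun y => l y + c) (φ.fn x) l :=
    (l.hasFDerivAt.add_const c).hasMFDerivAt
  have h1 := dmap_comp I 𝓘(ℝ, G) 𝓘(ℝ, G') hl.mdifferentiableAt (φ.mdiff hx)
  rw [dmap_of _ _ hl] at h1
  rw [dfn, dfn, ← dmap_comp I I' 𝓘(ℝ, G') (φ'.mdiff ((h.mem_iff x).2 hx))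
    ((h.contMDiffAt hx).mdifferentiableAt (by simp)), ← h1]
  exact dmap_congr _ _ (Filter.eventuallyEq_of_mem (φ.open_src.mem_nhds hx) h.eq)

lemma dfn_dmap_apply {x : N} (hx : x ∈ φ.src) (v : E) :
    φ'.dfn (f x) (dmap I I' f x v) = l (φ.dfn x v) :=
  DFunLike.congr_fun (h.dfn_dmap hx) v

omit h in
lemma symm {f : N ≃ N'} {l : G ≃L[ℝ] G'} (h : AffineIn φ φ' f (l : G →L[ℝ] G') 0) :
    AffineIn φ' φ f.symm (l.symm : G' →L[ℝ] G) 0 where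
  mem_iff x := by rw [← h.mem_iff, f.apply_symm_apply]
  eq x hx := by
    have e := h.eq (f.symm x) (by rwa [← h.mem_iff, f.apply_symm_apply])
    rw [f.apply_symm_apply, add_zero] at e
    rw [e, add_zero]
    exact (l.symm_apply_apply _).symm

end AffineIn

/-! ### Tensors with constant coefficients -/

/-- The field of bilinear forms `σ` has the constant coefficients `σ₀` in the coordinates `φ`. -/
def HasForm (σ : FormField I N) (σ₀ : G →L[ℝ] G →L[ℝ] ℝ) : Prop :=
  ∀ x ∈ φ.src, ∀ v w, σ x v w = σ₀ (φ.dfn x v) (φ.dfn x w)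

/-- The bivector field `Λ` has constant coefficients in the coordinates `φ`, given by the linear
map `S` from covectors to vectors: `Λ(a, b) = a(S b)`. -/
def HasBiv (Λ : BivField I N) (S : (G →L[ℝ] ℝ) →L[ℝ] G) : Prop :=
  ∀ x ∈ φ.src, ∀ a b : G →L[ℝ] ℝ, Λ x (a.comp (φ.dfn x)) (b.comp (φ.dfn x)) = a (S b)

variable {φ φ'}

lemma HasBiv.apply {Λ : BivField I N} {S : (G →L[ℝ] ℝ) →L[ℝ] G} (h : φ.HasBiv Λ S) {x : N}
    (hx : x ∈ φ.src) (a b : E →L[ℝ] ℝ) :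
    Λ x a b = a (φ.dinv (φ.fn x) (S (b.comp (φ.dinv (φ.fn x))))) := by
  have := h x hx (a.comp (φ.dinv (φ.fn x))) (b.comp (φ.dinv (φ.fn x)))
  rwa [φ.comp_dinv_dfn hx, φ.comp_dinv_dfn hx] at this

/-- The inverse of a nondegenerate form with constant coefficients `σ₀` is the inverse `S` of `σ₀`,
in coordinates. -/
lemma HasForm.dfn_inverse {σ : FormField I N} {σ₀ : G →L[ℝ] G →L[ℝ] ℝ} (h : φ.HasForm σ σ₀)
    {S : (G →L[ℝ] ℝ) →L[ℝ] G} (h1 : ∀ b, σ₀ (S b) = b) (h2 : ∀ v, S (σ₀ v) = v)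
    {x : N} (hx : x ∈ φ.src) (b : E →L[ℝ] ℝ) :
    φ.dfn x ((σ x).inverse b) = S (b.comp (φ.dinv (φ.fn x))) := by
  let e : E ≃L[ℝ] (E →L[ℝ] ℝ) := ContinuousLinearEquiv.equivOfInverse (σ x)
    ((φ.dinv (φ.fn x)).comp (S.comp (ContinuousLinearMap.precomp ℝ (φ.dinv (φ.fn x)))))
    (fun v => by
      have e1 : (σ x v).comp (φ.dinv (φ.fn x)) = σ₀ (φ.dfn x v) := by
        ext w
        change σ x v (φ.dinv (φ.fn x) w) = _
        rw [h x hx, φ.dfn_dinv_fn hx]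
      change φ.dinv (φ.fn x) (S ((σ x v).comp (φ.dinv (φ.fn x)))) = v
      rw [e1, h2, φ.dinv_fn_dfn hx])
    (fun b => by
      ext w
      change σ x (φ.dinv (φ.fn x) (S (b.comp (φ.dinv (φ.fn x))))) w = b w
      rw [h x hx, φ.dfn_dinv_fn hx, h1]
      change b (φ.dinv (φ.fn x) (φ.dfn x w)) = b w
      rw [φ.dinv_fn_dfn hx])
  have he : (σ x).inverse = (e.symm : (E →L[ℝ] ℝ) →L[ℝ] E) := by
    rw [← ContinuousLinearMap.inverse_equiv]
    rfl
  rw [he]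
  exact φ.dfn_dinv_fn hx _

/-- The bivector field of a nondegenerate form with constant coefficients has constant
coefficients. -/
lemma HasForm.hasBiv {σ : FormField I N} {σ₀ : G →L[ℝ] G →L[ℝ] ℝ} (h : φ.HasForm σ σ₀)
    {S : (G →L[ℝ] ℝ) →L[ℝ] G} (h1 : ∀ b, σ₀ (S b) = b) (h2 : ∀ v, S (σ₀ v) = v) :
    φ.HasBiv (bivOfForm σ) S := by
  intro x hx a b
  have hs : ∀ b : G →L[ℝ] ℝ, φ.dfn x ((σ x).inverse (b.comp (φ.dfn x))) = S b := fun b => by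
    rw [h.dfn_inverse h1 h2 hx]
    congr 1
    ext w
    exact congrArg b (φ.dfn_dinv_fn hx w)
  change σ x ((σ x).inverse _) ((σ x).inverse _) = _
  rw [h x hx, hs, hs, h1]

/-- Transport of constant bivectors by a map which is affine in coordinates. -/
lemma HasBiv.map_eq {Λ : BivField I N} {Λ' : BivField I' N'} {S : (G →L[ℝ] ℝ) →L[ℝ] G}
    {S' : (G' →L[ℝ] ℝ) →L[ℝ] G'} (h : φ.HasBiv Λ S) (h' : φ'.HasBiv Λ' S') {f : N → N'}
    {l : G →L[ℝ] G'} {c : G'} (hf : AffineIn φ φ' f l c) (hS : ∀ b, l (S (b.comp l)) = S' b)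
    {x : N} (hx : x ∈ φ.src) (a b : E' →L[ℝ] ℝ) :
    Λ' (f x) a b = Λ x (a.comp (dmap I I' f x)) (b.comp (dmap I I' f x)) := by
  have hx' := (hf.mem_iff x).2 hx
  have key : ∀ a : E' →L[ℝ] ℝ, a.comp (dmap I I' f x) =
      ((a.comp (φ'.dinv (φ'.fn (f x)))).comp l).comp (φ.dfn x) := fun a => by
    ext v
    change a _ = a (φ'.dinv (φ'.fn (f x)) (l (φ.dfn x v)))
    rw [← hf.dfn_dmap_apply hx, φ'.dinv_fn_dfn hx']
    rfl
  rw [key, key, h x hx, h'.apply hx']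
  change _ = a (φ'.dinv _ (l _))
  rw [hS]

/-! ### Projection and restriction of tensors -/

/-- The candidate for the projection of a bivector field along a surjective map: its value at
a point is computed at a chosen preimage. -/
def pushBiv (I : ModelWithCorners ℝ E H) (I' : ModelWithCorners ℝ E' H') {f : N → N'}
    (hf : Function.Surjective f) (Λ : BivField I N) : BivField I' N' := fun x' =>
  let x := Function.surjInv hf x'
  (Λ x).bilinearComp (ContinuousLinearMap.precomp ℝ (dmap I I' f x))
    (ContinuousLinearMap.precomp ℝ (dmap I I' f x))

lemma HasBiv.push {Λ : BivField I N} {S : (G →L[ℝ] ℝ) →L[ℝ] G}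
    {S' : (G' →L[ℝ] ℝ) →L[ℝ] G'} (h : φ.HasBiv Λ S) {f : N → N'}
    {l : G →L[ℝ] G'} {c : G'} (hf : AffineIn φ φ' f l c) (hs : Function.Surjective f)
    (hS : ∀ b, l (S (b.comp l)) = S' b) : φ'.HasBiv (pushBiv I I' hs Λ) S' := by
  intro x' hx' a b
  have key : ∀ x, f x = x' → Λ x ((a.comp (φ'.dfn x')).comp (dmap I I' f x))
      ((b.comp (φ'.dfn x')).comp (dmap I I' f x)) = a (S' b) := by
    rintro x rfl
    have hx := (hf.mem_iff x).1 hx'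
    rw [ContinuousLinearMap.comp_assoc, ContinuousLinearMap.comp_assoc, hf.dfn_dmap hx,
      ← ContinuousLinearMap.comp_assoc, ← ContinuousLinearMap.comp_assoc, h x hx,
      ContinuousLinearMap.comp_apply, hS]
  exact key _ (Function.surjInv_eq hs x')

/-- The candidate for the restriction of a bivector field along an immersion `f`, where `r x` is
a left inverse of the derivative of `f` at `x`. -/
def pullBiv (I : ModelWithCorners ℝ E H) (I' : ModelWithCorners ℝ E' H') (f : N → N')
    (r : N → E' →L[ℝ] E) (Λ : BivField I' N') : BivField I N := fun x =>
  (Λ (f x)).bilinearComp (ContinuousLinearMap.precomp ℝ (r x))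
    (ContinuousLinearMap.precomp ℝ (r x))

lemma HasBiv.pull {Λ : BivField I' N'} {S : (G →L[ℝ] ℝ) →L[ℝ] G}
    {S' : (G' →L[ℝ] ℝ) →L[ℝ] G'} (h : φ'.HasBiv Λ S') {f : N → N'}
    {l : G →L[ℝ] G'} {c : G'} (hf : AffineIn φ φ' f l c) {r : N → E' →L[ℝ] E}
    (hr : ∀ x v, r x (dmap I I' f x v) = v)
    (hS : ∀ b, l (S (b.comp l)) = S' b) : φ.HasBiv (pullBiv I I' f r Λ) S := by
  intro x hx a b
  have hx' := (hf.mem_iff x).2 hx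
  have key : ∀ v, φ.dfn x (r x (φ'.dinv (φ'.fn (f x)) (l v))) = v := fun v => by
    have e := hf.dfn_dmap_apply hx (φ.dinv (φ.fn x) v)
    rw [φ.dfn_dinv_fn hx] at e
    rw [← e, φ'.dinv_fn_dfn hx', hr, φ.dfn_dinv_fn hx]
  change Λ (f x) ((a.comp (φ.dfn x)).comp (r x)) ((b.comp (φ.dfn x)).comp (r x)) = _
  rw [h.apply hx', ← hS]
  change a (φ.dfn x (r x (φ'.dinv (φ'.fn (f x)) (l _)))) = _
  rw [key]
  congr 2
  exact ContinuousLinearMap.ext fun v => congrArg b (key v)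

/-- A map which is affine in coordinates, with an injective linear part, is an immersion. -/
lemma AffineIn.exists_leftInverse {f : N → N'} {l : G →L[ℝ] G'} {c : G'}
    (hf : AffineIn φ φ' f l c) {k : G' →L[ℝ] G} (hk : ∀ v, k (l v) = v) {x : N}
    (hx : x ∈ φ.src) : ∃ r : E' →L[ℝ] E, ∀ v, r (dmap I I' f x v) = v :=
  ⟨(φ.dinv (φ.fn x)).comp (k.comp (φ'.dfn (f x))), fun v => by
    change φ.dinv (φ.fn x) (k (φ'.dfn (f x) (dmap I I' f x v))) = v
    rw [hf.dfn_dmap_apply hx, hk, φ.dinv_fn_dfn hx]⟩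

/-- A map which is affine in coordinates, with a surjective linear part, is a submersion. -/
lemma AffineIn.exists_rightInverse {f : N → N'} {l : G →L[ℝ] G'} {c : G'}
    (hf : AffineIn φ φ' f l c) {k : G' →L[ℝ] G} (hk : ∀ v, l (k v) = v) {x : N}
    (hx : x ∈ φ.src) : ∃ s : E' →L[ℝ] E, ∀ v, dmap I I' f x (s v) = v :=
  ⟨(φ.dinv (φ.fn x)).comp (k.comp (φ'.dfn (f x))), fun v => by
    have hx' := (hf.mem_iff x).2 hx
    have e := hf.dfn_dmap_apply hx (φ.dinv (φ.fn x) (k (φ'.dfn (f x) v)))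
    rw [φ.dfn_dinv_fn hx, hk] at e
    change dmap I I' f x (φ.dinv (φ.fn x) (k (φ'.dfn (f x) v))) = v
    rw [← φ'.dinv_fn_dfn hx' (dmap I I' f x _), e, φ'.dinv_fn_dfn hx']⟩

/-- The candidate for the projection of a form along a surjective submersion `f`, where `s x` is
a right inverse of the derivative of `f` at `x`. -/
def pushForm (I : ModelWithCorners ℝ E H) (I' : ModelWithCorners ℝ E' H') {f : N → N'}
    (hf : Function.Surjective f) (s : N → E' →L[ℝ] E) (σ : FormField I N) : FormField I' N' :=
  fun x' => (σ (Function.surjInv hf x')).bilinearComp (s (Function.surjInv hf x'))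
    (s (Function.surjInv hf x'))

lemma HasForm.push {σ : FormField I N} {σ₀ : G →L[ℝ] G →L[ℝ] ℝ} {σ₀' : G' →L[ℝ] G' →L[ℝ] ℝ}
    (h : φ.HasForm σ σ₀) {f : N → N'} {l : G →L[ℝ] G'} {c : G'} (hf : AffineIn φ φ' f l c)
    (hsurj : Function.Surjective f) {s : N → E' →L[ℝ] E} (hs : ∀ x v, dmap I I' f x (s x v) = v)
    (hσ : ∀ v w, σ₀ v w = σ₀' (l v) (l w)) : φ'.HasForm (pushForm I I' hsurj s σ) σ₀' := by
  intro x' hx' v w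
  have key : ∀ x, f x = x' → σ x (s x v) (s x w) = σ₀' (φ'.dfn x' v) (φ'.dfn x' w) := by
    rintro x rfl
    have hx := (hf.mem_iff x).1 hx'
    rw [h x hx, hσ, ← hf.dfn_dmap_apply hx, ← hf.dfn_dmap_apply hx, hs, hs]
  exact key _ (Function.surjInv_eq hsurj x')

lemma HasForm.pullback {σ : FormField I' N'} {σ₀' : G' →L[ℝ] G' →L[ℝ] ℝ}
    (h : φ'.HasForm σ σ₀') {f : N → N'} {l : G →L[ℝ] G'} {c : G'} (hf : AffineIn φ φ' f l c) :
    φ.HasForm (pullbackForm I I' f σ) (σ₀'.bilinearComp l l) := by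
  intro x hx v w
  have hx' := (hf.mem_iff x).2 hx
  change σ (f x) (dmap I I' f x v) (dmap I I' f x w) = σ₀' (l (φ.dfn x v)) (l (φ.dfn x w))
  rw [h _ hx', hf.dfn_dmap_apply hx, hf.dfn_dmap_apply hx]

end Coord

end General

section Analysis

variable {G : Type*} [NormedAddCommGroup G] [NormedSpace ℝ G]

lemma two_le_infty : (2 : ℕ∞ω) ≤ ∞ := WithTop.coe_le_coe.2 (le_top (a := (2 : ℕ∞)))

/-! ### Constant bivectors are Poisson structures -/

/-- The bracket `{f, g} = df(S dg)` of a bivector with constant coefficients `S`. -/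
def constBracket (S : (G →L[ℝ] ℝ) →L[ℝ] G) (f g : G → ℝ) (y : G) : ℝ :=
  fderiv ℝ f y (S (fderiv ℝ g y))

lemma contDiffOn_constBracket (S : (G →L[ℝ] ℝ) →L[ℝ] G) {f g : G → ℝ} {V : Set G}
    (hV : IsOpen V) (hf : ContDiffOn ℝ ∞ f V) (hg : ContDiffOn ℝ ∞ g V) :
    ContDiffOn ℝ ∞ (constBracket S f g) V :=
  (hf.fderiv_of_isOpen hV (by simp)).clm_apply
    (S.contDiff.comp_contDiffOn (hg.fderiv_of_isOpen hV (by simp)))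

lemma apply_sharp_comm {S : (G →L[ℝ] ℝ) →L[ℝ] G} (hS : ∀ a : G →L[ℝ] ℝ, a (S a) = 0) (a b : G →L[ℝ] ℝ) :
    a (S b) = -b (S a) := by
  have h := hS (a + b)
  rw [map_add, add_apply, map_add, map_add, hS, hS] at h
  linarith

/-- The bracket `{f, {g, h}}` is a difference of values of the Hessians of `h` and `g`; by the symmetry
of Hessians, the cyclic sum cancels. -/
lemma constBracket_constBracket {S : (G →L[ℝ] ℝ) →L[ℝ] G} (hS : ∀ a : G →L[ℝ] ℝ, a (S a) = 0)
    (f : G → ℝ) {g h : G → ℝ} {y : G} (hg : ContDiffAt ℝ ∞ g y) (hh : ContDiffAt ℝ ∞ h y) :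
    constBracket S f (constBracket S g h) y =
      fderiv ℝ (fderiv ℝ h) y (S (fderiv ℝ f y)) (S (fderiv ℝ g y)) -
        fderiv ℝ (fderiv ℝ g) y (S (fderiv ℝ f y)) (S (fderiv ℝ h y)) := by
  have dg := ((hg.fderiv_right (m := ∞) (by simp)).differentiableAt (by simp)).hasFDerivAt
  have dh := ((hh.fderiv_right (m := ∞) (by simp)).differentiableAt (by simp)).hasFDerivAt
  have d : fderiv ℝ (constBracket S g h) y = _ :=
    (dg.clm_apply (S.hasFDerivAt.comp y dh)).fderiv
  rw [constBracket, apply_sharp_comm hS, d]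
  simp only [add_apply, ContinuousLinearMap.comp_apply,
    ContinuousLinearMap.flip_apply, Function.comp]
  rw [apply_sharp_comm hS (fderiv ℝ g y)]
  ring

lemma constBracket_jacobi {S : (G →L[ℝ] ℝ) →L[ℝ] G} (hS : ∀ a : G →L[ℝ] ℝ, a (S a) = 0)
    {f g h : G → ℝ} {y : G} (hf : ContDiffAt ℝ ∞ f y) (hg : ContDiffAt ℝ ∞ g y)
    (hh : ContDiffAt ℝ ∞ h y) :
    constBracket S f (constBracket S g h) y + constBracket S g (constBracket S h f) y +
      constBracket S h (constBracket S f g) y = 0 := by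
  have sf := hf.isSymmSndFDerivAt (by simpa using two_le_infty)
  have sg := hg.isSymmSndFDerivAt (by simpa using two_le_infty)
  have sh := hh.isSymmSndFDerivAt (by simpa using two_le_infty)
  rw [constBracket_constBracket hS f hg hh, constBracket_constBracket hS g hh hf,
    constBracket_constBracket hS h hf hg, sf.eq (S (fderiv ℝ g y)), sg.eq (S (fderiv ℝ h y)),
    sh.eq (S (fderiv ℝ f y))]
  ring

end Analysis

section General

variable {E H : Type*} [NormedAddCommGroup E] [NormedSpace ℝ E] [TopologicalSpace H]
  {N : Type*} [TopologicalSpace N] [ChartedSpace H N]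
  {I : ModelWithCorners ℝ E H}
  {G : Type*} [NormedAddCommGroup G] [NormedSpace ℝ G] {φ : Coord I N G}

lemma Coord.HasBiv.bracket_eq {Λ : BivField I N} {S : (G →L[ℝ] ℝ) →L[ℝ] G} (h : φ.HasBiv Λ S)
    {f g : N → ℝ} {x : N} (hx : x ∈ φ.src) (hf : MDifferentiableAt I 𝓘(ℝ, ℝ) f x)
    (hg : MDifferentiableAt I 𝓘(ℝ, ℝ) g x) :
    bracket I Λ f g x =
      constBracket S (fun y => f (φ.inv y)) (fun y => g (φ.inv y)) (φ.fn x) := by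
  rw [bracket, φ.dmap_eq_fderiv_comp hx hf, φ.dmap_eq_fderiv_comp hx hg, h x hx]
  rfl

/-- The bracket in coordinates, on the domain of the coordinates. -/
lemma Coord.HasBiv.bracket_inv {Λ : BivField I N} {S : (G →L[ℝ] ℝ) →L[ℝ] G} (h : φ.HasBiv Λ S)
    {U : Set N} (hU : IsOpen U) {f g : N → ℝ} (hf : ContMDiffOn I 𝓘(ℝ, ℝ) ∞ f U)
    (hg : ContMDiffOn I 𝓘(ℝ, ℝ) ∞ g U) {y : G} (hy : y ∈ φ.tgt ∩ φ.inv ⁻¹' U) :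
    bracket I Λ f g (φ.inv y) =
      constBracket S (fun y => f (φ.inv y)) (fun y => g (φ.inv y)) y := by
  have hd : ∀ {f : N → ℝ}, ContMDiffOn I 𝓘(ℝ, ℝ) ∞ f U →
      MDifferentiableAt I 𝓘(ℝ, ℝ) f (φ.inv y) := fun hf =>
    (hf.contMDiffAt (hU.mem_nhds hy.2)).mdifferentiableAt (by simp)
  rw [h.bracket_eq (φ.map_tgt y hy.1) (hd hf) (hd hg), φ.right_inv y hy.1]

lemma Coord.HasBiv.contMDiffOn_bracket {Λ : BivField I N} {S : (G →L[ℝ] ℝ) →L[ℝ] G}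
    (h : φ.HasBiv Λ S) {U : Set N} (hU : IsOpen U) {f g : N → ℝ}
    (hf : ContMDiffOn I 𝓘(ℝ, ℝ) ∞ f U) (hg : ContMDiffOn I 𝓘(ℝ, ℝ) ∞ g U) :
    ContMDiffOn I 𝓘(ℝ, ℝ) ∞ (bracket I Λ f g) (φ.src ∩ U) := by
  have h1 := contDiffOn_constBracket S (φ.isOpen_inter_preimage hU) (φ.contDiffOn_comp_inv hf)
    (φ.contDiffOn_comp_inv hg)
  have hm : ∀ x ∈ φ.src ∩ U, φ.fn x ∈ φ.tgt ∩ φ.inv ⁻¹' U := fun x hx =>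
    ⟨φ.map_src x hx.1, by rw [mem_preimage, φ.left_inv x hx.1]; exact hx.2⟩
  refine (h1.contMDiffOn.comp (φ.smooth_fn.mono inter_subset_left) hm).congr fun x hx => ?_
  rw [← φ.left_inv x hx.1, h.bracket_inv hU hf hg (hm x hx), φ.left_inv x hx.1]
  rfl

/-- A bivector field which has constant coefficients in coordinates around each point is
a Poisson structure. -/
theorem isPoisson_of_hasBiv {Λ : BivField I N} {S : (G →L[ℝ] ℝ) →L[ℝ] G}
    (hS : ∀ a : G →L[ℝ] ℝ, a (S a) = 0) (h : ∀ x, ∃ φ : Coord I N G, x ∈ φ.src ∧ φ.HasBiv Λ S) :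
    IsPoisson I Λ where
  alternating x a := by
    obtain ⟨φ, hx, h⟩ := h x
    rw [h.apply hx]
    exact hS (a.comp (φ.dinv (φ.fn x)))
  smooth U hU f g hf hg x hx := by
    obtain ⟨φ, hx', h⟩ := h x
    exact ((h.contMDiffOn_bracket hU hf hg).contMDiffAt
      ((φ.open_src.inter hU).mem_nhds ⟨hx', hx⟩)).contMDiffWithinAt
  jacobi U hU f g k hf hg hk x hx := by
    obtain ⟨φ, hx', h⟩ := h x
    have hV := φ.isOpen_inter_preimage hU
    have hm : φ.fn x ∈ φ.tgt ∩ φ.inv ⁻¹' U :=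
      ⟨φ.map_src x hx', by rw [mem_preimage, φ.left_inv x hx']; exact hx⟩
    have hn := hV.mem_nhds hm
    have hW := φ.open_src.inter hU
    have key : ∀ {f g k : N → ℝ}, ContMDiffOn I 𝓘(ℝ, ℝ) ∞ f U → ContMDiffOn I 𝓘(ℝ, ℝ) ∞ g U →
        ContMDiffOn I 𝓘(ℝ, ℝ) ∞ k U → bracket I Λ f (bracket I Λ g k) x =
          constBracket S (fun y => f (φ.inv y)) (constBracket S (fun y => g (φ.inv y))
            (fun y => k (φ.inv y))) (φ.fn x) := by
      intro f g k hf hg hk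
      have h1 := (h.contMDiffOn_bracket hU hg hk).contMDiffAt (hW.mem_nhds ⟨hx', hx⟩)
      have h2 := hf.contMDiffAt (hU.mem_nhds hx)
      rw [h.bracket_eq hx' (h2.mdifferentiableAt (by simp)) (h1.mdifferentiableAt (by simp))]
      unfold constBracket
      congr 2
      exact Filter.EventuallyEq.fderiv_eq
        (Filter.eventuallyEq_of_mem hn fun y hy => h.bracket_inv hU hg hk hy)
    have hc : ∀ {f : N → ℝ}, ContMDiffOn I 𝓘(ℝ, ℝ) ∞ f U →
        ContDiffAt ℝ ∞ (fun y => f (φ.inv y)) (φ.fn x) := fun hf =>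
      (φ.contDiffOn_comp_inv hf).contDiffAt hn
    rw [key hf hg hk, key hg hk hf, key hk hf hg]
    exact constBracket_jacobi hS (hc hf) (hc hg) (hc hk)

/-! ### Changes of coordinates -/

/-- The change of coordinates `φ ∘ ψ⁻¹` near a point in both domains: it is smooth, it is defined
on a neighbourhood, and its derivative is the composition of those of `φ` and of `ψ⁻¹`. -/
lemma Coord.exists_transition {G' : Type*} [NormedAddCommGroup G'] [NormedSpace ℝ G']
    (φ : Coord I N G) (ψ : Coord I N G') {x : N} (hφ : x ∈ φ.src) (hψ : x ∈ ψ.src) :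
    ContDiffAt ℝ ∞ (fun y => φ.fn (ψ.inv y)) (ψ.fn x) ∧
      (∀ᶠ y in 𝓝 (ψ.fn x), y ∈ ψ.tgt ∧ ψ.inv y ∈ φ.src) ∧
      ∀ y ∈ ψ.tgt, ψ.inv y ∈ φ.src →
        fderiv ℝ (fun y => φ.fn (ψ.inv y)) y = (φ.dfn (ψ.inv y)).comp (ψ.dinv y) := by
  have hV := ψ.isOpen_inter_preimage φ.open_src
  have hm : ψ.fn x ∈ ψ.tgt ∩ ψ.inv ⁻¹' φ.src :=
    ⟨ψ.map_src x hψ, by rw [mem_preimage, ψ.left_inv x hψ]; exact hφ⟩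
  have h1 : ContMDiffOn 𝓘(ℝ, G') 𝓘(ℝ, G) ∞ (fun y => φ.fn (ψ.inv y))
      (ψ.tgt ∩ ψ.inv ⁻¹' φ.src) :=
    φ.smooth_fn.comp (ψ.smooth_inv.mono inter_subset_left) fun _ hy => hy.2
  refine ⟨h1.contDiffOn.contDiffAt (hV.mem_nhds hm), hV.mem_nhds hm, fun y hy hy' => ?_⟩
  have h2 := dmap_comp 𝓘(ℝ, G') I 𝓘(ℝ, G) (φ.mdiff hy') (ψ.mdiff_inv hy)
  exact mfderiv_eq_fderiv.symm.trans h2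

variable [IsManifold I ∞ N] [I.Boundaryless]

/-- The exterior derivative of a `1`-form may be computed in any coordinates. -/
theorem extDerivOne_eq (φ : Coord I N G) (θ : N → E →L[ℝ] ℝ) {x : N} (hx : x ∈ φ.src)
    {A : G →L[ℝ] G →L[ℝ] ℝ}
    (hA : HasFDerivAt (fun y => (θ (φ.inv y)).comp (φ.dinv y)) A (φ.fn x)) (v w : E) :
    extDerivOne I θ x v w =
      A (φ.dfn x v) (φ.dfn x w) - A (φ.dfn x w) (φ.dfn x v) := by
  set ψ : Coord I N E := Coord.ext I x
  have hψ : x ∈ ψ.src := mem_extChartAt_source x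
  obtain ⟨h1, h2, h3⟩ := φ.exists_transition ψ hx hψ
  set τ : E → G := fun y => φ.fn (ψ.inv y) with hτ
  have hy := ψ.map_src x hψ
  have e0 := ψ.left_inv x hψ
  have eτ : τ (ψ.fn x) = φ.fn x := congrArg φ.fn e0
  have ev : (fun y => (θ (ψ.inv y)).comp (ψ.dinv y)) =ᶠ[𝓝 (ψ.fn x)]
      fun y => ((θ (φ.inv (τ y))).comp (φ.dinv (τ y))).comp (fderiv ℝ τ y) := by
    filter_upwards [h2] with y hy
    rw [h3 y hy.1 hy.2, hτ]
    ext u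
    change θ (ψ.inv y) _ = θ (φ.inv (φ.fn (ψ.inv y))) (φ.dinv (φ.fn (ψ.inv y)) (φ.dfn (ψ.inv y) _))
    rw [φ.dinv_fn_dfn hy.2, φ.left_inv _ hy.2]
  have d1 : HasFDerivAt (fun y => (θ (φ.inv (τ y))).comp (φ.dinv (τ y)))
      (A.comp (fderiv ℝ τ (ψ.fn x))) (ψ.fn x) := by
    refine HasFDerivAt.comp (g := fun y => (θ (φ.inv y)).comp (φ.dinv y)) (f := τ) (ψ.fn x) ?_
      (h1.differentiableAt (by simp)).hasFDerivAt
    rw [eτ]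
    exact hA
  have d2 := ((h1.fderiv_right (m := ∞) (by simp)).differentiableAt (by simp)).hasFDerivAt
  have d3 := (d1.clm_comp d2).congr_of_eventuallyEq ev
  have hsymm := h1.isSymmSndFDerivAt (by simpa using two_le_infty)
  have key : ∀ u, fderiv ℝ τ (ψ.fn x) (ψ.dfn x u) = φ.dfn x u := fun u => by
    rw [h3 _ hy (by rw [e0]; exact hx), e0]
    change φ.dfn x (ψ.dinv _ (ψ.dfn x u)) = _
    rw [ψ.dinv_fn_dfn hψ]
  have hd : extDerivOne I θ x v w =
      fderiv ℝ (fun y => (θ (ψ.inv y)).comp (ψ.dinv y)) (ψ.fn x) (ψ.dfn x v) (ψ.dfn x w) -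
      fderiv ℝ (fun y => (θ (ψ.inv y)).comp (ψ.dinv y)) (ψ.fn x) (ψ.dfn x w) (ψ.dfn x v) := rfl
  rw [hd, d3.fderiv]
  simp only [add_apply, ContinuousLinearMap.comp_apply,
    ContinuousLinearMap.compL_apply, ContinuousLinearMap.flip_apply, key,
    hsymm.eq (ψ.dfn x v) (ψ.dfn x w)]
  ring

end General

section LinearAlgebra

variable (G : Type*) [NormedAddCommGroup G] [NormedSpace ℝ G] [FiniteDimensional ℝ G]

/-! ### The canonical symplectic form of a cotangent bundle -/

/-- A finite-dimensional space is canonically isomorphic to its bidual. -/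
def bidual : G ≃L[ℝ] ((G →L[ℝ] ℝ) →L[ℝ] ℝ) :=
  (LinearEquiv.ofBijective (ContinuousLinearMap.apply ℝ ℝ : G →L[ℝ] (G →L[ℝ] ℝ) →L[ℝ] ℝ).toLinearMap
    (by
      have hi : Function.Injective
          (ContinuousLinearMap.apply ℝ ℝ : G →L[ℝ] (G →L[ℝ] ℝ) →L[ℝ] ℝ).toLinearMap := by
        refine (injective_iff_map_eq_zero _).2 fun v hv => ?_
        by_contra h
        obtain ⟨f, hf⟩ := SeparatingDual.exists_ne_zero (R := ℝ) h
        exact hf (DFunLike.congr_fun hv f)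
      have hd : ∀ (V : Type _) [NormedAddCommGroup V] [NormedSpace ℝ V] [FiniteDimensional ℝ V],
          Module.finrank ℝ (V →L[ℝ] ℝ) = Module.finrank ℝ V := fun V _ _ _ =>
        (LinearMap.toContinuousLinearMap (𝕜 := ℝ) (E := V) (F' := ℝ)).symm.finrank_eq.trans
          Subspace.dual_finrank_eq
      exact ⟨hi, (LinearMap.injective_iff_surjective_of_finrank_eq_finrank
        (by rw [hd, hd])).1 hi⟩)).toContinuousLinearEquiv

variable {G}

@[simp] lemma bidual_apply (v : G) (a : G →L[ℝ] ℝ) : bidual G v a = a v := rfl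

@[simp] lemma apply_bidual_symm (b : (G →L[ℝ] ℝ) →L[ℝ] ℝ) (a : G →L[ℝ] ℝ) :
    a ((bidual G).symm b) = b a := by
  rw [← bidual_apply, ContinuousLinearEquiv.apply_symm_apply]

variable (G)

/-- The Liouville form of `T*G`, `(y, p) ↦ p dy`, as a linear map from points to covectors. -/
def liouvilleLin : (G × (G →L[ℝ] ℝ)) →L[ℝ] (G × (G →L[ℝ] ℝ)) →L[ℝ] ℝ :=
  (ContinuousLinearMap.precomp ℝ (ContinuousLinearMap.fst ℝ G (G →L[ℝ] ℝ))).comp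
    (ContinuousLinearMap.snd ℝ G (G →L[ℝ] ℝ))

/-- The canonical symplectic form `dy ∧ dp` of `T*G`. -/
def cotForm : (G × (G →L[ℝ] ℝ)) →L[ℝ] (G × (G →L[ℝ] ℝ)) →L[ℝ] ℝ :=
  (liouvilleLin G).flip - liouvilleLin G

/-- The inverse of `cotForm`. -/
def cotSharp : ((G × (G →L[ℝ] ℝ)) →L[ℝ] ℝ) →L[ℝ] G × (G →L[ℝ] ℝ) :=
  ((bidual G).symm.toContinuousLinearMap.comp
      (ContinuousLinearMap.precomp ℝ (ContinuousLinearMap.inr ℝ G (G →L[ℝ] ℝ)))).prod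
    (-ContinuousLinearMap.precomp ℝ (ContinuousLinearMap.inl ℝ G (G →L[ℝ] ℝ)))

variable {G}

omit [FiniteDimensional ℝ G] in
@[simp] lemma cotForm_apply (v w : G × (G →L[ℝ] ℝ)) : cotForm G v w = w.2 v.1 - v.2 w.1 := rfl

@[simp] lemma cotSharp_apply (b : (G × (G →L[ℝ] ℝ)) →L[ℝ] ℝ) : cotSharp G b =
    ((bidual G).symm (b.comp (ContinuousLinearMap.inr ℝ G (G →L[ℝ] ℝ))),
      -b.comp (ContinuousLinearMap.inl ℝ G (G →L[ℝ] ℝ))) := rfl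

lemma cotForm_cotSharp (b : (G × (G →L[ℝ] ℝ)) →L[ℝ] ℝ) : cotForm G (cotSharp G b) = b := by
  refine ContinuousLinearMap.ext fun w => ?_
  have e : w = (w.1, 0) + (0, w.2) := by simp
  conv_rhs => rw [e, map_add]
  simp [add_comm]

omit [FiniteDimensional ℝ G] in
lemma cotForm_injective : Function.Injective (cotForm G) := by
  refine (injective_iff_map_eq_zero _).2 fun v hv => ?_
  refine Prod.ext ?_ (ContinuousLinearMap.ext fun y => ?_)
  · by_contra h
    obtain ⟨f, hf⟩ := SeparatingDual.exists_ne_zero (R := ℝ) h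
    have := DFunLike.congr_fun hv (0, f)
    simp at this
    exact hf this
  · have := DFunLike.congr_fun hv (y, 0)
    simpa using this

lemma cotSharp_cotForm (v : G × (G →L[ℝ] ℝ)) : cotSharp G (cotForm G v) = v :=
  cotForm_injective (cotForm_cotSharp _)

omit [FiniteDimensional ℝ G] in
/-- The coefficients of the complete lift of a bivector with constant coefficients `S`. -/
def tanSharp (S : (G →L[ℝ] ℝ) →L[ℝ] G) : ((G × G) →L[ℝ] ℝ) →L[ℝ] G × G :=
  (S.comp (ContinuousLinearMap.precomp ℝ (ContinuousLinearMap.inr ℝ G G))).prod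
    (S.comp (ContinuousLinearMap.precomp ℝ (ContinuousLinearMap.inl ℝ G G)))

omit [FiniteDimensional ℝ G] in
@[simp] lemma tanSharp_apply (S : (G →L[ℝ] ℝ) →L[ℝ] G) (b : (G × G) →L[ℝ] ℝ) :
    tanSharp S b = (S (b.comp (ContinuousLinearMap.inr ℝ G G)),
      S (b.comp (ContinuousLinearMap.inl ℝ G G))) := rfl

end LinearAlgebra

section General

variable {E H : Type*} [NormedAddCommGroup E] [NormedSpace ℝ E] [TopologicalSpace H]
  {N : Type*} [TopologicalSpace N] [ChartedSpace H N]
  {I : ModelWithCorners ℝ E H} [IsManifold I ∞ N] [I.Boundaryless]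
  {G : Type*} [NormedAddCommGroup G] [NormedSpace ℝ G]

omit [I.Boundaryless] in
lemma Coord.liouville_cot (φ : Coord I N G) {z : G × (G →L[ℝ] ℝ)} (hz : z ∈ φ.cot.tgt) :
    (liouville I (φ.cot.inv z)).comp (φ.cot.dinv z) = liouvilleLin G z := by
  have h1 : MDifferentiableAt (cotModel I) I (fun β : CotBundle I N => β.1) (φ.cot.inv z) :=
    (Bundle.contMDiffAt_proj (n := 1) _).mdifferentiableAt (by simp)
  have h2 := dmap_comp 𝓘(ℝ, G × (G →L[ℝ] ℝ)) (cotModel I) I h1 (φ.cot.mdiff_inv hz)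
  have h3 : HasMFDerivAt 𝓘(ℝ, G × (G →L[ℝ] ℝ)) 𝓘(ℝ, G) (Prod.fst : G × (G →L[ℝ] ℝ) → G) z
      (ContinuousLinearMap.fst ℝ G (G →L[ℝ] ℝ)) :=
    (ContinuousLinearMap.fst ℝ G (G →L[ℝ] ℝ)).hasFDerivAt.hasMFDerivAt
  have h4 := dmap_comp 𝓘(ℝ, G × (G →L[ℝ] ℝ)) 𝓘(ℝ, G) I (φ.mdiff_inv hz.1) h3.mdifferentiableAt
  rw [dmap_of _ _ h3] at h4
  have h5 := h2.symm.trans h4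
  refine ContinuousLinearMap.ext fun w => ?_
  have h6 := DFunLike.congr_fun h5 w
  change z.2 (φ.dfn (φ.inv z.1) (dmap (cotModel I) I (fun β : CotBundle I N => β.1) (φ.cot.inv z)
    (φ.cot.dinv z w))) = z.2 w.1
  refine congrArg z.2 ((congrArg (φ.dfn (φ.inv z.1)) h6).trans ?_)
  exact DFunLike.congr_fun (φ.dfn_dinv hz.1) w.1

/-- The canonical symplectic form of `T*N` is `dy ∧ dp` in the coordinates induced by any
coordinates of `N`. -/
theorem Coord.hasForm_canonicalForm (φ : Coord I N G) :
    φ.cot.HasForm (canonicalForm I (N := N)) (cotForm G) := by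
  intro α hα v w
  have hA : HasFDerivAt (fun z => (liouville I (φ.cot.inv z)).comp (φ.cot.dinv z))
      (liouvilleLin G) (φ.cot.fn α) := by
    refine (liouvilleLin G).hasFDerivAt.congr_of_eventuallyEq ?_
    exact Filter.eventuallyEq_of_mem (φ.cot.open_tgt.mem_nhds (φ.cot.map_src α hα))
      fun z hz => φ.liouville_cot hz
  have h := extDerivOne_eq φ.cot (liouville I) hα hA v w
  change -(extDerivOne (cotModel I) (liouville I) α v w) = _
  rw [h, neg_sub]
  rfl

/-- A nondegenerate form with constant coefficients in the preferred chart at each point is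
symplectic. -/
theorem isSymplectic_of_hasForm {σ : FormField I N} {σ₀ : E →L[ℝ] E →L[ℝ] ℝ}
    (h0 : ∀ v, σ₀ v v = 0) (h1 : Function.Injective σ₀)
    (h : ∀ x, (Coord.ext I x).HasForm σ σ₀) : IsSymplectic I σ := by
  have hl : ∀ x, ∀ y ∈ (Coord.ext I x).tgt, FormField.loc (Coord.ext I x) σ y = σ₀ := by
    intro x y hy
    refine ContinuousLinearMap.ext fun v => ContinuousLinearMap.ext fun w => ?_
    change σ _ _ _ = _
    rw [h x _ ((Coord.ext I x).map_tgt y hy)]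
    have e := (Coord.ext I x).dfn_dinv hy
    exact congrArg₂ (fun v w => σ₀ v w) (DFunLike.congr_fun e v) (DFunLike.congr_fun e w)
  have hx : ∀ x : N, x ∈ (Coord.ext I x).src := fun x => mem_extChartAt_source x
  refine ⟨fun x v => ?_, fun x => ?_, fun x u v w => ?_, fun x v hv => ?_⟩
  · rw [h x x (hx x), h0]
  · exact contDiffOn_const.congr (hl x)
  · have e : fderiv ℝ (FormField.loc (Coord.ext I x) σ) ((Coord.ext I x).fn x) = 0 := by
      rw [Filter.EventuallyEq.fderiv_eq (Filter.eventuallyEq_of_mem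
        ((Coord.ext I x).open_tgt.mem_nhds ((Coord.ext I x).map_src x (hx x))) (hl x))]
      simp
    simp [e]
  · have e : (Coord.ext I x).dfn x v = 0 := by
      refine (injective_iff_map_eq_zero _).1 h1 _ (ContinuousLinearMap.ext fun w => ?_)
      have := h x x (hx x) v ((Coord.ext I x).dinv ((Coord.ext I x).fn x) w)
      rw [hv, (Coord.ext I x).dfn_dinv_fn (hx x)] at this
      exact this.symm
    rw [← (Coord.ext I x).dinv_fn_dfn (hx x) v, e, map_zero]

/-! ### Complete lifts -/

/-- The complete lift of a bivector field with constant coefficients has constant coefficients in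
the induced coordinates of the tangent bundle. The complete lift is defined through the preferred
chart `ψ`; the change of coordinates `τ = φ ∘ ψ⁻¹` maps one constant bivector to another one, and
the derivative of this relation cancels the second derivatives of `τ`. -/
theorem Coord.HasBiv.completeLift {Λ : BivField I N} {φ : Coord I N G}
    {S : (G →L[ℝ] ℝ) →L[ℝ] G} (h : φ.HasBiv Λ S) {S' : (E →L[ℝ] ℝ) →L[ℝ] E}
    (h' : ∀ x, (Coord.ext I x).HasBiv Λ S') :
    φ.tan.HasBiv (completeLift I Λ) (tanSharp S) := by
  intro w hw a b
  have hx : w.1 ∈ φ.src := hw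
  set ψ : Coord I N E := Coord.ext I w.1
  have hψ : w.1 ∈ ψ.src := mem_extChartAt_source w.1
  obtain ⟨h1, h2, h3⟩ := φ.exists_transition ψ hx hψ
  obtain ⟨-, -, k3⟩ := φ.tan.exists_transition ψ.tan (x := w) hw hψ
  set τ : E → G := fun y => φ.fn (ψ.inv y)
  set y : E := ψ.fn w.1
  set u : E := ψ.dfn w.1 w.2
  set T : E →L[ℝ] G := fderiv ℝ τ y
  set T' : E →L[ℝ] E →L[ℝ] G := fderiv ℝ (fderiv ℝ τ) y with hT'
  have hy : y ∈ ψ.tgt := ψ.map_src _ hψ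
  have d1 : HasFDerivAt τ T y := (h1.differentiableAt (by simp)).hasFDerivAt
  have d2 : HasFDerivAt (fderiv ℝ τ) T' y :=
    ((h1.fderiv_right (m := ∞) (by simp)).differentiableAt (by simp)).hasFDerivAt
  have hsymm := h1.isSymmSndFDerivAt (by simpa using two_le_infty)
  -- the change of coordinates relates the two constant bivectors
  have rel : ∀ c : G →L[ℝ] ℝ, ∀ᶠ z in 𝓝 y,
      fderiv ℝ τ z (S' (c.comp (fderiv ℝ τ z))) = S c := by
    intro c
    filter_upwards [h2] with z hz
    refine (SeparatingDual.eq_iff_forall_dual_eq (R := ℝ)).2 fun d => ?_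
    have e1 := h _ hz.2 d c
    rw [(h' w.1).apply (ψ.map_tgt z hz.1), ψ.right_inv z hz.1] at e1
    rw [← e1, h3 z hz.1 hz.2]
    rfl
  have rel0 : ∀ c : G →L[ℝ] ℝ, T (S' (c.comp T)) = S c := fun c => (rel c).self_of_nhds
  have rel1 : ∀ c : G →L[ℝ] ℝ,
      T' u (S' (c.comp T)) + T (S' (c.comp (T' u))) = 0 := by
    intro c
    have e1 := d2.clm_apply (S'.hasFDerivAt.comp y
      ((ContinuousLinearMap.compL ℝ E G ℝ c).hasFDerivAt.comp y d2))
    have e2 := e1.unique ((hasFDerivAt_const (S c) y).congr_of_eventuallyEq (rel c))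
    have e3 := DFunLike.congr_fun e2 u
    simp only [add_apply, ContinuousLinearMap.comp_apply, ContinuousLinearMap.flip_apply,
      ContinuousLinearMap.compL_apply, Function.comp, zero_apply] at e3
    rw [add_comm]
    exact e3
  -- the derivative of the change of coordinates of the tangent bundle
  have dT : (φ.tan.dfn w).comp (ψ.tan.dinv (y, u)) =
      (T.comp (ContinuousLinearMap.fst ℝ E E)).prod
        (T.comp (ContinuousLinearMap.snd ℝ E E) + (T'.flip u).comp
          (ContinuousLinearMap.fst ℝ E E)) := by
    have e0 : ψ.tan.inv (y, u) = w := ψ.tan.left_inv w hψ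
    have e1 := k3 (y, u) ⟨hy, mem_univ _⟩ (by rw [e0]; exact hw)
    rw [e0] at e1
    rw [← e1]
    have d3 : HasFDerivAt (fun z : E × E => (τ z.1, fderiv ℝ τ z.1 z.2)) _ (y, u) :=
      (HasFDerivAt.comp (y, u) (g := τ) (f := Prod.fst) d1 hasFDerivAt_fst).prodMk
        ((HasFDerivAt.comp (y, u) (g := fderiv ℝ τ) (f := Prod.fst) d2 hasFDerivAt_fst).clm_apply
          hasFDerivAt_snd)
    have ev : (fun z => φ.tan.fn (ψ.tan.inv z)) =ᶠ[𝓝 (y, u)]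
        fun z : E × E => (τ z.1, fderiv ℝ τ z.1 z.2) := by
      have hc : Filter.Tendsto (Prod.fst : E × E → E) (𝓝 (y, u)) (𝓝 y) := continuous_fst.tendsto _
      filter_upwards [hc.eventually h2] with z hz
      rw [h3 z.1 hz.1 hz.2]
      rfl
    rw [ev.fderiv_eq, d3.fderiv]
    rfl
  have hL : ∀ z ∈ ψ.tgt, ∀ c d, BivField.loc ψ Λ z c d = c (S' d) := fun z hz c d =>
    h' w.1 _ (ψ.map_tgt z hz) c d
  have hL' : fderiv ℝ (BivField.loc ψ Λ) y = 0 := by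
    have ev : BivField.loc ψ Λ =ᶠ[𝓝 y] fun _ => BivField.loc ψ Λ y :=
      Filter.eventuallyEq_of_mem (ψ.open_tgt.mem_nhds hy) fun z hz =>
        ContinuousLinearMap.ext fun c => ContinuousLinearMap.ext fun d => by
          rw [hL z hz, hL y hy]
    rw [ev.fderiv_eq]
    simp
  have hlift : ∀ A B : (E × E) →L[ℝ] ℝ, Tulczyjew.completeLift I Λ w A B =
      (A.comp ((ψ.tan.dinv (y, u)).comp (ContinuousLinearMap.inl ℝ E E)))
          (S' (B.comp ((ψ.tan.dinv (y, u)).comp (ContinuousLinearMap.inr ℝ E E)))) +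
        (A.comp ((ψ.tan.dinv (y, u)).comp (ContinuousLinearMap.inr ℝ E E)))
          (S' (B.comp ((ψ.tan.dinv (y, u)).comp (ContinuousLinearMap.inl ℝ E E)))) := by
    intro A B
    have e : Tulczyjew.completeLift I Λ w A B =
        BivField.loc ψ Λ y (A.comp ((ψ.tan.dinv (y, u)).comp (ContinuousLinearMap.inl ℝ E E)))
            (B.comp ((ψ.tan.dinv (y, u)).comp (ContinuousLinearMap.inr ℝ E E))) +
          BivField.loc ψ Λ y (A.comp ((ψ.tan.dinv (y, u)).comp (ContinuousLinearMap.inr ℝ E E)))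
            (B.comp ((ψ.tan.dinv (y, u)).comp (ContinuousLinearMap.inl ℝ E E))) +
          fderiv ℝ (BivField.loc ψ Λ) y u
            (A.comp ((ψ.tan.dinv (y, u)).comp (ContinuousLinearMap.inr ℝ E E)))
            (B.comp ((ψ.tan.dinv (y, u)).comp (ContinuousLinearMap.inr ℝ E E))) := rfl
    rw [e, hL', hL y hy, hL y hy]
    simp only [zero_apply, add_zero]
  have pinl : ∀ A : (G × G) →L[ℝ] ℝ, (A.comp (φ.tan.dfn w)).comp
      ((ψ.tan.dinv (y, u)).comp (ContinuousLinearMap.inl ℝ E E)) =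
      (A.comp (ContinuousLinearMap.inl ℝ G G)).comp T +
        (A.comp (ContinuousLinearMap.inr ℝ G G)).comp (T' u) := by
    intro A
    ext v
    have e1 := congrArg A (DFunLike.congr_fun dT (v, 0))
    have e2 : A (T v, T 0 + T' v u) = A (T v, 0) + A (0, T' u v) := by
      rw [← map_add, map_zero, hsymm.eq v u]
      simp [hT']
    exact e1.trans e2
  have pinr : ∀ A : (G × G) →L[ℝ] ℝ, (A.comp (φ.tan.dfn w)).comp
      ((ψ.tan.dinv (y, u)).comp (ContinuousLinearMap.inr ℝ E E)) =
      (A.comp (ContinuousLinearMap.inr ℝ G G)).comp T := by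
    intro A
    ext v
    have e1 := congrArg A (DFunLike.congr_fun dT (0, v))
    have e2 : A (T 0, T v + T' 0 u) = A (0, T v) := by simp
    exact e1.trans e2
  rw [hlift, pinl, pinr, pinl, pinr]
  have r1 := rel1 (b.comp (ContinuousLinearMap.inr ℝ G G))
  have r2 := rel0 (b.comp (ContinuousLinearMap.inr ℝ G G))
  have r3 := rel0 (b.comp (ContinuousLinearMap.inl ℝ G G))
  have r4 := congrArg (fun v => a (ContinuousLinearMap.inr ℝ G G v)) r1
  have e3 : a (tanSharp S b) = a (S (b.comp (ContinuousLinearMap.inr ℝ G G)), 0) +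
      a (0, S (b.comp (ContinuousLinearMap.inl ℝ G G))) := by
    rw [← map_add]
    simp
  rw [e3]
  simp only [add_apply, ContinuousLinearMap.comp_apply, map_add, r2, r3, map_zero] at r4 ⊢
  simp only [ContinuousLinearMap.inl_apply, ContinuousLinearMap.inr_apply] at r4 ⊢
  linarith

end General

/-! ### Coordinates of subquotients -/

namespace QuotChart

variable {E H : Type*} [NormedAddCommGroup E] [NormedSpace ℝ E] [TopologicalSpace H]
  {N : Type*} [TopologicalSpace N] [ChartedSpace H N] {I : ModelWithCorners ℝ E H}
  {C : Set N} {X : Type*} {q : C → X} {G : Type*} [NormedAddCommGroup G] [NormedSpace ℝ G]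
  [TopologicalSpace X]

lemma q_mem_source (Q : QuotChart I q G) (hq : Topology.IsQuotientMap q) (x₀ : X) (z : C) :
    q z ∈ (Q.chart hq x₀).source ↔ z.1 ∈ Q.src :=
  ⟨fun h => Q.preimage_src.subset h, fun h => ⟨z, h, rfl⟩⟩

omit [TopologicalSpace X] in
lemma up_fn (Q : QuotChart I q G) (x₀ : X) {z : C} (hz : z.1 ∈ Q.src) :
    Q.up x₀ (Q.fn z.1) = q z := by
  rw [Q.up_of x₀ (Q.fn_mem z hz)]
  exact Q.sec_fn z hz

variable [ChartedSpace G X] [IsManifold 𝓘(ℝ, G) ∞ X]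

/-- Any chart of a subquotient is a coordinate system for the smooth structure given by a family
of charts of the subquotient. -/
def coord (Q : QuotChart I q G) (hq : Topology.IsQuotientMap q)
    (hX : ∀ x : X, ∃ Q' : QuotChart I q G, chartAt G x = Q'.chart hq x) (x₀ : X) :
    Coord 𝓘(ℝ, G) X G where
  src := (Q.chart hq x₀).source
  tgt := Q.tgt
  fn := Q.down hq
  inv := Q.up x₀
  open_src := (Q.chart hq x₀).open_source
  open_tgt := Q.open_tgt
  map_src := fun _ h => (Q.chart hq x₀).map_source h
  map_tgt := fun _ h => (Q.chart hq x₀).map_target h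
  left_inv := fun _ h => (Q.chart hq x₀).left_inv h
  right_inv := fun _ h => (Q.chart hq x₀).right_inv h
  smooth_fn := by
    intro x hx
    apply ContMDiffAt.contMDiffWithinAt
    obtain ⟨Q', hQ'⟩ := hX x
    have h1 : ContMDiffOn 𝓘(ℝ, G) 𝓘(ℝ, G) ∞ (fun y => Q.fn (Q'.sec y))
        (Q'.tgt ∩ Q'.sec ⁻¹' Q.src) :=
      Q.smooth_fn.comp (Q'.smooth_sec.mono inter_subset_left) fun y hy => hy.2
    have h2 : ContMDiffOn 𝓘(ℝ, G) 𝓘(ℝ, G) ∞ (Q'.chart hq x) (Q'.chart hq x).source := by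
      rw [← hQ']
      exact contMDiffOn_chart
    have hs := (Q.chart hq x₀).open_source.inter (Q'.chart hq x).open_source
    have hx' : x ∈ (Q'.chart hq x).source := by
      rw [← hQ']
      exact mem_chart_source G x
    have hm : ∀ z : C, z.1 ∈ Q.src → z.1 ∈ Q'.src → Q'.sec (Q'.fn z.1) ∈ Q.src ∧
        Q.fn z.1 = Q.fn (Q'.sec (Q'.fn z.1)) := fun z hz hz' =>
      Q.sat z ⟨_, Q'.sec_mem _ (Q'.fn_mem z hz')⟩ (Q'.sec_fn z hz').symm hz
    have h3 : ContMDiffOn 𝓘(ℝ, G) 𝓘(ℝ, G) ∞ (fun w => Q.fn (Q'.sec (Q'.chart hq x w)))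
        ((Q.chart hq x₀).source ∩ (Q'.chart hq x).source) := by
      refine h1.comp (h2.mono inter_subset_right) ?_
      rintro _ ⟨⟨z, hz, rfl⟩, hz'⟩
      have hz' := (Q'.q_mem_source hq x z).1 hz'
      have e : (Q'.chart hq x) (q z) = Q'.fn z.1 := Q'.down_q hq hz'
      rw [mem_preimage, e]
      exact ⟨Q'.fn_mem z hz', (hm z hz hz').1⟩
    refine (h3.congr ?_).contMDiffAt (hs.mem_nhds ⟨hx, hx'⟩)
    rintro _ ⟨⟨z, hz, rfl⟩, hz'⟩
    have hz' := (Q'.q_mem_source hq x z).1 hz'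
    have e : (Q'.chart hq x) (q z) = Q'.fn z.1 := Q'.down_q hq hz'
    rw [e, Q.down_q hq hz]
    exact (hm z hz hz').2
  smooth_inv := by
    intro y hy
    apply ContMDiffAt.contMDiffWithinAt
    let x := Q.up x₀ y
    have ex : x = q ⟨Q.sec y, Q.sec_mem y hy⟩ := Q.up_of x₀ hy
    obtain ⟨Q', hQ'⟩ := hX x
    have h1 : ContMDiffOn 𝓘(ℝ, G) 𝓘(ℝ, G) ∞ (fun y => Q'.fn (Q.sec y))
        (Q.tgt ∩ Q.sec ⁻¹' Q'.src) :=
      Q'.smooth_fn.comp (Q.smooth_sec.mono inter_subset_left) fun y hy => hy.2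
    have h2 : ContMDiffOn 𝓘(ℝ, G) 𝓘(ℝ, G) ∞ (Q'.chart hq x).symm (Q'.chart hq x).target := by
      rw [← hQ']
      exact contMDiffOn_chart_symm
    have hx' : x ∈ (Q'.chart hq x).source := by
      rw [← hQ']
      exact mem_chart_source G x
    have hy' : Q.sec y ∈ Q'.src := by
      rw [ex] at hx'
      exact (Q'.q_mem_source hq _ _).1 hx'
    have hs : IsOpen (Q.tgt ∩ Q.sec ⁻¹' Q'.src) :=
      Q.smooth_sec.continuousOn.isOpen_inter_preimage Q.open_tgt Q'.open_src
    have h3 := h2.comp h1 fun z hz => Q'.fn_mem ⟨Q.sec z, Q.sec_mem z hz.1⟩ hz.2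
    refine (h3.congr fun z hz => ?_).contMDiffAt (hs.mem_nhds ⟨hy, hy'⟩)
    rw [Q.up_of x₀ hz.1]
    exact (Q'.up_fn x (z := ⟨Q.sec z, Q.sec_mem z hz.1⟩) hz.2).symm

variable (Q : QuotChart I q G) (hq : Topology.IsQuotientMap q)
  (hX : ∀ x : X, ∃ Q' : QuotChart I q G, chartAt G x = Q'.chart hq x) (x₀ : X)

lemma coord_mem (z : C) : q z ∈ (Q.coord hq hX x₀).src ↔ z.1 ∈ Q.src :=
  Q.q_mem_source hq x₀ z

lemma coord_fn {z : C} (hz : z.1 ∈ Q.src) : (Q.coord hq hX x₀).fn (q z) = Q.fn z.1 :=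
  Q.down_q hq hz

end QuotChart

/-! ### Adapted coordinates of the bundles and quotients -/

section Spaces

variable {n : ℕ} {M : Type*} [TopologicalSpace M]
  [ChartedSpace (EuclideanSpace ℝ (Fin (n + 1))) M] [IsManifold (𝓡 (n + 1)) ∞ M]
  (π : Fibration n M) {φ : Coord (𝓡 (n + 1)) M (ℝ × Fib n)}
  (h : ∀ x ∈ φ.src, (φ.fn x).1 = π.toFun x)

/-- The coordinates `((t, q), p)` of `V*π`. -/
def VStar.coord (a : VStar π) : Coord 𝓘(ℝ, VModel n) (VStar π) (VModel n) :=
  (VStar.quotChart π φ h).coord (muUniv_isQuotientMap π) (fun _ => ⟨_, rfl⟩) a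

lemma VStar.coord_mu_mem (a : VStar π) (α : CotBundle (𝓡 (n + 1)) M) :
    mu π α ∈ (VStar.coord π h a).src ↔ α ∈ φ.cot.src :=
  QuotChart.coord_mem _ _ _ _ (⟨α, mem_univ _⟩ : (univ : Set (CotBundle (𝓡 (n + 1)) M)))

lemma VStar.mem_coord (a b : VStar π) : b ∈ (VStar.coord π h a).src ↔ b.base ∈ φ.src := by
  obtain ⟨α, rfl⟩ := mu_surjective π b
  exact VStar.coord_mu_mem π h a α

/-- `μ` maps `((t, q), (p_t, p))` to `((t, q), p)`. -/
def muLin (n : ℕ) : ((ℝ × Fib n) × CovM n) →L[ℝ] VModel n :=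
  (ContinuousLinearMap.id ℝ (ℝ × Fib n)).prodMap
    (ContinuousLinearMap.precomp ℝ (ContinuousLinearMap.inr ℝ ℝ (Fib n)))

lemma affineIn_mu (a : VStar π) :
    Coord.AffineIn φ.cot (VStar.coord π h a) (mu π) (muLin n) 0 where
  mem_iff := VStar.coord_mu_mem π h a
  eq α hα := ((VStar.quotChart π φ h).coord_fn (muUniv_isQuotientMap π) _ a
    (z := ⟨α, mem_univ _⟩) hα).trans (add_zero _).symm

lemma VStar.coord_fst (a b : VStar π) (hb : b ∈ (VStar.coord π h a).src) :
    ((VStar.coord π h a).fn b).1.1 = piOneStar π b := by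
  obtain ⟨α, rfl⟩ := mu_surjective π b
  have hα : α ∈ φ.cot.src := (VStar.coord_mu_mem π h a α).1 hb
  rw [(affineIn_mu π h a).eq α hα]
  exact (congrArg Prod.fst (add_zero (φ.fn α.1))).trans (h _ hα)

/-- The coordinates `(((t, q), p), (q', p'))` of `J¹π₁*`. -/
def Jet.coord (w : Jet π) : Coord 𝓘(ℝ, JModel n) (Jet π) (JModel n) :=
  (Jet.quotChart π (VStar.coord π h w.1.1) (VStar.coord_fst π h w.1.1)).coord
    Topology.IsQuotientMap.id (fun _ => ⟨_, rfl⟩) w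

/-- The coordinates `(((t, q), (p_t, p)), (P_(t, q), P_p))` of `{γ(V_μ) = 1}`. -/
def Level.coord (Γ : Level π) : Coord 𝓘(ℝ, LModel n) (Level π) (LModel n) :=
  (Level.quotChart π φ h).coord Topology.IsQuotientMap.id (fun _ => ⟨_, rfl⟩) Γ

/-- The coordinates `(((t, q), p), (P_(t, q), P_p))` of `Pμ`. -/
def PMu.coord (z : PMu π) : Coord 𝓘(ℝ, PModel n) (PMu π) (PModel n) :=
  (PMu.quotChart π φ h).coord (PMu.mk_isQuotientMap π) (fun _ => ⟨_, rfl⟩) z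

/-- The coordinates `(((t, q), p), (P_q, P_p))` of `Pμ/⟨dπ₁*⟩`. -/
def PMuQuot.coord (z : PMuQuot π) : Coord 𝓘(ℝ, RModel n) (PMuQuot π) (RModel n) :=
  (PMuQuot.quotChart π φ h).coord (PMuQuot.mkL_isQuotientMap π) (fun _ => ⟨_, rfl⟩) z

/-- The preferred chart of `V*π` comes from the chosen adapted coordinates. -/
lemma VStar.ext_eq_coord (a : VStar π) : Coord.ext 𝓘(ℝ, VModel n) a =
    VStar.coord π (π.adapted_fst a.base) a := by
  unfold Coord.ext VStar.coord QuotChart.coord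
  congr 1
  · simp only [mfld_simps]; rfl
  · simp only [mfld_simps]; rfl

lemma PMu.ext_eq_coord (z : PMu π) : Coord.ext 𝓘(ℝ, PModel n) z =
    PMu.coord π (π.adapted_fst (PMu.rep π z).1.1.1) z := by
  unfold Coord.ext PMu.coord QuotChart.coord
  congr 1
  · simp only [mfld_simps]; rfl
  · simp only [mfld_simps]; rfl

end Spaces

section Spaces

variable {n : ℕ} {M : Type*} [TopologicalSpace M]
  [ChartedSpace (EuclideanSpace ℝ (Fin (n + 1))) M] [IsManifold (𝓡 (n + 1)) ∞ M]
  (π : Fibration n M) {φ : Coord (𝓡 (n + 1)) M (ℝ × Fib n)}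
  (h : ∀ x ∈ φ.src, (φ.fn x).1 = π.toFun x)

/-! ### The inclusions and projections in coordinates -/

/-- The linear part of the inclusion of `J¹π₁*` in `T(V*π)`. -/
def jetLin (n : ℕ) : JModel n →L[ℝ] VModel n × VModel n :=
  (ContinuousLinearMap.id ℝ (VModel n)).prodMap
    ((ContinuousLinearMap.inr ℝ ℝ (Fib n)).prodMap (ContinuousLinearMap.id ℝ (Fib n →L[ℝ] ℝ)))

@[simp] lemma jetLin_apply (z : JModel n) : jetLin n z = (z.1, ((0, z.2.1), z.2.2)) := rfl

lemma Jet.mem_coord (w w' : Jet π) : w' ∈ (Jet.coord π h w).src ↔ w'.1.1.base ∈ φ.src :=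
  (QuotChart.coord_mem (q := (id : Jet π → Jet π)) _ _ _ _ w').trans
    (VStar.mem_coord π h w.1.1 w'.1.1)

/-- The translation part of the inclusion is `∂_t`, since `dπ₁*(w) = 1`. -/
lemma affineIn_jet (w : Jet π) :
    Coord.AffineIn (Jet.coord π h w) (VStar.coord π h w.1.1).tan (fun w : Jet π => w.1)
      (jetLin n) (0, ((1, 0), 0)) where
  mem_iff w' := (VStar.mem_coord π h w.1.1 w'.1.1).trans (Jet.mem_coord π h w w').symm
  eq w' hw' := by
    set ψ := VStar.coord π h w.1.1
    set Q := Jet.quotChart π ψ (VStar.coord_fst π h w.1.1)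
    have hs : w'.1 ∈ ψ.tan.src :=
      (VStar.mem_coord π h w.1.1 w'.1.1).2 ((Jet.mem_coord π h w w').1 hw')
    have e1 : (ψ.tanFn w'.1).2.1.1 = 1 :=
      (dpiOneStar_eq π (VStar.coord_fst π h w.1.1) hs _).symm.trans w'.2
    have e2 : (Jet.coord π h w).fn w' =
        ((ψ.tanFn w'.1).1, ((ψ.tanFn w'.1).2.1.2, (ψ.tanFn w'.1).2.2)) :=
      Q.coord_fn _ _ _ hs
    rw [e2]
    change ψ.tanFn w'.1 = _
    ext <;> simp [e1]

/-- The linear part of the inclusion of `{γ(V_μ) = 1}` in `T*(T*M)`. -/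
def levelLin (n : ℕ) : LModel n →L[ℝ]
    ((ℝ × Fib n) × CovM n) × (((ℝ × Fib n) × CovM n) →L[ℝ] ℝ) :=
  (ContinuousLinearMap.id ℝ ((ℝ × Fib n) × CovM n)).prodMap
    ((ContinuousLinearMap.precomp ℝ (ContinuousLinearMap.fst ℝ (ℝ × Fib n) (CovM n))).coprod
      (ContinuousLinearMap.precomp ℝ
        ((ContinuousLinearMap.precomp ℝ (ContinuousLinearMap.inr ℝ ℝ (Fib n))).comp
          (ContinuousLinearMap.snd ℝ (ℝ × Fib n) (CovM n)))))

lemma ofL_eq (z : LModel n) : ofL z = levelLin n z +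
    (0, (ContinuousLinearMap.apply ℝ ℝ ((1 : ℝ), (0 : Fib n))).comp
      (ContinuousLinearMap.snd ℝ (ℝ × Fib n) (CovM n))) := by
  refine Prod.ext (add_zero _).symm (ContinuousLinearMap.ext fun w => ?_)
  exact (add_assoc _ _ _).symm

lemma Level.coord_mem (Γ Γ' : Level π) :
    Γ' ∈ (Level.coord π h Γ).src ↔ Γ'.1.1.1 ∈ φ.src :=
  QuotChart.coord_mem _ _ _ _ Γ'

lemma Level.coord_fn (Γ : Level π) {Γ' : Level π} (hΓ : Γ'.1.1.1 ∈ φ.src) :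
    (Level.coord π h Γ).fn Γ' = toL (φ.cot.cotFn Γ'.1) :=
  (Level.quotChart π φ h).coord_fn _ _ _ hΓ

/-- The translation part of the inclusion is `dp_t`, since `V_μ = ∂_{p_t}` and `γ(V_μ) = 1`. -/
lemma affineIn_level (Γ : Level π) :
    Coord.AffineIn (Level.coord π h Γ) φ.cot.cot (fun γ : Level π => γ.1) (levelLin n)
      (0, (ContinuousLinearMap.apply ℝ ℝ ((1 : ℝ), (0 : Fib n))).comp
        (ContinuousLinearMap.snd ℝ (ℝ × Fib n) (CovM n))) where
  mem_iff Γ' := (Level.coord_mem π h Γ Γ').symm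
  eq Γ' hΓ' := by
    have hs := (Level.coord_mem π h Γ Γ').1 hΓ'
    rw [Level.coord_fn π h Γ hs, ← ofL_eq, ofL_toL _ ((hatVMu_eq π h hs).symm.trans Γ'.2)]
    rfl

lemma PMu.coord_mem (z : PMu π) (Γ : Level π) :
    PMu.mk π Γ ∈ (PMu.coord π h z).src ↔ Γ.1.1.1 ∈ φ.src :=
  QuotChart.coord_mem _ _ _ _ Γ

lemma PMu.coord_fn (z : PMu π) {Γ : Level π} (hΓ : Γ.1.1.1 ∈ φ.src) :
    (PMu.coord π h z).fn (PMu.mk π Γ) = Level.pFn φ Γ.1 :=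
  (PMu.quotChart π φ h).coord_fn _ _ _ hΓ

/-- The projection of `{γ(V_μ) = 1}` to `Pμ` forgets the coordinate `p_t`. -/
def mkLin (n : ℕ) : LModel n →L[ℝ] PModel n :=
  (muLin n).prodMap (ContinuousLinearMap.id ℝ (CovM n × ((Fib n →L[ℝ] ℝ) →L[ℝ] ℝ)))

lemma affineIn_mk (Γ : Level π) (z : PMu π) :
    Coord.AffineIn (Level.coord π h Γ) (PMu.coord π h z) (PMu.mk π) (mkLin n) 0 where
  mem_iff Γ' := (PMu.coord_mem π h z Γ').trans (Level.coord_mem π h Γ Γ').symm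
  eq Γ' hΓ' := by
    have hs := (Level.coord_mem π h Γ Γ').1 hΓ'
    rw [Level.coord_fn π h Γ hs, PMu.coord_fn π h z hs, add_zero]
    rfl

lemma PMuQuot.coord_mem (z : PMuQuot π) (Γ : Level π) :
    PMuQuot.mkL π Γ ∈ (PMuQuot.coord π h z).src ↔ Γ.1.1.1 ∈ φ.src :=
  QuotChart.coord_mem _ _ _ _ Γ

lemma PMuQuot.coord_fn (z : PMuQuot π) {Γ : Level π} (hΓ : Γ.1.1.1 ∈ φ.src) :
    (PMuQuot.coord π h z).fn (PMuQuot.mkL π Γ) = Level.rFn φ Γ.1 :=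
  (PMuQuot.quotChart π φ h).coord_fn _ _ _ hΓ

/-- The projection of `Pμ` to `Pμ/⟨dπ₁*⟩` forgets the coordinate `P_t`. -/
def quotLin (n : ℕ) : PModel n →L[ℝ] RModel n :=
  (ContinuousLinearMap.id ℝ (VModel n)).prodMap
    ((ContinuousLinearMap.precomp ℝ (ContinuousLinearMap.inr ℝ ℝ (Fib n))).prodMap
      (ContinuousLinearMap.id ℝ ((Fib n →L[ℝ] ℝ) →L[ℝ] ℝ)))

lemma affineIn_quot (z : PMu π) (y : PMuQuot π) :
    Coord.AffineIn (PMu.coord π h z) (PMuQuot.coord π h y) (PMuQuot.mk π) (quotLin n) 0 where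
  mem_iff z' := by
    obtain ⟨Γ, rfl⟩ := (PMu.mk_isQuotientMap π).surjective z'
    exact (PMuQuot.coord_mem π h y Γ).trans (PMu.coord_mem π h z Γ).symm
  eq z' hz' := by
    obtain ⟨Γ, rfl⟩ := (PMu.mk_isQuotientMap π).surjective z'
    have hs := (PMu.coord_mem π h z Γ).1 hz'
    rw [PMu.coord_fn π h z hs, add_zero]
    exact PMuQuot.coord_fn π h y hs

/-! ### The map `φ = Tμ ∘ b_Ω⁻¹` -/

/-- In coordinates, `φ` maps `γ = P_t dt + P_q dq + dp_t + P_p dp` to the tangent vector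
`∂_t + P_p ∂_q - P_q ∂_p`, that is, the projection of the image of `γ` under the inverse of the
canonical symplectic form. -/
lemma tanFn_phi (a : VStar π) {Γ : Level π} (hΓ : Γ.1.1.1 ∈ φ.src) :
    (VStar.coord π h a).tanFn (phi π Γ) =
      (muLin n (φ.cot.cotFn Γ.1).1, muLin n (cotSharp (ℝ × Fib n) (φ.cot.cotFn Γ.1).2)) := by
  have hα : Γ.1.1 ∈ φ.cot.src := hΓ
  have hm := affineIn_mu π h a
  refine Prod.ext ((hm.eq _ hα).trans (add_zero _)) ?_
  have e1 := hm.dfn_dmap_apply hα ((canonicalForm (𝓡 (n + 1)) (N := M) Γ.1.1).inverse Γ.1.2)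
  refine Eq.trans e1 (congrArg (muLin n) ?_)
  exact (φ.hasForm_canonicalForm).dfn_inverse cotForm_cotSharp cotSharp_cotForm hα Γ.1.2

/-- The coordinates `P ↦ ∂_t + P_p ∂_q - P_q ∂_p` of the projected Hamiltonian vector. -/
lemma muLin_cotSharp (P : ((ℝ × Fib n) × CovM n) →L[ℝ] ℝ) (hP : P (dirV n) = 1) :
    muLin n (cotSharp (ℝ × Fib n) P) =
      ((1, (bidual (Fib n)).symm ((P.comp (ContinuousLinearMap.inr ℝ (ℝ × Fib n) (CovM n))).comp
        (ContinuousLinearMap.precomp ℝ (ContinuousLinearMap.snd ℝ ℝ (Fib n))))),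
        -(P.comp (ContinuousLinearMap.inl ℝ (ℝ × Fib n) (CovM n))).comp
          (ContinuousLinearMap.inr ℝ ℝ (Fib n))) := by
  have e : ∀ p : CovM n, p (cotSharp (ℝ × Fib n) P).1 = P (0, p) := fun p =>
    apply_bidual_symm _ _
  refine Prod.ext (Prod.ext ?_ ?_) rfl
  · exact (e (ContinuousLinearMap.fst ℝ ℝ (Fib n))).trans hP
  · refine (SeparatingDual.eq_iff_forall_dual_eq (R := ℝ)).2 fun d => ?_
    rw [apply_bidual_symm]
    exact e (d.comp (ContinuousLinearMap.snd ℝ ℝ (Fib n)))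

lemma phi_mem (Γ : Level π) : phi π Γ ∈ JetSet π := by
  have h := π.adapted_fst Γ.1.1.1
  have hΓ := π.mem_adapted Γ.1.1.1
  have e := tanFn_phi π h (phi π Γ).1 hΓ
  rw [muLin_cotSharp _ ((hatVMu_eq π h hΓ).symm.trans Γ.2)] at e
  refine (dpiOneStar_eq π (VStar.coord_fst π h (phi π Γ).1)
    ((VStar.mem_coord π h _ _).2 hΓ) _).trans ?_
  exact congrArg (fun z : VModel n × VModel n => z.2.1.1) e

/-- The map `φ` with values in `J¹π₁*`. -/
def phiJet (Γ : Level π) : Jet π := ⟨phi π Γ, phi_mem π Γ⟩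

lemma phiJet_mem_coord (w : Jet π) (Γ : Level π) :
    phiJet π Γ ∈ (Jet.coord π h w).src ↔ Γ.1.1.1 ∈ φ.src :=
  Jet.mem_coord π h w _

/-- The diffeomorphism `Pμ/⟨dπ₁*⟩ → J¹π₁*` induced by `φ` is `(P_q, P_p) ↦ (q', p')` with
`q' = P_p` and `p' = -P_q` in coordinates. -/
def phiLin (n : ℕ) : RModel n ≃L[ℝ] JModel n :=
  (ContinuousLinearEquiv.refl ℝ (VModel n)).prodCongr
    ((ContinuousLinearEquiv.prodComm ℝ (Fib n →L[ℝ] ℝ) ((Fib n →L[ℝ] ℝ) →L[ℝ] ℝ)).trans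
      ((bidual (Fib n)).symm.prodCongr (ContinuousLinearEquiv.neg ℝ)))

lemma coord_phiJet (w : Jet π) {Γ : Level π} (hΓ : Γ.1.1.1 ∈ φ.src) :
    (Jet.coord π h w).fn (phiJet π Γ) = phiLin n (Level.rFn φ Γ.1) := by
  have hs : (phiJet π Γ).1 ∈ (VStar.coord π h w.1.1).tan.src :=
    (VStar.mem_coord π h w.1.1 (mu π Γ.1.1)).2 hΓ
  have e := tanFn_phi π h w.1.1 hΓ
  rw [muLin_cotSharp _ ((hatVMu_eq π h hΓ).symm.trans Γ.2)] at e
  have e2 := (Jet.quotChart π (VStar.coord π h w.1.1) (VStar.coord_fst π h w.1.1)).coord_fn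
    Topology.IsQuotientMap.id (fun _ => ⟨_, rfl⟩) w (z := phiJet π Γ) hs
  refine e2.trans ?_
  exact congrArg (fun z : VModel n × VModel n => ((z.1, (z.2.1.2, z.2.2)) : JModel n)) e

/-- The map `Pμ/⟨dπ₁*⟩ → J¹π₁*` induced by `φ`. -/
def phiQuot (z : PMuQuot π) : Jet π := phiJet π (PMuQuot.rep π z)

lemma PMuQuot.mkL_rep (z : PMuQuot π) : PMuQuot.mkL π (PMuQuot.rep π z) = z :=
  (congrArg (PMuQuot.mk π) (Quot.out_eq (Quot.out z))).trans (Quot.out_eq z)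

/-- The map `φ` is constant on the classes of `Pμ/⟨dπ₁*⟩`. -/
lemma phiQuot_mkL (Γ : Level π) : phiQuot π (PMuQuot.mkL π Γ) = phiJet π Γ := by
  have h := π.adapted_fst Γ.1.1.1
  have hΓ := π.mem_adapted Γ.1.1.1
  obtain ⟨h1, h2⟩ := PMuQuot.sat π h (PMuQuot.mkL_rep π (PMuQuot.mkL π Γ)).symm hΓ
  let w := phiJet π Γ
  refine (Jet.coord π h w).eq_of_fn_eq ((phiJet_mem_coord π h w _).2 h1)
    ((phiJet_mem_coord π h w _).2 hΓ) ?_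
  refine (coord_phiJet π h w h1).trans ?_
  rw [coord_phiJet π h w hΓ, h2]

lemma affineIn_phiQuot (z : PMuQuot π) (w : Jet π) :
    Coord.AffineIn (PMuQuot.coord π h z) (Jet.coord π h w) (phiQuot π)
      (phiLin n : RModel n →L[ℝ] JModel n) 0 where
  mem_iff z' := by
    obtain ⟨Γ, rfl⟩ := (PMuQuot.mkL_isQuotientMap π).surjective z'
    rw [phiQuot_mkL]
    exact (phiJet_mem_coord π h w Γ).trans (PMuQuot.coord_mem π h z Γ).symm
  eq z' hz' := by
    obtain ⟨Γ, rfl⟩ := (PMuQuot.mkL_isQuotientMap π).surjective z'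
    have hs := (PMuQuot.coord_mem π h z Γ).1 hz'
    rw [phiQuot_mkL, coord_phiJet π h w hs, PMuQuot.coord_fn π h z hs, add_zero]
    rfl

lemma phiQuot_bijective : Function.Bijective (phiQuot π) := by
  constructor
  · intro z z' e
    obtain ⟨Γ, rfl⟩ := (PMuQuot.mkL_isQuotientMap π).surjective z
    have h := π.adapted_fst Γ.1.1.1
    let w := phiJet π Γ
    have hA := affineIn_phiQuot π h (PMuQuot.mkL π Γ) w
    have h1 := (PMuQuot.coord_mem π h (PMuQuot.mkL π Γ) Γ).2 (π.mem_adapted Γ.1.1.1)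
    have h2 := (hA.mem_iff z').1 (e ▸ (hA.mem_iff _).2 h1)
    refine (PMuQuot.coord π h (PMuQuot.mkL π Γ)).eq_of_fn_eq h1 h2 ((phiLin n).injective ?_)
    have e1 := hA.eq _ h1
    rw [e, hA.eq z' h2, add_zero, add_zero] at e1
    exact e1.symm
  · intro w
    have h := π.adapted_fst w.1.1.base
    have hw : w ∈ (Jet.coord π h w).src := (Jet.mem_coord π h w w).2 (π.mem_adapted _)
    have ht := (Jet.coord π h w).map_src w hw
    set z : RModel n := (phiLin n).symm ((Jet.coord π h w).fn w) with hz
    have hz' : z.1.1 ∈ (π.adapted w.1.1.base).tgt := ht.1.1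
    let Γ : Level π := ⟨Level.rInv (π.adapted w.1.1.base) z, hatVMu_ofL π h hz'⟩
    have hΓ : Γ.1.1.1 ∈ (π.adapted w.1.1.base).src := (π.adapted w.1.1.base).map_tgt _ hz'
    refine ⟨PMuQuot.mkL π Γ, ?_⟩
    rw [phiQuot_mkL]
    refine (Jet.coord π h w).eq_of_fn_eq ((phiJet_mem_coord π h w Γ).2 hΓ) hw ?_
    rw [coord_phiJet π h w hΓ, show Level.rFn _ Γ.1 = z from Level.rFn_rInv hz', hz,
      ContinuousLinearEquiv.apply_symm_apply]

/-- The diffeomorphism `b_π`, the inverse of the map induced by `φ`. -/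
def bPi : Diffeomorph 𝓘(ℝ, JModel n) 𝓘(ℝ, RModel n) (Jet π) (PMuQuot π) ∞ where
  toEquiv := (Equiv.ofBijective _ (phiQuot_bijective π)).symm
  contMDiff_toFun w := by
    have h := π.adapted_fst w.1.1.base
    exact (affineIn_phiQuot π h ((Equiv.ofBijective _ (phiQuot_bijective π)).symm w) w).symm
      (f := Equiv.ofBijective _ (phiQuot_bijective π)) |>.contMDiffAt
        ((Jet.mem_coord π h w w).2 (π.mem_adapted _))
  contMDiff_invFun z := by
    obtain ⟨Γ, rfl⟩ := (PMuQuot.mkL_isQuotientMap π).surjective z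
    have h := π.adapted_fst Γ.1.1.1
    exact (affineIn_phiQuot π h (PMuQuot.mkL π Γ) (phiJet π Γ)).contMDiffAt
      ((PMuQuot.coord_mem π h _ Γ).2 (π.mem_adapted _))

end Spaces

/-! ### The constant tensors -/

section Constants

variable (n : ℕ)

/-- The bivector `∂_q ∧ ∂_p` of `V*π`. -/
def sharpV : (VModel n →L[ℝ] ℝ) →L[ℝ] VModel n :=
  ((0 : (VModel n →L[ℝ] ℝ) →L[ℝ] ℝ).prod ((bidual (Fib n)).symm.toContinuousLinearMap.comp
      (ContinuousLinearMap.precomp ℝ (ContinuousLinearMap.inr ℝ (ℝ × Fib n) (Fib n →L[ℝ] ℝ))))).prod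
    (-ContinuousLinearMap.precomp ℝ ((ContinuousLinearMap.inl ℝ (ℝ × Fib n) (Fib n →L[ℝ] ℝ)).comp
      (ContinuousLinearMap.inr ℝ ℝ (Fib n))))

/-- The bivector `∂_q ∧ ∂_{p'} + ∂_{q'} ∧ ∂_p` of `J¹π₁*`. -/
def sharpJ : (JModel n →L[ℝ] ℝ) →L[ℝ] JModel n :=
  ((sharpV n).comp (ContinuousLinearMap.precomp ℝ
      ((ContinuousLinearMap.inr ℝ (VModel n) (Fib n × (Fib n →L[ℝ] ℝ))).comp
        ((ContinuousLinearMap.snd ℝ ℝ (Fib n)).prodMap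
          (ContinuousLinearMap.id ℝ (Fib n →L[ℝ] ℝ)))))).prod
    (((ContinuousLinearMap.snd ℝ ℝ (Fib n)).prodMap
      (ContinuousLinearMap.id ℝ (Fib n →L[ℝ] ℝ))).comp
      ((sharpV n).comp (ContinuousLinearMap.precomp ℝ
        (ContinuousLinearMap.inl ℝ (VModel n) (Fib n × (Fib n →L[ℝ] ℝ))))))

/-- The `1`-form `P_t dt + P_q dq + P_p dp` of `Pμ`, as a linear map from points to covectors. -/
def phaseLiouville : PModel n →L[ℝ] PModel n →L[ℝ] ℝ :=
  ((ContinuousLinearMap.precomp ℝ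
    (ContinuousLinearMap.fst ℝ (VModel n) (CovM n × ((Fib n →L[ℝ] ℝ) →L[ℝ] ℝ)))).comp
    ((ContinuousLinearMap.precomp ℝ (ContinuousLinearMap.fst ℝ (ℝ × Fib n) (Fib n →L[ℝ] ℝ))).coprod
      (ContinuousLinearMap.precomp ℝ
        (ContinuousLinearMap.snd ℝ (ℝ × Fib n) (Fib n →L[ℝ] ℝ))))).comp
    (ContinuousLinearMap.snd ℝ (VModel n) (CovM n × ((Fib n →L[ℝ] ℝ) →L[ℝ] ℝ)))

/-- The symplectic form `dt ∧ dP_t + dq ∧ dP_q + dp ∧ dP_p` of `Pμ`. -/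
def formP : PModel n →L[ℝ] PModel n →L[ℝ] ℝ :=
  (phaseLiouville n).flip - phaseLiouville n

/-- The inverse of `formP`. -/
def sharpP : (PModel n →L[ℝ] ℝ) →L[ℝ] PModel n :=
  let inV := ContinuousLinearMap.inl ℝ (VModel n) (CovM n × ((Fib n →L[ℝ] ℝ) →L[ℝ] ℝ))
  let inP := ContinuousLinearMap.inr ℝ (VModel n) (CovM n × ((Fib n →L[ℝ] ℝ) →L[ℝ] ℝ))
  (((bidual (ℝ × Fib n)).symm.toContinuousLinearMap.comp (ContinuousLinearMap.precomp ℝ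
      (inP.comp (ContinuousLinearMap.inl ℝ (CovM n) ((Fib n →L[ℝ] ℝ) →L[ℝ] ℝ))))).prod
    (ContinuousLinearMap.precomp ℝ
      ((inP.comp (ContinuousLinearMap.inr ℝ (CovM n) ((Fib n →L[ℝ] ℝ) →L[ℝ] ℝ))).comp
        (bidual (Fib n) : Fib n →L[ℝ] (Fib n →L[ℝ] ℝ) →L[ℝ] ℝ)))).prod
  ((-ContinuousLinearMap.precomp ℝ
      (inV.comp (ContinuousLinearMap.inl ℝ (ℝ × Fib n) (Fib n →L[ℝ] ℝ)))).prod
    (-ContinuousLinearMap.precomp ℝ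
      (inV.comp (ContinuousLinearMap.inr ℝ (ℝ × Fib n) (Fib n →L[ℝ] ℝ)))))

/-- The bivector `∂_q ∧ ∂_{P_q} + ∂_p ∧ ∂_{P_p}` of `Pμ/⟨dπ₁*⟩`. -/
def sharpR : (RModel n →L[ℝ] ℝ) →L[ℝ] RModel n :=
  (quotLin n).comp ((sharpP n).comp (ContinuousLinearMap.precomp ℝ (quotLin n)))

variable {n}

@[simp] lemma sharpV_apply (b : VModel n →L[ℝ] ℝ) : sharpV n b =
    ((0, (bidual (Fib n)).symm (b.comp (ContinuousLinearMap.inr ℝ (ℝ × Fib n) (Fib n →L[ℝ] ℝ)))),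
      -b.comp ((ContinuousLinearMap.inl ℝ (ℝ × Fib n) (Fib n →L[ℝ] ℝ)).comp
        (ContinuousLinearMap.inr ℝ ℝ (Fib n)))) := rfl

lemma formP_apply (v w : PModel n) : formP n v w =
    (w.2.1 v.1.1 + w.2.2 v.1.2) - (v.2.1 w.1.1 + v.2.2 w.1.2) := rfl

lemma formP_sharpP (b : PModel n →L[ℝ] ℝ) : formP n (sharpP n b) = b := by
  refine ContinuousLinearMap.ext fun w => ?_
  obtain ⟨⟨y, p⟩, ⟨P, x⟩⟩ := w
  obtain ⟨q, rfl⟩ := (bidual (Fib n)).surjective x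
  have e1 : P (sharpP n b).1.1 = b (0, (P, 0)) := apply_bidual_symm _ _
  have e2 : bidual (Fib n) q (sharpP n b).1.2 = b (0, (0, bidual (Fib n) q)) := rfl
  have e3 : (sharpP n b).2.1 y = -b ((y, 0), 0) := rfl
  have e4 : (sharpP n b).2.2 p = -b ((0, p), 0) := rfl
  have e5 : (((y, p), (P, bidual (Fib n) q)) : PModel n) =
      ((y, 0), 0) + ((0, p), 0) + ((0, (P, 0)) + (0, (0, bidual (Fib n) q))) := by simp
  rw [formP_apply, e1, e2, e3, e4, e5, map_add, map_add, map_add]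
  ring

lemma formP_self (v : PModel n) : formP n v v = 0 := by rw [formP_apply, sub_self]

lemma formP_injective : Function.Injective (formP n) := by
  intro v v' hv
  have key : ∀ (d : PModel n →L[ℝ] ℝ) (u : PModel n), d u = -formP n u (sharpP n d) := by
    intro d u
    conv_lhs => rw [← formP_sharpP d]
    rw [formP_apply, formP_apply]
    ring
  refine (SeparatingDual.eq_iff_forall_dual_eq (R := ℝ)).2 fun d => ?_
  exact (key d v).trans ((congrArg (fun f => -f (sharpP n d)) hv).trans (key d v').symm)

lemma sharpP_formP (v : PModel n) : sharpP n (formP n v) = v :=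
  formP_injective (formP_sharpP _)

lemma muLin_cotSharp_comp (b : VModel n →L[ℝ] ℝ) :
    muLin n (cotSharp (ℝ × Fib n) (b.comp (muLin n))) = sharpV n b := by
  have e : ∀ p : CovM n, p (cotSharp (ℝ × Fib n) (b.comp (muLin n))).1 =
    b (0, p.comp (ContinuousLinearMap.inr ℝ ℝ (Fib n))) := fun p => apply_bidual_symm _ _
  refine Prod.ext (Prod.ext ?_ ?_) ?_
  · refine (e (ContinuousLinearMap.fst ℝ ℝ (Fib n))).trans ?_
    rw [ContinuousLinearMap.fst_comp_inr]
    exact map_zero b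
  · refine (SeparatingDual.eq_iff_forall_dual_eq (R := ℝ)).2 fun d => ?_
    refine (e (d.comp (ContinuousLinearMap.snd ℝ ℝ (Fib n)))).trans ?_
    rw [sharpV_apply, apply_bidual_symm]
    rfl
  · refine ContinuousLinearMap.ext fun v => ?_
    change -b ((0, v), 0) = -b ((0, v), 0)
    rfl

/-- The bivector of `J¹π₁*` is the restriction of the complete lift of that of `V*π`. -/
lemma jetLin_sharpJ (B : (VModel n × VModel n) →L[ℝ] ℝ) :
    jetLin n (sharpJ n (B.comp (jetLin n))) = tanSharp (sharpV n) B := by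
  refine Prod.ext ?_ ?_
  · refine Prod.ext (Prod.ext rfl ?_) ?_
    · refine (SeparatingDual.eq_iff_forall_dual_eq (R := ℝ)).2 fun d => ?_
      exact (apply_bidual_symm _ _).trans (apply_bidual_symm _ _).symm
    · rfl
  · refine Prod.ext (Prod.ext rfl ?_) ?_
    · refine (SeparatingDual.eq_iff_forall_dual_eq (R := ℝ)).2 fun d => ?_
      exact (apply_bidual_symm _ _).trans (apply_bidual_symm _ _).symm
    · rfl

lemma formP_mkLin (v w : LModel n) :
    (cotForm ((ℝ × Fib n) × CovM n)).bilinearComp (levelLin n) (levelLin n) v w =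
      formP n (mkLin n v) (mkLin n w) := rfl

/-- The coefficients of the two Poisson structures are opposite under the diffeomorphism
`q' = P_p`, `p' = -P_q`. -/
lemma phiLin_sharpJ (b : RModel n →L[ℝ] ℝ) :
    (phiLin n).symm ((-sharpJ n) (b.comp ((phiLin n).symm : JModel n →L[ℝ] RModel n))) =
      sharpR n b := by
  have e : ∀ p : CovM n, p (sharpR n b).1.1 =
      b (0, (p.comp (ContinuousLinearMap.inr ℝ ℝ (Fib n)), 0)) := fun p => apply_bidual_symm _ _
  set c := b.comp ((phiLin n).symm : JModel n →L[ℝ] RModel n)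
  have hc' : ∀ a q p, c (a, (q, p)) = b (a, (-p, bidual (Fib n) q)) := fun a q p => rfl
  refine Prod.ext (Prod.ext (Prod.ext ?_ ?_) ?_) (Prod.ext ?_ ?_)
  · refine Eq.trans ?_ (e (ContinuousLinearMap.fst ℝ ℝ (Fib n))).symm
    rw [ContinuousLinearMap.fst_comp_inr]
    exact neg_zero.trans (map_zero b).symm
  · refine (SeparatingDual.eq_iff_forall_dual_eq (R := ℝ)).2 fun d => ?_
    refine Eq.trans ?_ (e (d.comp (ContinuousLinearMap.snd ℝ ℝ (Fib n)))).symm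
    have e1 : d (-(sharpJ n c).1.1.2) = -c (0, (0, d)) :=
      (map_neg d _).trans (congrArg Neg.neg (apply_bidual_symm _ _))
    refine e1.trans ?_
    rw [hc', ← map_neg, map_zero]
    congr 1
    refine Prod.ext neg_zero (Prod.ext (neg_neg d) neg_zero)
  · refine ContinuousLinearMap.ext fun v => ?_
    change - -c (0, (v, 0)) = b (0, (0, bidual (Fib n) v))
    rw [neg_neg, hc', neg_zero]
  · refine ContinuousLinearMap.ext fun v => ?_
    change - - -c (((0, v), 0), (0, 0)) = -b (((0, v), 0), (0, 0))
    rw [neg_neg, hc', neg_zero, map_zero]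
  · refine ContinuousLinearMap.ext fun p => ?_
    have e1 : p (-(sharpJ n c).2.1) = -c ((0, p), (0, 0)) :=
      (map_neg p _).trans (congrArg Neg.neg (apply_bidual_symm _ _))
    refine e1.trans ?_
    rw [hc', neg_zero, map_zero]
    rfl

lemma apply_sharpP_self (a : PModel n →L[ℝ] ℝ) : a (sharpP n a) = 0 := by
  rw [← formP_self (sharpP n a), formP_sharpP]

lemma apply_sharpR_self (a : RModel n →L[ℝ] ℝ) : a (sharpR n a) = 0 :=
  apply_sharpP_self (a.comp (quotLin n))

lemma apply_sharpJ_self (a : JModel n →L[ℝ] ℝ) : a (sharpJ n a) = 0 := by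
  have e := apply_sharpR_self (a.comp (phiLin n : RModel n →L[ℝ] JModel n))
  rw [← phiLin_sharpJ] at e
  have e1 : (a.comp (phiLin n : RModel n →L[ℝ] JModel n)).comp
      ((phiLin n).symm : JModel n →L[ℝ] RModel n) = a :=
    ContinuousLinearMap.ext fun v => congrArg a ((phiLin n).apply_symm_apply v)
  rw [e1] at e
  have e2 : a (phiLin n ((phiLin n).symm ((-sharpJ n) a))) = 0 := e
  rw [ContinuousLinearEquiv.apply_symm_apply] at e2
  exact neg_eq_zero.1 ((map_neg a (sharpJ n a)).symm.trans e2)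

lemma apply_sharpV_self (a : VModel n →L[ℝ] ℝ) : a (sharpV n a) = 0 := by
  rw [← muLin_cotSharp_comp]
  change (a.comp (muLin n)) _ = 0
  rw [← cotForm_cotSharp (a.comp (muLin n)), cotSharp_cotForm, cotForm_apply, sub_self]

end Constants

section Fields

variable {n : ℕ} {M : Type*} [TopologicalSpace M]
  [ChartedSpace (EuclideanSpace ℝ (Fin (n + 1))) M] [IsManifold (𝓡 (n + 1)) ∞ M]
  (π : Fibration n M)

/-! ### The canonical tensor fields -/

/-- The canonical Poisson structure of `V*π`. -/
def bivV : BivField 𝓘(ℝ, VModel n) (VStar π) :=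
  Coord.pushBiv (cotModel (𝓡 (n + 1))) 𝓘(ℝ, VModel n) (mu_surjective π)
    (bivOfForm (canonicalForm (𝓡 (n + 1))))

lemma hasBiv_cot (φ : Coord (𝓡 (n + 1)) M (ℝ × Fib n)) :
    φ.cot.HasBiv (bivOfForm (canonicalForm (𝓡 (n + 1)) (N := M))) (cotSharp (ℝ × Fib n)) :=
  φ.hasForm_canonicalForm.hasBiv cotForm_cotSharp cotSharp_cotForm

lemma hasBiv_bivV {φ : Coord (𝓡 (n + 1)) M (ℝ × Fib n)}
    (h : ∀ x ∈ φ.src, (φ.fn x).1 = π.toFun x) (a : VStar π) :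
    (VStar.coord π h a).HasBiv (bivV π) (sharpV n) :=
  (hasBiv_cot φ).push (affineIn_mu π h a) _ muLin_cotSharp_comp

lemma isPoisson_bivV : IsPoisson 𝓘(ℝ, VModel n) (bivV π) :=
  isPoisson_of_hasBiv apply_sharpV_self fun a => ⟨VStar.coord π (π.adapted_fst a.base) a,
    (VStar.mem_coord π _ a a).2 (π.mem_adapted _), hasBiv_bivV π _ a⟩

/-- The canonical Poisson structure of `T*M` has a unique projection to `V*π`. -/
theorem isPoissonMap_mu_iff (Λ : BivField 𝓘(ℝ, VModel n) (VStar π)) :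
    IsPoissonMap (cotModel (𝓡 (n + 1))) 𝓘(ℝ, VModel n) (mu π)
      (bivOfForm (canonicalForm (𝓡 (n + 1)))) Λ ↔ Λ = bivV π := by
  have key : ∀ α a b, bivV π (mu π α) a b = bivOfForm (canonicalForm (𝓡 (n + 1))) α
      (a.comp (dmap (cotModel (𝓡 (n + 1))) 𝓘(ℝ, VModel n) (mu π) α))
      (b.comp (dmap (cotModel (𝓡 (n + 1))) 𝓘(ℝ, VModel n) (mu π) α)) := fun α a b =>
    (hasBiv_cot _).map_eq (hasBiv_bivV π (π.adapted_fst α.1) (mu π α)) (affineIn_mu π _ _)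
      muLin_cotSharp_comp (π.mem_adapted α.1) a b
  constructor
  · rintro ⟨-, h⟩
    refine funext fun x => ?_
    obtain ⟨α, rfl⟩ := mu_surjective π x
    exact ContinuousLinearMap.ext fun a => ContinuousLinearMap.ext fun b =>
      (h α a b).trans (key α a b).symm
  · rintro rfl
    exact ⟨mu_contMDiff π, key⟩

lemma hasBiv_completeLift {φ : Coord (𝓡 (n + 1)) M (ℝ × Fib n)}
    (h : ∀ x ∈ φ.src, (φ.fn x).1 = π.toFun x) (a : VStar π) :
    (VStar.coord π h a).tan.HasBiv (completeLift 𝓘(ℝ, VModel n) (bivV π))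
      (tanSharp (sharpV n)) :=
  (hasBiv_bivV π h a).completeLift fun b => by
    rw [VStar.ext_eq_coord]
    exact hasBiv_bivV π _ b

lemma exists_leftInverse_jet (w : Jet π) : ∃ r : VModel n × VModel n →L[ℝ] JModel n,
    ∀ v, r (dmap 𝓘(ℝ, JModel n) 𝓘(ℝ, VModel n).tangent (fun w : Jet π => w.1) w v) = v :=
  (affineIn_jet π (π.adapted_fst w.1.1.base) w).exists_leftInverse
    (k := (ContinuousLinearMap.id ℝ (VModel n)).prodMap
      ((ContinuousLinearMap.snd ℝ ℝ (Fib n)).prodMap (ContinuousLinearMap.id ℝ (Fib n →L[ℝ] ℝ))))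
    (fun _ => rfl) ((Jet.mem_coord π _ w w).2 (π.mem_adapted _))

/-- The Poisson structure of `J¹π₁*`. -/
def bivJ : BivField 𝓘(ℝ, JModel n) (Jet π) :=
  Coord.pullBiv 𝓘(ℝ, JModel n) 𝓘(ℝ, VModel n).tangent (fun w : Jet π => w.1)
    (fun w => (exists_leftInverse_jet π w).choose) (completeLift 𝓘(ℝ, VModel n) (bivV π))

lemma hasBiv_bivJ {φ : Coord (𝓡 (n + 1)) M (ℝ × Fib n)}
    (h : ∀ x ∈ φ.src, (φ.fn x).1 = π.toFun x) (w : Jet π) :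
    (Jet.coord π h w).HasBiv (bivJ π) (sharpJ n) :=
  (hasBiv_completeLift π h w.1.1).pull (affineIn_jet π h w)
    (fun w => (exists_leftInverse_jet π w).choose_spec) jetLin_sharpJ

lemma isPoisson_bivJ : IsPoisson 𝓘(ℝ, JModel n) (bivJ π) :=
  isPoisson_of_hasBiv apply_sharpJ_self fun w => ⟨Jet.coord π (π.adapted_fst w.1.1.base) w,
    (Jet.mem_coord π _ w w).2 (π.mem_adapted _), hasBiv_bivJ π _ w⟩

/-- The complete lift is tangent to `J¹π₁*`, and its restriction is unique because each covector of
`J¹π₁*` extends to `T(V*π)`. -/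
theorem isPoissonMap_jet_iff (Λ : BivField 𝓘(ℝ, JModel n) (Jet π)) :
    IsPoissonMap 𝓘(ℝ, JModel n) 𝓘(ℝ, VModel n).tangent (fun w : Jet π => w.1) Λ
      (completeLift 𝓘(ℝ, VModel n) (bivV π)) ↔ Λ = bivJ π := by
  constructor
  · rintro ⟨-, h⟩
    refine funext fun w => ContinuousLinearMap.ext fun a => ContinuousLinearMap.ext fun b => ?_
    have hr := (exists_leftInverse_jet π w).choose_spec
    set r := (exists_leftInverse_jet π w).choose
    have e : ∀ a : JModel n →L[ℝ] ℝ, (a.comp r).comp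
        (dmap 𝓘(ℝ, JModel n) 𝓘(ℝ, VModel n).tangent (fun w : Jet π => w.1) w) = a := fun a =>
      ContinuousLinearMap.ext fun v => congrArg a (hr v)
    have h1 := h w (a.comp r) (b.comp r)
    rw [e, e] at h1
    exact h1.symm
  · rintro rfl
    have hm : ∀ w : Jet π, w ∈ (Jet.coord π (π.adapted_fst w.1.1.base) w).src := fun w =>
      (Jet.mem_coord π _ w w).2 (π.mem_adapted _)
    exact ⟨fun w => (affineIn_jet π _ w).contMDiffAt (hm w), fun w a b =>
      (hasBiv_bivJ π _ w).map_eq (hasBiv_completeLift π _ w.1.1) (affineIn_jet π _ w)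
        jetLin_sharpJ (hm w) a b⟩

/-- The restriction to `{γ(V_μ) = 1}` of the canonical symplectic form of `T*(T*M)`. -/
def formL : FormField 𝓘(ℝ, LModel n) (Level π) :=
  pullbackForm 𝓘(ℝ, LModel n) (cotModel (cotModel (𝓡 (n + 1)))) (fun γ : Level π => γ.1)
    (canonicalForm (cotModel (𝓡 (n + 1))))

lemma hasForm_formL {φ : Coord (𝓡 (n + 1)) M (ℝ × Fib n)}
    (h : ∀ x ∈ φ.src, (φ.fn x).1 = π.toFun x) (Γ : Level π) :
    (Level.coord π h Γ).HasForm (formL π)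
      ((cotForm ((ℝ × Fib n) × CovM n)).bilinearComp (levelLin n) (levelLin n)) :=
  φ.cot.hasForm_canonicalForm.pullback (affineIn_level π h Γ)

lemma exists_rightInverse_mk (Γ : Level π) : ∃ s : PModel n →L[ℝ] LModel n,
    ∀ v, dmap 𝓘(ℝ, LModel n) 𝓘(ℝ, PModel n) (PMu.mk π) Γ (s v) = v :=
  (affineIn_mk π (π.adapted_fst Γ.1.1.1) Γ (PMu.mk π Γ)).exists_rightInverse
    (k := ((ContinuousLinearMap.id ℝ (ℝ × Fib n)).prodMap
      (ContinuousLinearMap.precomp ℝ (ContinuousLinearMap.snd ℝ ℝ (Fib n)))).prodMap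
      (ContinuousLinearMap.id ℝ (CovM n × ((Fib n →L[ℝ] ℝ) →L[ℝ] ℝ))))
    (fun _ => rfl) ((Level.coord_mem π _ Γ Γ).2 (π.mem_adapted _))

/-- The canonical symplectic form of `Pμ`. -/
def formPMu : FormField 𝓘(ℝ, PModel n) (PMu π) :=
  Coord.pushForm 𝓘(ℝ, LModel n) 𝓘(ℝ, PModel n) (PMu.mk_isQuotientMap π).surjective
    (fun Γ => (exists_rightInverse_mk π Γ).choose) (formL π)

lemma hasForm_formPMu {φ : Coord (𝓡 (n + 1)) M (ℝ × Fib n)}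
    (h : ∀ x ∈ φ.src, (φ.fn x).1 = π.toFun x) (z : PMu π) :
    (PMu.coord π h z).HasForm (formPMu π) (formP n) :=
  (hasForm_formL π h (PMu.rep π z)).push (affineIn_mk π h _ z) _
    (fun Γ => (exists_rightInverse_mk π Γ).choose_spec) formP_mkLin

lemma isSymplectic_formPMu : IsSymplectic 𝓘(ℝ, PModel n) (formPMu π) :=
  isSymplectic_of_hasForm formP_self formP_injective fun z => by
    rw [PMu.ext_eq_coord]
    exact hasForm_formPMu π _ z

/-- The restriction of the canonical symplectic form of `T*(T*M)` descends to a unique form on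
`Pμ`. -/
theorem pullbackForm_mk_iff (Ω : FormField 𝓘(ℝ, PModel n) (PMu π)) :
    (∀ Γ, pullbackForm 𝓘(ℝ, LModel n) 𝓘(ℝ, PModel n) (PMu.mk π) Ω Γ = formL π Γ) ↔
      Ω = formPMu π := by
  have key : ∀ Γ, pullbackForm 𝓘(ℝ, LModel n) 𝓘(ℝ, PModel n) (PMu.mk π) (formPMu π) Γ =
      formL π Γ := by
    intro Γ
    have h := π.adapted_fst Γ.1.1.1
    have hΓ := (Level.coord_mem π h Γ Γ).2 (π.mem_adapted _)
    refine ContinuousLinearMap.ext fun v => ContinuousLinearMap.ext fun w => ?_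
    rw [hasForm_formL π h Γ Γ hΓ, formP_mkLin]
    exact (hasForm_formPMu π h (PMu.mk π Γ)).pullback (affineIn_mk π h Γ _) Γ hΓ v w
  constructor
  · intro h
    refine funext fun z => ?_
    obtain ⟨Γ, rfl⟩ := (PMu.mk_isQuotientMap π).surjective z
    obtain ⟨s, hs⟩ := exists_rightInverse_mk π Γ
    refine ContinuousLinearMap.ext fun v => ContinuousLinearMap.ext fun w => ?_
    have e := DFunLike.congr_fun (DFunLike.congr_fun ((h Γ).trans (key Γ).symm) (s v)) (s w)
    change Ω _ (dmap 𝓘(ℝ, LModel n) 𝓘(ℝ, PModel n) (PMu.mk π) Γ (s v))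
      (dmap 𝓘(ℝ, LModel n) 𝓘(ℝ, PModel n) (PMu.mk π) Γ (s w)) = formPMu π _
      (dmap 𝓘(ℝ, LModel n) 𝓘(ℝ, PModel n) (PMu.mk π) Γ (s v))
      (dmap 𝓘(ℝ, LModel n) 𝓘(ℝ, PModel n) (PMu.mk π) Γ (s w)) at e
    rwa [hs, hs] at e
  · rintro rfl
    exact key

lemma hasBiv_formPMu {φ : Coord (𝓡 (n + 1)) M (ℝ × Fib n)}
    (h : ∀ x ∈ φ.src, (φ.fn x).1 = π.toFun x) (z : PMu π) :
    (PMu.coord π h z).HasBiv (bivOfForm (formPMu π)) (sharpP n) :=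
  (hasForm_formPMu π h z).hasBiv formP_sharpP sharpP_formP

lemma PMuQuot.mk_surjective : Function.Surjective (PMuQuot.mk π) := Quot.mk_surjective

/-- The Poisson structure of `Pμ/⟨dπ₁*⟩`. -/
def bivR : BivField 𝓘(ℝ, RModel n) (PMuQuot π) :=
  Coord.pushBiv 𝓘(ℝ, PModel n) 𝓘(ℝ, RModel n) (PMuQuot.mk_surjective π)
    (bivOfForm (formPMu π))

lemma hasBiv_bivR {φ : Coord (𝓡 (n + 1)) M (ℝ × Fib n)}
    (h : ∀ x ∈ φ.src, (φ.fn x).1 = π.toFun x) (z : PMuQuot π) :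
    (PMuQuot.coord π h z).HasBiv (bivR π) (sharpR n) :=
  (hasBiv_formPMu π h (Quot.out z)).push (affineIn_quot π h _ z) _ fun _ => rfl

lemma isPoisson_bivR : IsPoisson 𝓘(ℝ, RModel n) (bivR π) :=
  isPoisson_of_hasBiv apply_sharpR_self fun z => by
    obtain ⟨Γ, rfl⟩ := (PMuQuot.mkL_isQuotientMap π).surjective z
    exact ⟨PMuQuot.coord π (π.adapted_fst Γ.1.1.1) (PMuQuot.mkL π Γ),
      (PMuQuot.coord_mem π _ _ Γ).2 (π.mem_adapted _), hasBiv_bivR π _ _⟩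

/-- The Poisson structure of `Pμ` has a unique projection to `Pμ/⟨dπ₁*⟩`. -/
theorem isPoissonMap_quot_iff (Λ : BivField 𝓘(ℝ, RModel n) (PMuQuot π)) :
    IsPoissonMap 𝓘(ℝ, PModel n) 𝓘(ℝ, RModel n) (PMuQuot.mk π) (bivOfForm (formPMu π)) Λ ↔
      Λ = bivR π := by
  have hA := fun Γ : Level π => affineIn_quot π (π.adapted_fst Γ.1.1.1) (PMu.mk π Γ)
    (PMuQuot.mk π (PMu.mk π Γ))
  have hm := fun Γ : Level π =>
    (PMu.coord_mem π (π.adapted_fst Γ.1.1.1) (PMu.mk π Γ) Γ).2 (π.mem_adapted _)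
  have key : ∀ z a b, bivR π (PMuQuot.mk π z) a b = bivOfForm (formPMu π) z
      (a.comp (dmap 𝓘(ℝ, PModel n) 𝓘(ℝ, RModel n) (PMuQuot.mk π) z))
      (b.comp (dmap 𝓘(ℝ, PModel n) 𝓘(ℝ, RModel n) (PMuQuot.mk π) z)) := by
    intro z a b
    obtain ⟨Γ, rfl⟩ := (PMu.mk_isQuotientMap π).surjective z
    exact (hasBiv_formPMu π _ _).map_eq (hasBiv_bivR π _ _) (hA Γ) (fun _ => rfl) (hm Γ) a b
  constructor
  · rintro ⟨-, h⟩
    refine funext fun x => ?_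
    obtain ⟨z, rfl⟩ := PMuQuot.mk_surjective π x
    exact ContinuousLinearMap.ext fun a => ContinuousLinearMap.ext fun b =>
      (h z a b).trans (key z a b).symm
  · rintro rfl
    refine ⟨fun z => ?_, key⟩
    obtain ⟨Γ, rfl⟩ := (PMu.mk_isQuotientMap π).surjective z
    exact (hA Γ).contMDiffAt (hm Γ)

theorem isAntiPoissonMap_bPi :
    IsAntiPoissonMap 𝓘(ℝ, JModel n) 𝓘(ℝ, RModel n) (bPi π) (bivJ π) (bivR π) := by
  refine ⟨(bPi π).contMDiff, fun w a b => ?_⟩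
  have h := π.adapted_fst w.1.1.base
  have hJ : (Jet.coord π h w).HasBiv (-bivJ π) (-sharpJ n) := fun x hx a b => by
    have e := hasBiv_bivJ π h w x hx a b
    change -(bivJ π x _ _) = a (-(sharpJ n b))
    rw [e, map_neg]
  have hA := (affineIn_phiQuot π h (bPi π w) w).symm
    (f := Equiv.ofBijective _ (phiQuot_bijective π))
  exact hJ.map_eq (hasBiv_bivR π h (bPi π w)) hA phiLin_sharpJ
    ((Jet.mem_coord π h w w).2 (π.mem_adapted _)) a b

lemma bPi_symm_mk (Γ : Level π) :
    ((bPi π).symm (PMuQuot.mk π (PMu.mk π Γ))).1 = phi π Γ :=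
  congrArg Subtype.val (phiQuot_mkL π Γ)

end Fields

end Tulczyjew

end

theorem theoremt1 {n : ℕ} {M : Type*} [TopologicalSpace M]
    [ChartedSpace (EuclideanSpace ℝ (Fin (n + 1))) M] [IsManifold (𝓡 (n + 1)) ∞ M]
    (π : Fibration n M) :
    ∃ (ΛV : BivField 𝓘(ℝ, VModel n) (VStar π)) (ΛJ : BivField 𝓘(ℝ, JModel n) (Jet π))
      (ΩP : FormField 𝓘(ℝ, PModel n) (PMu π)) (ΛR : BivField 𝓘(ℝ, RModel n) (PMuQuot π))
      (b : Diffeomorph 𝓘(ℝ, JModel n) 𝓘(ℝ, RModel n) (Jet π) (PMuQuot π) ∞),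
      -- `ΛV` is the canonical Poisson structure of `V*π`, the projection of that of `T*M`
      (∀ Λ, IsPoissonMap (cotModel (𝓡 (n + 1))) 𝓘(ℝ, VModel n) (mu π)
        (bivOfForm (canonicalForm (𝓡 (n + 1)))) Λ ↔ Λ = ΛV) ∧
      IsPoisson 𝓘(ℝ, VModel n) ΛV ∧
      -- `ΛJ` is the restriction to `J¹π₁*` of the complete lift of `ΛV` to `T(V*π)`
      (∀ Λ, IsPoissonMap 𝓘(ℝ, JModel n) 𝓘(ℝ, VModel n).tangent (fun w : Jet π => w.1)
        Λ (completeLift 𝓘(ℝ, VModel n) ΛV) ↔ Λ = ΛJ) ∧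
      IsPoisson 𝓘(ℝ, JModel n) ΛJ ∧
      -- `ΩP` is the canonical symplectic form of `Pμ`: it pulls back to `{γ(V_μ) = 1}` as the
      -- restriction of the canonical symplectic form of `T*(T*M)`
      (∀ Ω, (∀ Γ, pullbackForm 𝓘(ℝ, LModel n) 𝓘(ℝ, PModel n) (PMu.mk π) Ω Γ =
          pullbackForm 𝓘(ℝ, LModel n) (cotModel (cotModel (𝓡 (n + 1)))) (fun γ : Level π => γ.1)
            (canonicalForm (cotModel (𝓡 (n + 1)))) Γ) ↔ Ω = ΩP) ∧
      IsSymplectic 𝓘(ℝ, PModel n) ΩP ∧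
      -- `ΛR` is the projection to `Pμ/⟨dπ₁*⟩` of the Poisson structure of `(Pμ, ΩP)`
      (∀ Λ, IsPoissonMap 𝓘(ℝ, PModel n) 𝓘(ℝ, RModel n) (PMuQuot.mk π) (bivOfForm ΩP) Λ ↔
        Λ = ΛR) ∧
      IsPoisson 𝓘(ℝ, RModel n) ΛR ∧
      -- `b` is the inverse of the map `Pμ/⟨dπ₁*⟩ → J¹π₁*` induced by `φ = Tμ ∘ b_Ω⁻¹`
      (∀ Γ : Level π, (b.symm (PMuQuot.mk π (PMu.mk π Γ))).1 = phi π Γ) ∧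
      IsAntiPoissonMap 𝓘(ℝ, JModel n) 𝓘(ℝ, RModel n) b ΛJ ΛR := by
  exact ⟨bivV π, bivJ π, formPMu π, bivR π, bPi π, isPoissonMap_mu_iff π, isPoisson_bivV π,
    isPoissonMap_jet_iff π, isPoisson_bivJ π, pullbackForm_mk_iff π, isSymplectic_formPMu π,
    isPoissonMap_quot_iff π, isPoisson_bivR π, bPi_symm_mk π, isAntiPoissonMap_bPi π⟩
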